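/- Let $\Lambda\subset\mathbb{R}^d$ be a lattice of full rank (for instance $\Lambda=\mathbb{Z}^d$), let $\mathcal{M}=\mathbb{R}^d/\Lambda$ be the associated torus, whose functions are identified with the $\Lambda$-periodic functions on $\mathbb{R}^d$, let $V\in C^\infty(\mathcal{M})$ and $\beta>0$, and set $\mathcal{L}\varphi=-\beta\nabla V\cdot\nabla\varphi+\Delta\varphi$. For a time step $\Delta t>0$, $q\in\mathbb{R}^d$ and $g\in\mathbb{R}^d$, let $\tilde q=\Phi_{\Delta t}(q,g)$ be given either by the midpoint proposal $$\tilde q=q-\beta\Delta t\,\nabla V\Big(\frac{\tilde q+q}{2}\Big)+\sqrt{2\Delta t}\,g$$ (an implicit equation), or by the HMC proposal $$\tilde q=q-\beta\Delta t\,\nabla V\Big(q+\frac{\sqrt{2\Delta t}}{2}g\Big)+\sqrt{2\Delta t}\,g .$$ For the midpoint proposal set $$\alpha_{\Delta t}(q,g)=\beta\big(V(\tilde q)-V(q)\big)+\frac{1}{4\Delta t}\Big(\Big|q-\tilde q+\beta\Delta t\,\nabla V\Big(\frac{q+\tilde q}{2}\Big)\Big|^2-\Big|\tilde q-q+\beta\Delta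 t\,\nabla V\Big(\frac{q+\tilde q}{2}\Big)\Big|^2\Big),$$ and for the HMC proposal set $$\alpha_{\Delta t}(q,g)=\beta\big(V(\tilde q)-V(q)\big)+\frac12\Big(\Big|g-\sqrt{2\Delta t}\,\beta\nabla V\Big(q+\frac{\sqrt{2\Delta t}}{2}g\Big)\Big|^2-|g|^2\Big).$$ The acceptance rate is $A_{\Delta t}(q,g)=\min(1,e^{-\alpha_{\Delta t}(q,g)})$ for the Metropolis rule, and $A_{\Delta t}(q,g)=e^{-\alpha_{\Delta t}(q,g)}/(1+e^{-\alpha_{\Delta t}(q,g)})$ for the Barker rule. For a function $\psi$ on $\mathcal{M}$ define $$P_{\Delta t}\psi(q)=\mathbb{E}\Big[\psi\Big(q+\mathbf{1}_{U\le A_{\Delta t}(q,G)}\big(\Phi_{\Delta t}(q,G)-q\big)\Big)\Big],$$ where $G$ is a standard $d$-dimensional Gaussian random variable and $U$ is an independent random variable uniformly distributed on $[0,1]$. Then, for either proposal and either acceptance rule, and for every $\psi\in C^\infty(\mathcal{M})$, there exist $\Delta t^*>0$ and $C\ge 0$ such that, for every $0<\Delta t\le\Delta t^*$, the proposal $\Phi_{\Delta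 t}(q,g)$ is well defined for all $q,g$ (its defining equation has exactly one solution $\tilde q\in\mathbb{R}^d$), the expectation defining $P_{\Delta t}\psi(q)$ makes sense for all $q$, and $$\frac{P_{\Delta t}-\mathrm{Id}}{\Delta t}\psi=a\Big(\mathcal{L}\psi+\frac{\Delta t}{2}\mathcal{L}^2\psi\Big)+\Delta t^{\alpha}\,r_{\psi,\Delta t}$$ on $\mathcal{M}$, where $r_{\psi,\Delta t}$ is a measurable function on $\mathcal{M}$ with $\sup_{\mathcal M}|r_{\psi,\Delta t}|\le C$. Here $a=1/2$, $\alpha=2$ for the Barker rule, and $a=1$, $\alpha=3/2$ for the Metropolis rule. -/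

import Mathlib

open MeasureTheory ProbabilityTheory
open scoped ContDiff Gradient Laplacian RealInnerProductSpace

noncomputable section

/-- The space `ℝ^d` with its Euclidean norm. -/
abbrev Euc (d : ℕ) : Type := EuclideanSpace ℝ (Fin d)

/-- `f` is periodic for the lattice `ℤ b₁ + ⋯ + ℤ b_d`; such functions are the functions on the
torus `ℝ^d / (ℤ b₁ + ⋯ + ℤ b_d)`. -/
def LatticePeriodic {d : ℕ} (b : Module.Basis (Fin d) ℝ (Euc d)) (f : Euc d → ℝ) : Prop :=
  ∀ i, Function.Periodic f (b i)

/-- `f` is a smooth function on the torus `ℝ^d / (ℤ b₁ + ⋯ + ℤ b_d)`. -/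
def SmoothOnTorus {d : ℕ} (b : Module.Basis (Fin d) ℝ (Euc d)) (f : Euc d → ℝ) : Prop :=
  ContDiff ℝ ∞ f ∧ LatticePeriodic b f

/-- The generator `𝓛 φ = -β ∇Vᵀ ∇φ + Δ φ` of the overdamped Langevin dynamics. -/
def langevinGenerator {d : ℕ} (β : ℝ) (V φ : Euc d → ℝ) : Euc d → ℝ :=
  fun q => -β * ⟪∇ V q, ∇ φ q⟫ + Δ φ q

/-- The two proposals. -/
inductive Proposal
  | midpoint
  | hmc

/-- The two acceptance rules. -/
inductive AcceptanceRule
  | metropolis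
  | barker

/-- `Q` is a proposed move from `q` with Gaussian increment `g` and time step `dt`
(an implicit equation on `Q` for the midpoint proposal). -/
def IsProposedMove {d : ℕ} (β : ℝ) (V : Euc d → ℝ) (dt : ℝ) (q g : Euc d) :
    Proposal → Euc d → Prop
  | .midpoint, Q => Q = q - (β * dt) • ∇ V ((1 / 2 : ℝ) • (Q + q)) + √(2 * dt) • g
  | .hmc, Q => Q = q - (β * dt) • ∇ V (q + (√(2 * dt) / 2) • g) + √(2 * dt) • g

open Classical in
/-- The proposal function `Φ_dt(q, g)`. The value `q` in the second case is a convention, which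
is never used when the proposal is well defined. -/
def proposalMap {d : ℕ} (S : Proposal) (β : ℝ) (V : Euc d → ℝ) (dt : ℝ) (q g : Euc d) : Euc d :=
  if h : ∃ Q, IsProposedMove β V dt q g S Q then h.choose else q

/-- The exponent `α_dt(q, q')` in the acceptance rate of the midpoint proposal. -/
def alphaMidpoint {d : ℕ} (β : ℝ) (V : Euc d → ℝ) (dt : ℝ) (q q' : Euc d) : ℝ :=
  β * (V q' - V q) + 1 / (4 * dt) *
    (‖q - q' + (β * dt) • ∇ V ((1 / 2 : ℝ) • (q + q'))‖ ^ 2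
      - ‖q' - q + (β * dt) • ∇ V ((1 / 2 : ℝ) • (q + q'))‖ ^ 2)

/-- The exponent `α_dt(q, Φ_dt(q, g))` in the acceptance rate of the move from `q` with Gaussian
increment `g`. -/
def alphaExponent {d : ℕ} (S : Proposal) (β : ℝ) (V : Euc d → ℝ) (dt : ℝ) (q g : Euc d) : ℝ :=
  match S with
  | .midpoint => alphaMidpoint β V dt q (proposalMap .midpoint β V dt q g)
  | .hmc => β * (V (proposalMap .hmc β V dt q g) - V q) +
      1 / 2 * (‖g - (√(2 * dt) * β) • ∇ V (q + (√(2 * dt) / 2) • g)‖ ^ 2 - ‖g‖ ^ 2)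

/-- The acceptance rate as a function of the exponent `x`. -/
def AcceptanceRule.rate : AcceptanceRule → ℝ → ℝ
  | .metropolis, x => min 1 (Real.exp (-x))
  | .barker, x => Real.exp (-x) / (1 + Real.exp (-x))

/-- The acceptance rate `A_dt(q, Φ_dt(q, g))`. -/
def acceptanceRate {d : ℕ} (S : Proposal) (R : AcceptanceRule) (β : ℝ) (V : Euc d → ℝ) (dt : ℝ)
    (q g : Euc d) : ℝ :=
  R.rate (alphaExponent S β V dt q g)

open Classical in
/-- One step `Ψ_dt(q, g, u) = q + 1_{u ≤ A_dt(q, Φ_dt(q, g))} (Φ_dt(q, g) - q)` of the chain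
(before reprojection to the torus, which periodic functions do not see). -/
def chainStep {d : ℕ} (S : Proposal) (R : AcceptanceRule) (β : ℝ) (V : Euc d → ℝ) (dt : ℝ)
    (q g : Euc d) (u : ℝ) : Euc d :=
  q + (if u ≤ acceptanceRate S R β V dt q g then (1 : ℝ) else 0) • (proposalMap S β V dt q g - q)

/-- The joint law of the standard Gaussian increment `G` and of the independent uniform variable
`U` on `[0, 1]`. -/
def noiseLaw (d : ℕ) : Measure (Euc d × ℝ) :=
  (stdGaussian (Euc d)).prod (volume.restrict (Set.Icc (0 : ℝ) 1))

/-- The evolution operator `P_dt ψ(q) = 𝔼[ψ(Ψ_dt(q, G, U))]`. -/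
def evolution {d : ℕ} (S : Proposal) (R : AcceptanceRule) (β : ℝ) (V : Euc d → ℝ) (dt : ℝ)
    (ψ : Euc d → ℝ) (q : Euc d) : ℝ :=
  ∫ z, ψ (chainStep S R β V dt q z.1 z.2) ∂(noiseLaw d)

/-- The discrete generator `(P_dt - Id) / dt`. -/
def discreteGenerator {d : ℕ} (S : Proposal) (R : AcceptanceRule) (β : ℝ) (V : Euc d → ℝ)
    (dt : ℝ) (ψ : Euc d → ℝ) (q : Euc d) : ℝ :=
  (evolution S R β V dt ψ q - ψ q) / dt

/-- The prefactor `a`. -/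
def AcceptanceRule.prefactor : AcceptanceRule → ℝ
  | .metropolis => 1
  | .barker => 1 / 2

/-- The order `α` of the remainder. -/
def AcceptanceRule.order : AcceptanceRule → ℝ
  | .metropolis => 3 / 2
  | .barker => 2

end

/-! Put `h = √(2Δt)` and `Φ = -βV`. Both proposals move `q` by `δ = h g + (h²/2) ∇Φ(q + m)` with `m
= (h/2) g + (ε h²/4) ∇Φ(q + m)`, where `ε = 1` for the midpoint proposal and `ε = 0` for HMC. Both
exponents equal `⟪∇Φ(q + m), δ⟫ - (Φ(q + δ) - Φ(q))`, the error of a midpoint-type quadrature of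
`∇Φ` along the move; it is of order `h³` (`approxExponent_isBigO`). Integrating out the uniform
variable, `P ψ - ψ` is the Gaussian mean of the rate times the increment `D` of `ψ`.

The rate at `x` is `2a(1/2 - x/4) - κ|x|/2 + O(x²)`, with `κ = 1` for Metropolis and `κ = 0` for
Barker (`AcceptanceRule.abs_rate_sub_le`). The Gaussian law is even, so one may average over `g` and
`-g`, which amounts to averaging over `h` and `-h`. The smooth part becomes even in `h`: its odd
powers disappear and its remainder after `h⁴` is `O(h⁶)`. The kink `|α| D` starts at `h⁴` with a
coefficient odd in `g`; this cancels too, but the next term `h⁵` survives. Division by `Δt` turns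
`h⁶` into `Δt²` and `h⁵` into `Δt^(3/2)`, which is the difference between the two rules.

It remains to average the coefficients of `h²` and `h⁴`. Wick's formula gives multiples of `𝓛ψ` and
`𝓛²ψ` (`hasGaussianMean_incrCoeff₂`, `hasGaussianMean_acceptedCoeff`); the `ε`-dependent part of the
increment is compensated by that of the exponent, so both proposals give the same result.

For uniformity in `q` and `g`, the implicit `δ` is never differentiated. It is replaced by an
explicit Picard iterate, at a cost of `h⁶` in the increment and `h⁵` in the exponent
(`exists_displacement_bounds`). The iterates are smooth in `h`, with derivatives bounded by powers
of `1 + |g|` (`PolyBdd`). In such a family a pointwise order of vanishing is automatically uniform,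
so no Taylor remainder has to be tracked, and the Gaussian integrates every power of `1 + |g|`. -/

noncomputable section

/-! ### Orders of vanishing of smooth functions of one variable -/

section Taylor

open Asymptotics Filter Topology

/-- A smooth function which is `O(h ^ n)` at `0` has vanishing derivatives of order `< n`. -/
theorem iteratedDeriv_eq_zero_of_isBigO {f : ℝ → ℝ} (hf : ContDiff ℝ ∞ f) {n : ℕ}
    (h : f =O[𝓝 0] fun x => x ^ n) {k : ℕ} (hk : k < n) : iteratedDeriv k f 0 = 0 := by
  induction k using Nat.strong_induction_on with
  | _ k ih =>
    -- By induction the Taylor polynomial of degree `k` is its top monomial alone, and this monomial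
    -- is then `o(x ^ k)`.
    have h1 := taylor_isLittleO_univ (x₀ := 0) (n := k) (hf.of_le (by exact_mod_cast le_top))
    simp only [sub_zero] at h1
    have h2 : f =o[𝓝 0] fun x : ℝ => x ^ k :=
      h.trans_isLittleO (isLittleO_pow_pow hk)
    have h3 : taylorWithinEval f k Set.univ 0 =
        fun x => (iteratedDeriv k f 0 / k.factorial) * x ^ k := by
      funext x
      rw [taylor_within_apply, Finset.sum_range_succ, Finset.sum_eq_zero]
      · simp [iteratedDerivWithin_univ]
        ring
      · intro j hj
        rw [Finset.mem_range] at hj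
        simp [iteratedDerivWithin_univ, ih j hj (hj.trans hk)]
    have h4 : (fun x => (iteratedDeriv k f 0 / k.factorial) * x ^ k) =o[𝓝 0]
        fun x : ℝ => x ^ k := by
      have := h2.sub h1
      simpa [h3] using this
    by_contra hne
    have hc : iteratedDeriv k f 0 / k.factorial ≠ 0 :=
      div_ne_zero hne (by exact_mod_cast k.factorial_ne_zero)
    rw [isLittleO_const_mul_left_iff hc] at h4
    have h5 : (fun x : ℝ => x ^ k) =o[𝓝[≠] 0] fun x : ℝ => x ^ k := h4.mono nhdsWithin_le_nhds
    have h6 := (isLittleO_irrefl ?_) h5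
    · exact h6
    · refine Eventually.frequently ?_
      filter_upwards [self_mem_nhdsWithin] with x hx
      exact pow_ne_zero _ hx

/-- If the derivatives of order `< n` vanish at `0` and the `n`-th one is bounded by `B`, then
`|f h| ≤ B |h| ^ n`. -/
theorem norm_le_of_iteratedDeriv_eq_zero {f : ℝ → ℝ} (hf : ContDiff ℝ ∞ f) {n : ℕ} {B : ℝ}
    (h0 : ∀ k < n, iteratedDeriv k f 0 = 0)
    (hB : ∀ x, |x| ≤ 1 → |iteratedDeriv n f x| ≤ B) {x : ℝ} (hx : |x| ≤ 1) :
    |f x| ≤ B * |x| ^ n := by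
  induction n generalizing f x with
  | zero => simpa using hB x hx
  | succ n ih =>
    have hf' : ContDiff ℝ ∞ (deriv f) := ((contDiff_infty_iff_deriv (𝕜 := ℝ)).1 hf).2
    have h1 : ∀ y, |y| ≤ 1 → |deriv f y| ≤ B * |y| ^ n := by
      intro y hy
      refine ih hf' (fun k hk => ?_) (fun z hz => ?_) hy
      · simpa [iteratedDeriv_succ'] using h0 (k + 1) (by omega)
      · simpa [iteratedDeriv_succ'] using hB z hz
    have hB0 : 0 ≤ B := (abs_nonneg _).trans (hB 0 (by simp))
    -- The mean value inequality replaces integration, which loses the factor `1 / n!`; constants do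
    -- not matter here.
    have h2 := (convex_closedBall (0 : ℝ) |x|).norm_image_sub_le_of_norm_deriv_le
      (f := f) (C := B * |x| ^ n) (x := 0) (y := x)
      (fun y _ => (hf.differentiable (by simp)) y) (fun y hy => ?_) (by simp) (by simp)
    · have h00 : f 0 = 0 := by simpa using h0 0 (by omega)
      rw [h00, sub_zero, sub_zero, Real.norm_eq_abs, Real.norm_eq_abs] at h2
      calc |f x| ≤ B * |x| ^ n * |x| := h2
        _ = B * |x| ^ (n + 1) := by ring
    · have hy' : |y| ≤ |x| := by simpa using hy
      refine (h1 y (hy'.trans hx)).trans ?_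
      gcongr

/-- If `f` and `p` agree at `0` and `f' = p' + O(h ^ n)`, then `f = p + O(h ^ (n + 1))`. -/
theorem isBigO_pow_succ_of_deriv {f f' p p' : ℝ → ℝ} {n : ℕ}
    (hf : ∀ x, HasDerivAt f (f' x) x) (hp : ∀ x, HasDerivAt p (p' x) x) (h0 : f 0 = p 0)
    (h : (fun x => f' x - p' x) =O[𝓝 0] fun x => x ^ n) :
    (fun x => f x - p x) =O[𝓝 0] fun x => x ^ (n + 1) := by
  obtain ⟨C, hC⟩ := h.bound
  obtain ⟨r, hr, hrC⟩ := Metric.eventually_nhds_iff_ball.1 hC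
  have hC0 : 0 ≤ |C| := abs_nonneg C
  refine IsBigO.of_bound |C| ?_
  filter_upwards [Metric.ball_mem_nhds (0 : ℝ) hr] with x hx
  have hx' : |x| < r := by simpa using hx
  have h2 := (convex_closedBall (0 : ℝ) |x|).norm_image_sub_le_of_norm_hasDerivWithin_le
      (f := fun x => f x - p x) (f' := fun x => f' x - p' x) (C := |C| * |x| ^ n) (x := 0) (y := x)
      (fun y _ => ((hf y).sub (hp y)).hasDerivWithinAt) (fun y hy => ?_) (by simp) (by simp)
  · simp only [h0, sub_self, sub_zero] at h2
    refine h2.trans (le_of_eq ?_)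
    simp only [Real.norm_eq_abs, abs_pow]
    ring
  · have hy' : |y| ≤ |x| := by simpa using hy
    have := hrC y (by simpa using hy'.trans_lt hx')
    refine this.trans ?_
    simp only [norm_pow, Real.norm_eq_abs]
    calc C * |y| ^ n ≤ |C| * |y| ^ n := by gcongr; exact le_abs_self C
      _ ≤ _ := by gcongr

end Taylor

/-! ### Families of smooth functions with polynomially weighted derivative bounds -/

section PolyBdd

variable {Ω : Type*} {G G' : Type*} [NormedAddCommGroup G] [NormedSpace ℝ G]
  [NormedAddCommGroup G'] [NormedSpace ℝ G']

/-- A family of smooth functions of `h` whose derivatives on `[-1, 1]` are bounded by constant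
multiples of powers of the weight `w`. -/
structure PolyBdd (w : Ω → ℝ) (f : Ω → ℝ → G) : Prop where
  smooth : ∀ p, ContDiff ℝ ∞ (f p)
  bound : ∀ n : ℕ, ∃ (C : ℝ) (N : ℕ), 0 ≤ C ∧ ∀ p h, |h| ≤ 1 →
    ‖iteratedFDeriv ℝ n (f p) h‖ ≤ C * w p ^ N

variable {w : Ω → ℝ} (hw : ∀ p, 1 ≤ w p)

include hw

/-- The Leibniz and composition estimates need one bound for all orders up to `n`. Taking `C ≥ 1`
makes it at least `1`, so that it may be raised to powers. -/
theorem PolyBdd.exists_common_bound {f : Ω → ℝ → G} (hf : PolyBdd w f) (n : ℕ) :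
    ∃ (C : ℝ) (N : ℕ), 1 ≤ C ∧ ∀ k ≤ n, ∀ p h, |h| ≤ 1 →
      ‖iteratedFDeriv ℝ k (f p) h‖ ≤ C * w p ^ N := by
  choose C N hC h using hf.bound
  refine ⟨1 + ∑ k ∈ Finset.range (n + 1), C k, ∑ k ∈ Finset.range (n + 1), N k,
    by linarith [Finset.sum_nonneg fun k (_ : k ∈ Finset.range (n + 1)) => hC k],
    fun k hk p x hx => ?_⟩
  have hk' : k ∈ Finset.range (n + 1) := by simp; omega
  refine (h k p x hx).trans ?_
  have h1 : C k ≤ 1 + ∑ k ∈ Finset.range (n + 1), C k := by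
    linarith [Finset.single_le_sum (fun k _ => hC k) hk']
  have h2 : N k ≤ ∑ k ∈ Finset.range (n + 1), N k :=
    Finset.single_le_sum (fun k _ => Nat.zero_le _) hk'
  have := pow_le_pow_right₀ (hw p) h2
  have h3 : 0 ≤ w p := zero_le_one.trans (hw p)
  gcongr
  exact (hC k).trans h1

theorem PolyBdd.add {f g : Ω → ℝ → G} (hf : PolyBdd w f) (hg : PolyBdd w g) :
    PolyBdd w (fun p h => f p h + g p h) := by
  refine ⟨fun p => (hf.smooth p).add (hg.smooth p), fun n => ?_⟩
  obtain ⟨C, N, hC, h⟩ := hf.bound n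
  obtain ⟨C', N', hC', h'⟩ := hg.bound n
  refine ⟨C + C', N + N', by positivity, fun p x hx => ?_⟩
  have h3 : 0 ≤ w p := zero_le_one.trans (hw p)
  have e : iteratedFDeriv ℝ n (fun x => f p x + g p x) x =
      iteratedFDeriv ℝ n (f p) x + iteratedFDeriv ℝ n (g p) x :=
    iteratedFDeriv_add_apply ((hf.smooth p).contDiffAt.of_le (by exact_mod_cast le_top))
      ((hg.smooth p).contDiffAt.of_le (by exact_mod_cast le_top))
  rw [e]
  calc _ ≤ _ := norm_add_le _ _
    _ ≤ C * w p ^ N + C' * w p ^ N' := add_le_add (h p x hx) (h' p x hx)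
    _ ≤ C * w p ^ (N + N') + C' * w p ^ (N + N') := by
      have := hw p
      gcongr <;> omega
    _ = _ := by ring

theorem PolyBdd.smul {f : Ω → ℝ → ℝ} {g : Ω → ℝ → G} (hf : PolyBdd w f) (hg : PolyBdd w g) :
    PolyBdd w (fun p h => f p h • g p h) := by
  refine ⟨fun p => (hf.smooth p).smul (hg.smooth p), fun n => ?_⟩
  obtain ⟨C, N, hC, h⟩ := hf.exists_common_bound hw n
  obtain ⟨C', N', hC', h'⟩ := hg.exists_common_bound hw n
  refine ⟨∑ i ∈ Finset.range (n + 1), (n.choose i : ℝ) * C * C', N + N', by positivity,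
    fun p x hx => ?_⟩
  have h3 : 0 ≤ w p := zero_le_one.trans (hw p)
  refine (norm_iteratedFDeriv_smul_le (hf.smooth p) (hg.smooth p) x
    (n := n) (by exact_mod_cast le_top)).trans ?_
  rw [Finset.sum_mul]
  refine Finset.sum_le_sum fun i hi => ?_
  have hi' : i ≤ n := by simpa [Nat.lt_succ_iff] using hi
  calc _ ≤ (n.choose i : ℝ) * (C * w p ^ N) * (C' * w p ^ N') := by
        gcongr
        · exact h i hi' p x hx
        · exact h' (n - i) (by omega) p x hx
    _ = _ := by ring

theorem PolyBdd.const {c : Ω → G} {C : ℝ} {N : ℕ} (hC : 0 ≤ C) (h : ∀ p, ‖c p‖ ≤ C * w p ^ N) :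
    PolyBdd w (fun p _ => c p) := by
  refine ⟨fun p => contDiff_const, fun n => ⟨C, N, hC, fun p x _ => ?_⟩⟩
  have h3 : 0 ≤ w p := zero_le_one.trans (hw p)
  rcases Nat.eq_zero_or_pos n with rfl | hn
  · simpa using h p
  · rw [iteratedFDeriv_const_of_ne (by omega)]
    simp only [Pi.zero_apply, norm_zero]
    positivity

theorem PolyBdd.monomial (k : ℕ) :
    PolyBdd w (fun (_ : Ω) (h : ℝ) => h ^ k) := by
  have hid : PolyBdd w (fun (_ : Ω) (h : ℝ) => h) := by
    refine ⟨fun _ => contDiff_id, fun n => ⟨1, 0, zero_le_one, fun p x hx => ?_⟩⟩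
    rw [norm_iteratedFDeriv_eq_norm_iteratedDeriv]
    rcases n with _ | _ | n
    · simpa using hx
    · simp [iteratedDeriv_one]
    · simp [iteratedDeriv_succ']
  induction k with
  | zero =>
    simpa using PolyBdd.const (w := w) hw (c := fun _ => (1 : ℝ)) (C := 1) (N := 0)
      zero_le_one (by simp)
  | succ k ih => simpa [pow_succ] using ih.smul hw hid

omit hw in
theorem PolyBdd.clm (L : G →L[ℝ] G') {f : Ω → ℝ → G} (hf : PolyBdd w f) :
    PolyBdd w (fun p h => L (f p h)) := by
  refine ⟨fun p => L.contDiff.comp (hf.smooth p), fun n => ?_⟩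
  obtain ⟨C, N, hC, h⟩ := hf.bound n
  refine ⟨‖L‖ * C, N, by positivity, fun p x hx => ?_⟩
  refine (L.norm_iteratedFDeriv_comp_left ((hf.smooth p).contDiffAt) (n := n)
    (by exact_mod_cast le_top)).trans ?_
  rw [mul_assoc]
  gcongr
  exact h p x hx

/-- Faà di Bruno. The derivatives of `V` are bounded on the whole space, so the base point `q p` is
arbitrary and does not enter the weight. -/
theorem PolyBdd.comp {V : G → G'} (hV : ContDiff ℝ ∞ V)
    (hVb : ∀ n : ℕ, ∃ C, ∀ x, ‖iteratedFDeriv ℝ n V x‖ ≤ C) (q : Ω → G)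
    {f : Ω → ℝ → G} (hf : PolyBdd w f) :
    PolyBdd w (fun p h => V (q p + f p h)) := by
  have hs : ∀ p, ContDiff ℝ ∞ (fun x => V (q p + x)) :=
    fun p => hV.comp (contDiff_const.add contDiff_id)
  refine ⟨fun p => (hs p).comp (hf.smooth p), fun n => ?_⟩
  obtain ⟨C, N, hC, h⟩ := hf.exists_common_bound hw n
  choose B hB using hVb
  have hB0 : ∀ k, 0 ≤ B k := fun k => (norm_nonneg _).trans (hB k 0)
  refine ⟨n.factorial * (∑ k ∈ Finset.range (n + 1), B k) * C ^ n, N * n,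
    by have := Finset.sum_nonneg fun k (_ : k ∈ Finset.range (n + 1)) => hB0 k
       positivity, fun p x hx => ?_⟩
  have h3 : 1 ≤ w p := hw p
  -- The composition estimate asks for the `i`-th derivative to be at most `D ^ i`; as `D ≥ 1`, the
  -- bound by `D` suffices when `i ≥ 1`.
  have h4 : 1 ≤ C * w p ^ N := by
    have := one_le_pow₀ h3 (n := N)
    nlinarith
  have := norm_iteratedFDeriv_comp_le (hs p) (hf.smooth p) (n := n)
    (by exact_mod_cast le_top) x (C := ∑ k ∈ Finset.range (n + 1), B k) (D := C * w p ^ N)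
    (fun i hi => ?_) (fun i hi hi' => (h i hi' p x hx).trans (le_self_pow₀ h4 (by omega)))
  · refine this.trans (le_of_eq ?_)
    rw [mul_pow, ← pow_mul]
    ring
  · rw [iteratedFDeriv_comp_add_left]
    exact (hB i _).trans (Finset.single_le_sum (fun k _ => hB0 k) (by simp; omega))

omit hw in
theorem PolyBdd.congr {f g : Ω → ℝ → G} (hf : PolyBdd w f) (h : ∀ p x, g p x = f p x) :
    PolyBdd w g := by
  have : g = f := by
    funext p x
    exact h p x
  rwa [this]

theorem PolyBdd.mul {f g : Ω → ℝ → ℝ} (hf : PolyBdd w f) (hg : PolyBdd w g) :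
    PolyBdd w (fun p h => f p h * g p h) :=
  hf.smul hw hg

omit hw in
theorem PolyBdd.const_mul (c : ℝ) {f : Ω → ℝ → ℝ} (hf : PolyBdd w f) :
    PolyBdd w (fun p h => c * f p h) :=
  hf.clm (c • ContinuousLinearMap.id ℝ ℝ)

omit hw in
theorem PolyBdd.const_smul (c : ℝ) {f : Ω → ℝ → G} (hf : PolyBdd w f) :
    PolyBdd w (fun p h => c • f p h) :=
  hf.clm (c • ContinuousLinearMap.id ℝ G)

theorem PolyBdd.sub {f g : Ω → ℝ → G} (hf : PolyBdd w f) (hg : PolyBdd w g) :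
    PolyBdd w (fun p h => f p h - g p h) :=
  (hf.add hw (hg.const_smul (-1))).congr fun p x => by simp [sub_eq_add_neg]

theorem PolyBdd.sum {ι : Type*} (s : Finset ι) {f : ι → Ω → ℝ → G}
    (hf : ∀ i ∈ s, PolyBdd w (f i)) : PolyBdd w (fun p h => ∑ i ∈ s, f i p h) := by
  classical
  induction s using Finset.induction_on with
  | empty =>
    simpa using PolyBdd.const (w := w) hw (c := fun _ => (0 : G)) (C := 0) (N := 0)
      le_rfl (by simp)
  | insert a s ha ih =>
    simp only [Finset.sum_insert ha]
    exact (hf a (by simp)).add hw (ih fun i hi => hf i (by simp [hi]))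

omit hw in
theorem PolyBdd.reflect {f : Ω → ℝ → G} (hf : PolyBdd w f) :
    PolyBdd w (fun p h => f p (-h)) := by
  refine ⟨fun p => (hf.smooth p).comp contDiff_neg, fun n => ?_⟩
  obtain ⟨C, N, hC, h⟩ := hf.bound n
  refine ⟨C, N, hC, fun p x hx => ?_⟩
  have := h p (-x) (by simpa using hx)
  rw [norm_iteratedFDeriv_eq_norm_iteratedDeriv] at this ⊢
  rw [iteratedDeriv_comp_neg, norm_smul]
  simpa using this

omit hw in
open Asymptotics Topology in
/-- A pointwise order of vanishing at `h = 0` is uniform in a `PolyBdd` family. -/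
theorem PolyBdd.uniform_of_isBigO {f : Ω → ℝ → ℝ} (hf : PolyBdd w f) {n : ℕ}
    (h : ∀ p, f p =O[𝓝 0] fun x => x ^ n) :
    ∃ (C : ℝ) (N : ℕ), 0 ≤ C ∧ ∀ p x, |x| ≤ 1 → |f p x| ≤ C * w p ^ N * |x| ^ n := by
  obtain ⟨C, N, hC, hb⟩ := hf.bound n
  refine ⟨C, N, hC, fun p x hx => norm_le_of_iteratedDeriv_eq_zero (hf.smooth p)
    (fun k hk => iteratedDeriv_eq_zero_of_isBigO (hf.smooth p) (h p) hk) (fun y hy => ?_) hx⟩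
  simpa [norm_iteratedFDeriv_eq_norm_iteratedDeriv] using hb p y hy

omit hw in
open Asymptotics Topology in
/-- In a family of even functions, an odd order of vanishing improves by one. -/
theorem PolyBdd.uniform_of_isBigO_of_even {f : Ω → ℝ → ℝ} (hf : PolyBdd w f) {n : ℕ}
    (hn : Odd n) (heven : ∀ p x, f p (-x) = f p x)
    (h : ∀ p, f p =O[𝓝 0] fun x => x ^ n) :
    ∃ (C : ℝ) (N : ℕ), 0 ≤ C ∧ ∀ p x, |x| ≤ 1 → |f p x| ≤ C * w p ^ N * |x| ^ (n + 1) := by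
  obtain ⟨C, N, hC, hb⟩ := hf.bound (n + 1)
  refine ⟨C, N, hC, fun p x hx => norm_le_of_iteratedDeriv_eq_zero (hf.smooth p)
    (fun k hk => ?_) (fun y hy => ?_) hx⟩
  · rcases Nat.lt_succ_iff_lt_or_eq.1 hk with hk | rfl
    · exact iteratedDeriv_eq_zero_of_isBigO (hf.smooth p) (h p) hk
    · have := iteratedDeriv_comp_neg k (f p) 0
      simp only [heven, hn.neg_one_pow, neg_zero, smul_eq_mul] at this
      linarith
  · simpa [norm_iteratedFDeriv_eq_norm_iteratedDeriv] using hb p y hy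

end PolyBdd

/-! ### Calculus of directional derivatives -/

section DirDeriv

variable {E : Type*} [NormedAddCommGroup E] [NormedSpace ℝ E]

/-- The derivative of `φ` in the direction `v`. -/
def dirDeriv (v : E) (φ : E → ℝ) : E → ℝ := fun x => fderiv ℝ φ x v

theorem ContDiff.dirDeriv {φ : E → ℝ} (hφ : ContDiff ℝ ∞ φ) (v : E) :
    ContDiff ℝ ∞ (dirDeriv v φ) :=
  (hφ.fderiv_right (m := ∞) (by simp)).clm_apply contDiff_const

theorem dirDeriv_add_left (u v : E) (φ : E → ℝ) (x : E) :
    dirDeriv (u + v) φ x = dirDeriv u φ x + dirDeriv v φ x := by simp [dirDeriv]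

theorem dirDeriv_smul_left (c : ℝ) (v : E) (φ : E → ℝ) (x : E) :
    dirDeriv (c • v) φ x = c * dirDeriv v φ x := by simp [dirDeriv]

theorem dirDeriv_sum_left {ι : Type*} (s : Finset ι) (v : ι → E) (φ : E → ℝ) (x : E) :
    dirDeriv (∑ i ∈ s, v i) φ x = ∑ i ∈ s, dirDeriv (v i) φ x := by simp [dirDeriv]

theorem dirDeriv_add {φ χ : E → ℝ} (hφ : ContDiff ℝ ∞ φ) (hχ : ContDiff ℝ ∞ χ) (v x : E) :
    dirDeriv v (fun y => φ y + χ y) x = dirDeriv v φ x + dirDeriv v χ x := by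
  simp only [dirDeriv]
  rw [fderiv_fun_add (hφ.differentiable (by simp) x) (hχ.differentiable (by simp) x)]
  simp

theorem dirDeriv_const_mul {φ : E → ℝ} (hφ : ContDiff ℝ ∞ φ) (c : ℝ) (v x : E) :
    dirDeriv v (fun y => c * φ y) x = c * dirDeriv v φ x := by
  simp only [dirDeriv]
  rw [fderiv_const_mul (hφ.differentiable (by simp) x)]
  simp

theorem dirDeriv_mul {φ χ : E → ℝ} (hφ : ContDiff ℝ ∞ φ) (hχ : ContDiff ℝ ∞ χ) (v x : E) :
    dirDeriv v (fun y => φ y * χ y) x = φ x * dirDeriv v χ x + dirDeriv v φ x * χ x := by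
  simp only [dirDeriv]
  rw [fderiv_fun_mul (hφ.differentiable (by simp) x) (hχ.differentiable (by simp) x)]
  simp [mul_comm]

theorem dirDeriv_sum {ι : Type*} (s : Finset ι) {φ : ι → E → ℝ}
    (hφ : ∀ i, ContDiff ℝ ∞ (φ i)) (v x : E) :
    dirDeriv v (fun y => ∑ i ∈ s, φ i y) x = ∑ i ∈ s, dirDeriv v (φ i) x := by
  simp only [dirDeriv]
  rw [fderiv_fun_sum fun i _ => (hφ i).differentiable (by simp) x]
  simp

theorem dirDeriv_comm {φ : E → ℝ} (hφ : ContDiff ℝ ∞ φ) (u v : E) :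
    dirDeriv u (dirDeriv v φ) = dirDeriv v (dirDeriv u φ) := by
  funext x
  have hd : DifferentiableAt ℝ (fderiv ℝ φ) x :=
    (hφ.fderiv_right (m := ∞) (by simp)).differentiable (by simp) x
  have h1 : ∀ u v, dirDeriv u (dirDeriv v φ) x = fderiv ℝ (fderiv ℝ φ) x u v := by
    intro u v
    have : dirDeriv v φ = fun y => (fderiv ℝ φ y) v := rfl
    rw [this]
    simp only [dirDeriv]
    rw [fderiv_clm_apply hd (differentiableAt_const v)]
    simp
  rw [h1, h1]
  exact (hφ.contDiffAt.isSymmSndFDerivAt (by simpa using WithTop.coe_le_coe.2 (le_top : (2 : ℕ∞) ≤ ⊤))).eq u v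

end DirDeriv

/-! ### Taylor expansion of a function along a quartic curve -/

section CurveExpansion

open Asymptotics Topology

variable {E : Type*} [NormedAddCommGroup E] [NormedSpace ℝ E] (q g a b c : E)

/-- A polynomial curve of degree four. -/
def quarticCurve (h : ℝ) : E := q + h • g + h ^ 2 • a + h ^ 3 • b + h ^ 4 • c

/-- The derivative is again built from functions along the same curve, the slower directions
carrying extra powers of `h`. Each expansion below thus follows by integrating lower-order
expansions of directional derivatives. -/
theorem hasDerivAt_comp_quarticCurve {φ : E → ℝ} (hφ : ContDiff ℝ ∞ φ) (h : ℝ) :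
    HasDerivAt (fun h => φ (quarticCurve q g a b c h))
      (dirDeriv g φ (quarticCurve q g a b c h) + 2 * h * dirDeriv a φ (quarticCurve q g a b c h)
        + 3 * h ^ 2 * dirDeriv b φ (quarticCurve q g a b c h)
        + 4 * h ^ 3 * dirDeriv c φ (quarticCurve q g a b c h)) h := by
  have h1 : HasDerivAt (quarticCurve q g a b c)
      (g + (2 * h) • a + (3 * h ^ 2) • b + (4 * h ^ 3) • c) h := by
    have e1 : HasDerivAt (fun h : ℝ => h • g) g h := by
      simpa using (hasDerivAt_id h).smul_const g
    have e2 := (hasDerivAt_pow 2 h).smul_const a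
    have e3 := (hasDerivAt_pow 3 h).smul_const b
    have e4 := (hasDerivAt_pow 4 h).smul_const c
    have := (((e1.const_add q).add e2).add e3).add e4
    convert! this using 1
    norm_num
  have h2 := ((hφ.differentiable (by simp)) (quarticCurve q g a b c h)).hasFDerivAt.comp_hasDerivAt
    h h1
  convert! h2 using 1
  simp [dirDeriv]

theorem pow_isBigO_pow_of_le {m n : ℕ} (h : m ≤ n) :
    (fun x : ℝ => x ^ n) =O[𝓝 0] fun x => x ^ m := by
  rcases h.eq_or_lt with rfl | h
  · exact isBigO_refl _ _
  · exact (isLittleO_pow_pow h).isBigO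

theorem isBigO_const_mul_pow_mul {f : ℝ → ℝ} {n : ℕ} (k : ℕ) (r : ℝ)
    (hf : f =O[𝓝 0] fun x => x ^ n) :
    (fun x => r * x ^ k * f x) =O[𝓝 0] fun x => x ^ (k + n) := by
  have : (fun x : ℝ => r * x ^ k) =O[𝓝 0] fun x => x ^ k := isBigO_const_mul_self r _ _
  simpa [pow_add] using this.mul hf

theorem comp_quarticCurve_isBigO_one {φ : E → ℝ} (hφ : ContDiff ℝ ∞ φ) :
    (fun h => φ (quarticCurve q g a b c h) - φ q) =O[𝓝 0] fun h => h ^ 1 := by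
  have h1 := (hasDerivAt_comp_quarticCurve q g a b c hφ 0).differentiableAt.isBigO_sub
  simpa [quarticCurve] using h1

theorem comp_quarticCurve_isBigO_two {φ : E → ℝ} (hφ : ContDiff ℝ ∞ φ) :
    (fun h => φ (quarticCurve q g a b c h) - (φ q + h * dirDeriv g φ q))
      =O[𝓝 0] fun h => h ^ 2 := by
  refine isBigO_pow_succ_of_deriv (p' := fun _ => dirDeriv g φ q)
    (hasDerivAt_comp_quarticCurve q g a b c hφ) (fun x => ?_) (by simp [quarticCurve]) ?_
  · simpa using ((hasDerivAt_id x).mul_const (dirDeriv g φ q)).const_add (φ q)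
  · have e1 := comp_quarticCurve_isBigO_one q g a b c (hφ.dirDeriv g)
    have e0 : ∀ (v : E), (fun h => dirDeriv v φ (quarticCurve q g a b c h)) =O[𝓝 0]
        fun h => h ^ 0 := fun v => by
      simpa using ((hasDerivAt_comp_quarticCurve q g a b c (hφ.dirDeriv v) 0).continuousAt
        ).isBigO_one ℝ
    have e2 := isBigO_const_mul_pow_mul 1 2 (e0 a)
    have e3 := (isBigO_const_mul_pow_mul 2 3 (e0 b)).trans (pow_isBigO_pow_of_le (show 1 ≤ 2 + 0 by simp))
    have e4 := (isBigO_const_mul_pow_mul 3 4 (e0 c)).trans (pow_isBigO_pow_of_le (show 1 ≤ 3 + 0 by simp))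
    refine (((e1.add e2).add e3).add e4).congr_left fun x => ?_
    ring

theorem comp_quarticCurve_isBigO_three {φ : E → ℝ} (hφ : ContDiff ℝ ∞ φ) :
    (fun h => φ (quarticCurve q g a b c h) - (φ q + h * dirDeriv g φ q
      + h ^ 2 * (dirDeriv a φ q + 1 / 2 * dirDeriv g (dirDeriv g φ) q)))
      =O[𝓝 0] fun h => h ^ 3 := by
  refine isBigO_pow_succ_of_deriv (p' := fun h => dirDeriv g φ q
      + 2 * h * (dirDeriv a φ q + 1 / 2 * dirDeriv g (dirDeriv g φ) q))
    (hasDerivAt_comp_quarticCurve q g a b c hφ) (fun x => ?_) (by simp [quarticCurve]) ?_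
  · simpa using (((hasDerivAt_id x).mul_const (dirDeriv g φ q)).const_add (φ q)).fun_add
      ((hasDerivAt_pow 2 x).mul_const _)
  · have e1 := comp_quarticCurve_isBigO_two q g a b c (hφ.dirDeriv g)
    have e0 : ∀ (v : E), (fun h => dirDeriv v φ (quarticCurve q g a b c h)) =O[𝓝 0]
        fun h => h ^ 0 := fun v => by
      simpa using ((hasDerivAt_comp_quarticCurve q g a b c (hφ.dirDeriv v) 0).continuousAt
        ).isBigO_one ℝ
    have e2 := isBigO_const_mul_pow_mul 1 2 (comp_quarticCurve_isBigO_one q g a b c (hφ.dirDeriv a))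
    have e3 := isBigO_const_mul_pow_mul 2 3 (e0 b)
    have e4 := (isBigO_const_mul_pow_mul 3 4 (e0 c)).trans (pow_isBigO_pow_of_le (show 2 ≤ 3 + 0 by simp))
    refine (((e1.add e2).add e3).add e4).congr_left fun x => ?_
    ring

theorem comp_quarticCurve_isBigO_four {φ : E → ℝ} (hφ : ContDiff ℝ ∞ φ) :
    (fun h => φ (quarticCurve q g a b c h) - (φ q + h * dirDeriv g φ q
      + h ^ 2 * (dirDeriv a φ q + 1 / 2 * dirDeriv g (dirDeriv g φ) q)
      + h ^ 3 * (dirDeriv b φ q + dirDeriv a (dirDeriv g φ) q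
        + 1 / 6 * dirDeriv g (dirDeriv g (dirDeriv g φ)) q)))
      =O[𝓝 0] fun h => h ^ 4 := by
  refine isBigO_pow_succ_of_deriv (p' := fun h => dirDeriv g φ q
      + 2 * h * (dirDeriv a φ q + 1 / 2 * dirDeriv g (dirDeriv g φ) q)
      + 3 * h ^ 2 * (dirDeriv b φ q + dirDeriv a (dirDeriv g φ) q
        + 1 / 6 * dirDeriv g (dirDeriv g (dirDeriv g φ)) q))
    (hasDerivAt_comp_quarticCurve q g a b c hφ) (fun x => ?_) (by simp [quarticCurve]) ?_
  · simpa using ((((hasDerivAt_id x).mul_const (dirDeriv g φ q)).const_add (φ q)).fun_add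
      ((hasDerivAt_pow 2 x).mul_const _)).fun_add ((hasDerivAt_pow 3 x).mul_const _)
  · have e1 := comp_quarticCurve_isBigO_three q g a b c (hφ.dirDeriv g)
    have e0 : ∀ (v : E), (fun h => dirDeriv v φ (quarticCurve q g a b c h)) =O[𝓝 0]
        fun h => h ^ 0 := fun v => by
      simpa using ((hasDerivAt_comp_quarticCurve q g a b c (hφ.dirDeriv v) 0).continuousAt
        ).isBigO_one ℝ
    have e2 := isBigO_const_mul_pow_mul 1 2 (comp_quarticCurve_isBigO_two q g a b c (hφ.dirDeriv a))
    have e3 := isBigO_const_mul_pow_mul 2 3 (comp_quarticCurve_isBigO_one q g a b c (hφ.dirDeriv b))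
    have e4 := isBigO_const_mul_pow_mul 3 4 (e0 c)
    refine (((e1.add e2).add e3).add e4).congr_left fun x => ?_
    -- The mixed term arises once from `g` and twice from `a`; commuting the derivatives adds these
    -- up to the factor `3` of `3 h ^ 2`.
    rw [dirDeriv_comm hφ g a]
    ring

theorem comp_quarticCurve_isBigO_five {φ : E → ℝ} (hφ : ContDiff ℝ ∞ φ) :
    (fun h => φ (quarticCurve q g a b c h) - (φ q + h * dirDeriv g φ q
      + h ^ 2 * (dirDeriv a φ q + 1 / 2 * dirDeriv g (dirDeriv g φ) q)
      + h ^ 3 * (dirDeriv b φ q + dirDeriv a (dirDeriv g φ) q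
        + 1 / 6 * dirDeriv g (dirDeriv g (dirDeriv g φ)) q)
      + h ^ 4 * (dirDeriv c φ q + dirDeriv b (dirDeriv g φ) q
        + 1 / 2 * dirDeriv a (dirDeriv a φ) q + 1 / 2 * dirDeriv a (dirDeriv g (dirDeriv g φ)) q
        + 1 / 24 * dirDeriv g (dirDeriv g (dirDeriv g (dirDeriv g φ))) q)))
      =O[𝓝 0] fun h => h ^ 5 := by
  refine isBigO_pow_succ_of_deriv (p' := fun h => dirDeriv g φ q
      + 2 * h * (dirDeriv a φ q + 1 / 2 * dirDeriv g (dirDeriv g φ) q)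
      + 3 * h ^ 2 * (dirDeriv b φ q + dirDeriv a (dirDeriv g φ) q
        + 1 / 6 * dirDeriv g (dirDeriv g (dirDeriv g φ)) q)
      + 4 * h ^ 3 * (dirDeriv c φ q + dirDeriv b (dirDeriv g φ) q
        + 1 / 2 * dirDeriv a (dirDeriv a φ) q + 1 / 2 * dirDeriv a (dirDeriv g (dirDeriv g φ)) q
        + 1 / 24 * dirDeriv g (dirDeriv g (dirDeriv g (dirDeriv g φ))) q))
    (hasDerivAt_comp_quarticCurve q g a b c hφ) (fun x => ?_) (by simp [quarticCurve]) ?_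
  · simpa using (((((hasDerivAt_id x).mul_const (dirDeriv g φ q)).const_add (φ q)).fun_add
      ((hasDerivAt_pow 2 x).mul_const _)).fun_add ((hasDerivAt_pow 3 x).mul_const _)).fun_add
      ((hasDerivAt_pow 4 x).mul_const _)
  · have e1 := comp_quarticCurve_isBigO_four q g a b c (hφ.dirDeriv g)
    have e2 := isBigO_const_mul_pow_mul 1 2
      (comp_quarticCurve_isBigO_three q g a b c (hφ.dirDeriv a))
    have e3 := isBigO_const_mul_pow_mul 2 3 (comp_quarticCurve_isBigO_two q g a b c (hφ.dirDeriv b))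
    have e4 := isBigO_const_mul_pow_mul 3 4 (comp_quarticCurve_isBigO_one q g a b c (hφ.dirDeriv c))
    refine (((e1.add e2).add e3).add e4).congr_left fun x => ?_
    rw [dirDeriv_comm hφ g a, dirDeriv_comm hφ g b, dirDeriv_comm (hφ.dirDeriv g) g a]
    ring

end CurveExpansion

/-! ### Second and fourth moments of Gaussian measures -/

section GaussianMoments

/-- The moment is the fourth derivative at `0` of the moment generating function `exp (v t² / 2)`.
-/
theorem integral_pow_four_gaussianReal (v : NNReal) :
    ∫ x, x ^ 4 ∂(gaussianReal 0 v) = 3 * (v : ℝ) ^ 2 := by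
  have h := iteratedDeriv_mgf_zero (X := id) (μ := gaussianReal 0 v)
    (by simp [integrableExpSet_id_gaussianReal]) 4
  simp only [Pi.pow_apply, id] at h
  rw [← h, mgf_id_gaussianReal]
  set c : ℝ := (v : ℝ) with hc
  -- Differentiating `p · exp (c t² / 2)` amounts to replacing `p` by `p' + c t p`; four
  -- applications to `p = 1` follow.
  have step : ∀ (p p' : ℝ → ℝ), (∀ t, HasDerivAt p (p' t) t) →
      deriv (fun t => p t * Real.exp (0 * t + c * t ^ 2 / 2)) =
        fun t => (p' t + c * t * p t) * Real.exp (0 * t + c * t ^ 2 / 2) := by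
    intro p p' hp
    funext t
    have h1 : HasDerivAt (fun t : ℝ => 0 * t + c * t ^ 2 / 2) (c * t) t := by
      have := (((hasDerivAt_pow 2 t).const_mul c).div_const 2).const_add (0 : ℝ)
      convert! this using 1
      · funext t; simp
      · norm_num; ring
    have := ((hp t).mul h1.exp).deriv
    refine this.trans ?_
    ring
  have e0 : (fun t => Real.exp (0 * t + c * t ^ 2 / 2)) =
      fun t => (fun _ : ℝ => (1 : ℝ)) t * Real.exp (0 * t + c * t ^ 2 / 2) := by
    funext t; ring
  rw [iteratedDeriv_succ', iteratedDeriv_succ', iteratedDeriv_succ', iteratedDeriv_succ',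
    iteratedDeriv_zero, e0, step _ _ (fun t => hasDerivAt_const t 1),
    step (fun t => 0 + c * t * 1) (fun t => c) (fun t => by
      simpa using (hasDerivAt_id t).const_mul c),
    step (fun t => c + c * t * (0 + c * t * 1)) (fun t => c ^ 2 * (2 * t)) (fun t => by
      have := ((hasDerivAt_pow 2 t).const_mul (c ^ 2)).const_add c
      convert! this using 1
      · funext t; ring
      · norm_num),
    step (fun t => c ^ 2 * (2 * t) + c * t * (c + c * t * (0 + c * t * 1)))
      (fun t => c ^ 2 * 2 + (c ^ 2 + c ^ 3 * (3 * t ^ 2))) (fun t => by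
      have := ((hasDerivAt_id t).const_mul (c ^ 2 * 2)).add
        (((hasDerivAt_id t).const_mul (c ^ 2)).add ((hasDerivAt_pow 3 t).const_mul (c ^ 3)))
      convert! this using 1
      · funext t; simp; ring
      · norm_num)]
  simp
  ring

theorem integral_pow_two_gaussianReal (v : NNReal) :
    ∫ x, x ^ 2 ∂(gaussianReal 0 v) = (v : ℝ) := by
  have h := variance_of_integral_eq_zero (X := fun x : ℝ => x) (μ := gaussianReal 0 v)
    (by fun_prop) (by simp)
  rw [← h]
  simp

variable {E : Type*} [NormedAddCommGroup E] [InnerProductSpace ℝ E] [FiniteDimensional ℝ E]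
  [MeasurableSpace E] [BorelSpace E]

theorem map_inner_stdGaussian (a : E) :
    (stdGaussian E).map (fun x => ⟪a, x⟫) = gaussianReal 0 (‖a‖₊ ^ 2) := by
  have h := IsGaussian.map_eq_gaussianReal (μ := stdGaussian E) (innerSL ℝ a)
  rw [integral_strongDual_stdGaussian, variance_dual_stdGaussian] at h
  simp only [innerSL_apply_norm] at h
  have e : (⇑(innerSL ℝ a) : E → ℝ) = fun x => ⟪a, x⟫ := by
    funext x; simp [innerSL_apply_apply]
  rw [e] at h
  rw [h]
  congr 1
  ext
  simp

theorem integral_inner_pow_four_stdGaussian (a : E) :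
    ∫ x, ⟪a, x⟫ ^ 4 ∂(stdGaussian E) = 3 * (‖a‖ ^ 2) ^ 2 := by
  have h := integral_map (μ := stdGaussian E) (φ := fun x => ⟪a, x⟫) (f := fun y : ℝ => y ^ 4)
    (by fun_prop) (by fun_prop)
  rw [← h, map_inner_stdGaussian, integral_pow_four_gaussianReal]
  simp

theorem integral_inner_pow_two_stdGaussian (a : E) :
    ∫ x, ⟪a, x⟫ ^ 2 ∂(stdGaussian E) = ‖a‖ ^ 2 := by
  have h := integral_map (μ := stdGaussian E) (φ := fun x => ⟪a, x⟫) (f := fun y : ℝ => y ^ 2)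
    (by fun_prop) (by fun_prop)
  rw [← h, map_inner_stdGaussian, integral_pow_two_gaussianReal]
  simp

theorem integrable_one_add_norm_pow_stdGaussian (N : ℕ) :
    Integrable (fun x : E => (1 + ‖x‖) ^ N) (stdGaussian E) := by
  have h0 : MemLp (fun x : E => ‖x‖) (N : ENNReal) (stdGaussian E) :=
    (IsGaussian.memLp_id (stdGaussian E) (N : ENNReal) (ENNReal.natCast_ne_top N)).norm
  have hc : MemLp (fun _ : E => (1 : ℝ)) (N : ENNReal) (stdGaussian E) := memLp_const 1
  have h1 : MemLp (fun x : E => 1 + ‖x‖) (N : ENNReal) (stdGaussian E) := hc.add h0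
  have h2 := h1.integrable_norm_pow'
  refine h2.congr (Filter.Eventually.of_forall fun x => ?_)
  simp only [Real.norm_eq_abs]
  rw [abs_of_nonneg (by positivity)]

theorem integrable_of_le_one_add_norm_pow {f : E → ℝ} (hf : Continuous f) {C : ℝ} {N : ℕ}
    (h : ∀ x, |f x| ≤ C * (1 + ‖x‖) ^ N) : Integrable f (stdGaussian E) :=
  ((integrable_one_add_norm_pow_stdGaussian N).const_mul C).mono' hf.aestronglyMeasurable
    (Filter.Eventually.of_forall h)

omit [FiniteDimensional ℝ E] [MeasurableSpace E] [BorelSpace E] in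
theorem abs_inner_le_mul_one_add_norm (a x : E) : |⟪a, x⟫| ≤ ‖a‖ * (1 + ‖x‖) := by
  refine (abs_real_inner_le_norm a x).trans ?_
  have := norm_nonneg a
  nlinarith

theorem integrable_inner_mul_inner (a b : E) :
    Integrable (fun x => ⟪a, x⟫ * ⟪b, x⟫) (stdGaussian E) := by
  refine integrable_of_le_one_add_norm_pow (C := ‖a‖ * ‖b‖) (N := 2) (by fun_prop) fun x => ?_
  rw [abs_mul]
  calc _ ≤ (‖a‖ * (1 + ‖x‖)) * (‖b‖ * (1 + ‖x‖)) := by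
        gcongr <;> exact abs_inner_le_mul_one_add_norm _ _
    _ = _ := by ring

theorem integrable_inner_mul_inner_mul_inner_mul_inner (a b c e : E) :
    Integrable (fun x => ⟪a, x⟫ * ⟪b, x⟫ * ⟪c, x⟫ * ⟪e, x⟫) (stdGaussian E) := by
  refine integrable_of_le_one_add_norm_pow (C := ‖a‖ * ‖b‖ * ‖c‖ * ‖e‖) (N := 4) (by fun_prop)
    fun x => ?_
  rw [abs_mul, abs_mul, abs_mul]
  calc _ ≤ (‖a‖ * (1 + ‖x‖)) * (‖b‖ * (1 + ‖x‖)) * (‖c‖ * (1 + ‖x‖)) * (‖e‖ * (1 + ‖x‖)) := by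
        gcongr <;> exact abs_inner_le_mul_one_add_norm _ _
    _ = _ := by ring

theorem integral_inner_mul_inner (a b : E) :
    ∫ x, ⟪a, x⟫ * ⟪b, x⟫ ∂(stdGaussian E) = ⟪a, b⟫ := by
  have hi : ∀ a : E, Integrable (fun x => ⟪a, x⟫ ^ 2) (stdGaussian E) := fun a => by
    simpa [pow_two] using integrable_inner_mul_inner a a
  have e : ∀ x : E, ⟪a, x⟫ * ⟪b, x⟫ = 1 / 4 * (⟪a + b, x⟫ ^ 2 - ⟪a - b, x⟫ ^ 2) := by
    intro x
    simp only [inner_add_left, inner_sub_left]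
    ring
  simp_rw [e]
  rw [integral_const_mul, integral_sub (hi _) (hi _), integral_inner_pow_two_stdGaussian,
    integral_inner_pow_two_stdGaussian, norm_add_sq_real, norm_sub_sq_real]
  ring

/-- Wick's formula, by polarisation from the fourth moment of a single linear form. -/
theorem integral_inner_mul_inner_mul_inner_mul_inner (a b c e : E) :
    ∫ x, ⟪a, x⟫ * ⟪b, x⟫ * ⟪c, x⟫ * ⟪e, x⟫ ∂(stdGaussian E) =
      ⟪a, b⟫ * ⟪c, e⟫ + ⟪a, c⟫ * ⟪b, e⟫ + ⟪a, e⟫ * ⟪b, c⟫ := by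
  have hi : ∀ a : E, Integrable (fun x => ⟪a, x⟫ ^ 4) (stdGaussian E) := fun a => by
    refine (integrable_inner_mul_inner_mul_inner_mul_inner a a a a).congr
      (Filter.Eventually.of_forall fun x => ?_)
    simp only
    ring
  -- Signed sum over the eight choices of signs of `b`, `c`, `e`; the constant is `192 = 8 · 4!`.
  have key : ∀ x : E, ⟪a, x⟫ * ⟪b, x⟫ * ⟪c, x⟫ * ⟪e, x⟫ = 1 / 192 *
      (⟪a + b + c + e, x⟫ ^ 4 - ⟪a + b + c - e, x⟫ ^ 4 - ⟪a + b - c + e, x⟫ ^ 4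
        + ⟪a + b - c - e, x⟫ ^ 4 - ⟪a - b + c + e, x⟫ ^ 4 + ⟪a - b + c - e, x⟫ ^ 4
        + ⟪a - b - c + e, x⟫ ^ 4 - ⟪a - b - c - e, x⟫ ^ 4) := by
    intro x
    simp only [inner_add_left, inner_sub_left]
    ring
  simp_rw [key]
  rw [integral_const_mul, integral_sub, integral_add, integral_add, integral_sub, integral_add,
    integral_sub, integral_sub]
  · simp only [integral_inner_pow_four_stdGaussian]
    simp only [← real_inner_self_eq_norm_sq, inner_add_left,
      inner_sub_left, inner_add_right, inner_sub_right, real_inner_comm a b, real_inner_comm a c,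
      real_inner_comm a e, real_inner_comm b c, real_inner_comm b e, real_inner_comm c e]
    ring
  all_goals fun_prop (disch := exact hi _)

end GaussianMoments

/-! ### Wick's formula in coordinates -/

section CoordinateMoments

variable {d : ℕ}

/-- The standard basis vectors of `ℝ^d`. -/
def stdVec (i : Fin d) : Euc d := EuclideanSpace.basisFun (Fin d) ℝ i

theorem inner_stdVec_stdVec (i j : Fin d) : ⟪stdVec i, stdVec j⟫ = if i = j then (1 : ℝ) else 0 :=
  orthonormal_iff_ite.1 (EuclideanSpace.basisFun (Fin d) ℝ).orthonormal i j

theorem sum_inner_stdVec_smul (x : Euc d) : ∑ i, ⟪stdVec i, x⟫ • stdVec i = x :=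
  (EuclideanSpace.basisFun (Fin d) ℝ).sum_repr' x

theorem dirDeriv_eq_sum (v : Euc d) (φ : Euc d → ℝ) (x : Euc d) :
    dirDeriv v φ x = ∑ i, ⟪stdVec i, v⟫ * dirDeriv (stdVec i) φ x := by
  conv_lhs => rw [← sum_inner_stdVec_smul v]
  simp [dirDeriv_sum_left, dirDeriv_smul_left]

theorem integrable_quadratic (T : Fin d → Fin d → ℝ) :
    Integrable (fun g : Euc d => ∑ i, ∑ j, T i j * (⟪stdVec i, g⟫ * ⟪stdVec j, g⟫))
      (stdGaussian (Euc d)) :=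
  integrable_finsetSum _ fun _ _ => integrable_finsetSum _ fun _ _ =>
    (integrable_inner_mul_inner _ _).const_mul _

theorem integral_quadratic (T : Fin d → Fin d → ℝ) :
    ∫ g : Euc d, ∑ i, ∑ j, T i j * (⟪stdVec i, g⟫ * ⟪stdVec j, g⟫) ∂(stdGaussian (Euc d)) =
      ∑ i, T i i := by
  rw [integral_finsetSum _ fun _ _ => integrable_finsetSum _ fun _ _ =>
    (integrable_inner_mul_inner _ _).const_mul _]
  refine Finset.sum_congr rfl fun i _ => ?_
  rw [integral_finsetSum _ fun j _ => (integrable_inner_mul_inner _ _).const_mul _]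
  simp [integral_const_mul, integral_inner_mul_inner, inner_stdVec_stdVec]

theorem integrable_quartic (T : Fin d → Fin d → Fin d → Fin d → ℝ) :
    Integrable (fun g : Euc d => ∑ i, ∑ j, ∑ k, ∑ l, T i j k l *
      (⟪stdVec i, g⟫ * ⟪stdVec j, g⟫ * ⟪stdVec k, g⟫ * ⟪stdVec l, g⟫)) (stdGaussian (Euc d)) :=
  integrable_finsetSum _ fun _ _ => integrable_finsetSum _ fun _ _ =>
    integrable_finsetSum _ fun _ _ => integrable_finsetSum _ fun _ _ =>
    (integrable_inner_mul_inner_mul_inner_mul_inner _ _ _ _).const_mul _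

theorem integral_quartic (T : Fin d → Fin d → Fin d → Fin d → ℝ) :
    ∫ g : Euc d, ∑ i, ∑ j, ∑ k, ∑ l, T i j k l *
      (⟪stdVec i, g⟫ * ⟪stdVec j, g⟫ * ⟪stdVec k, g⟫ * ⟪stdVec l, g⟫) ∂(stdGaussian (Euc d)) =
      ∑ i, ∑ j, (T i i j j + T i j i j + T i j j i) := by
  have h4 : ∀ i j k l, Integrable (fun g : Euc d => T i j k l *
      (⟪stdVec i, g⟫ * ⟪stdVec j, g⟫ * ⟪stdVec k, g⟫ * ⟪stdVec l, g⟫)) (stdGaussian (Euc d)) :=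
    fun _ _ _ _ => (integrable_inner_mul_inner_mul_inner_mul_inner _ _ _ _).const_mul _
  rw [integral_finsetSum _ fun _ _ => integrable_finsetSum _ fun _ _ =>
    integrable_finsetSum _ fun _ _ => integrable_finsetSum _ fun _ _ => h4 _ _ _ _]
  refine Finset.sum_congr rfl fun i _ => ?_
  rw [integral_finsetSum _ fun _ _ =>
    integrable_finsetSum _ fun _ _ => integrable_finsetSum _ fun _ _ => h4 _ _ _ _]
  have e1 : ∀ j, ∫ g : Euc d, ∑ k, ∑ l, T i j k l *
      (⟪stdVec i, g⟫ * ⟪stdVec j, g⟫ * ⟪stdVec k, g⟫ * ⟪stdVec l, g⟫) ∂(stdGaussian (Euc d)) =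
      ∑ k, ∑ l, T i j k l * ((if i = j then 1 else 0) * (if k = l then 1 else 0)
        + (if i = k then 1 else 0) * (if j = l then 1 else 0)
        + (if i = l then 1 else 0) * (if j = k then 1 else 0)) := by
    intro j
    rw [integral_finsetSum _ fun _ _ => integrable_finsetSum _ fun _ _ => h4 _ _ _ _]
    refine Finset.sum_congr rfl fun k _ => ?_
    rw [integral_finsetSum _ fun _ _ => h4 _ _ _ _]
    refine Finset.sum_congr rfl fun l _ => ?_
    rw [integral_const_mul, integral_inner_mul_inner_mul_inner_mul_inner]
    simp only [inner_stdVec_stdVec]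
  simp_rw [e1]
  simp only [mul_add, Finset.sum_add_distrib, mul_ite, mul_one, mul_zero,
    Finset.sum_ite_eq, Finset.mem_univ, if_true,
    Finset.sum_ite_irrel, Finset.sum_const_zero]

end CoordinateMoments

/-! ### Smooth functions with bounded derivatives -/

section SmoothBdd

variable {E G : Type*} [NormedAddCommGroup E] [NormedSpace ℝ E]
  [NormedAddCommGroup G] [NormedSpace ℝ G]

/-- A smooth function all of whose derivatives are bounded. -/
structure SmoothBdd (V : E → G) : Prop where
  smooth : ContDiff ℝ ∞ V
  bound : ∀ n : ℕ, ∃ C, ∀ x, ‖iteratedFDeriv ℝ n V x‖ ≤ C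

theorem SmoothBdd.exists_norm_le {V : E → G} (hV : SmoothBdd V) :
    ∃ C, 0 ≤ C ∧ ∀ x, ‖V x‖ ≤ C := by
  obtain ⟨C, hC⟩ := hV.bound 0
  refine ⟨C, (norm_nonneg _).trans (hC 0), fun x => by simpa using hC x⟩

theorem SmoothBdd.exists_lipschitz {V : E → G} (hV : SmoothBdd V) :
    ∃ C, 0 ≤ C ∧ ∀ x y, ‖V x - V y‖ ≤ C * ‖x - y‖ := by
  obtain ⟨C, hC⟩ := hV.bound 1
  refine ⟨C, (norm_nonneg _).trans (hC 0), fun x y => ?_⟩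
  refine convex_univ.norm_image_sub_le_of_norm_fderiv_le (𝕜 := ℝ)
    (fun z _ => hV.smooth.differentiable (by simp) z) (fun z _ => ?_) (Set.mem_univ y)
    (Set.mem_univ x)
  rw [← norm_iteratedFDeriv_one]
  exact hC z

end SmoothBdd

/-! ### Periodic functions, gradients and their derivatives -/

section Torus

variable {d : ℕ}

/-- Every point is a lattice translate of one in the fundamental parallelepiped, which lies in the
compact ball of radius `∑ ‖b i‖`. -/
theorem exists_norm_le_of_periodic {G : Type*} [NormedAddCommGroup G]
    (b : Module.Basis (Fin d) ℝ (Euc d)) {f : Euc d → G} (hf : Continuous f)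
    (hp : ∀ i, Function.Periodic f (b i)) : ∃ C, ∀ x, ‖f x‖ ≤ C := by
  obtain ⟨C, hC⟩ := (isCompact_closedBall (0 : Euc d) (∑ i, ‖b i‖)).exists_bound_of_continuousOn
    hf.continuousOn
  refine ⟨C, fun x => ?_⟩
  have hper : ∀ v ∈ Submodule.span ℤ (Set.range b), ∀ x, f (x + v) = f x := by
    intro v hv
    induction hv using Submodule.span_induction with
    | mem v hv =>
      obtain ⟨i, rfl⟩ := hv
      exact hp i
    | zero => simp
    | add u v _ _ hu hv => intro x; rw [← add_assoc, hv, hu]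
    | smul n v _ hv => exact (Function.Periodic.zsmul hv n)
  have h1 : f (ZSpan.fract b x) = f x := by
    rw [ZSpan.fract_apply, sub_eq_add_neg]
    exact hper _ (neg_mem (ZSpan.floor b x).2) x
  rw [← h1]
  refine hC _ ?_
  simpa using ZSpan.norm_fract_le b x

theorem smoothBdd_of_periodic {G : Type*} [NormedAddCommGroup G] [NormedSpace ℝ G]
    (b : Module.Basis (Fin d) ℝ (Euc d)) {f : Euc d → G} (hf : ContDiff ℝ ∞ f)
    (hp : ∀ i, Function.Periodic f (b i)) : SmoothBdd f := by
  refine ⟨hf, fun n => exists_norm_le_of_periodic b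
    (hf.continuous_iteratedFDeriv (by exact_mod_cast le_top)) fun i x => ?_⟩
  rw [← iteratedFDeriv_comp_add_right]
  congr 1
  funext y
  exact hp i y

theorem periodic_dirDeriv {f : Euc d → ℝ} {u : Euc d} (hp : Function.Periodic f u) (v : Euc d) :
    Function.Periodic (dirDeriv v f) u := by
  intro x
  simp only [dirDeriv]
  rw [← fderiv_comp_add_right]
  congr 2
  funext y
  exact hp y

theorem inner_gradient_eq_dirDeriv (f : Euc d → ℝ) (x v : Euc d) :
    ⟪∇ f x, v⟫ = dirDeriv v f x := inner_gradient_left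

theorem gradient_eq_sum_dirDeriv (f : Euc d → ℝ) (x : Euc d) :
    ∇ f x = ∑ i, dirDeriv (stdVec i) f x • stdVec i := by
  conv_lhs => rw [← sum_inner_stdVec_smul (∇ f x)]
  refine Finset.sum_congr rfl fun i _ => ?_
  rw [real_inner_comm, inner_gradient_eq_dirDeriv]

theorem contDiff_gradient {f : Euc d → ℝ} (hf : ContDiff ℝ ∞ f) : ContDiff ℝ ∞ (∇ f) := by
  rw [funext (gradient_eq_sum_dirDeriv f)]
  exact ContDiff.sum fun i _ => (hf.dirDeriv _).smul contDiff_const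

theorem periodic_gradient {f : Euc d → ℝ} {u : Euc d} (hp : Function.Periodic f u) :
    Function.Periodic (∇ f) u := by
  intro x
  rw [gradient_eq_sum_dirDeriv, gradient_eq_sum_dirDeriv]
  simp only [periodic_dirDeriv hp _ x]

/-- The derivative of the gradient field in the direction `v`. -/
def gradientDeriv (f : Euc d → ℝ) (v x : Euc d) : Euc d :=
  ∑ i, dirDeriv v (dirDeriv (stdVec i) f) x • stdVec i

theorem dirDeriv_dirDeriv_eq_sum {f : Euc d → ℝ} (hf : ContDiff ℝ ∞ f) (v u : Euc d) (x : Euc d) :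
    dirDeriv v (dirDeriv u f) x =
      ∑ i, ⟪stdVec i, u⟫ * dirDeriv v (dirDeriv (stdVec i) f) x := by
  rw [funext (dirDeriv_eq_sum u f), dirDeriv_sum _ fun i => contDiff_const.mul (hf.dirDeriv _)]
  exact Finset.sum_congr rfl fun i _ => dirDeriv_const_mul (hf.dirDeriv _) _ _ _

theorem inner_gradientDeriv {f : Euc d → ℝ} (hf : ContDiff ℝ ∞ f) (v x u : Euc d) :
    ⟪gradientDeriv f v x, u⟫ = dirDeriv v (dirDeriv u f) x := by
  rw [dirDeriv_dirDeriv_eq_sum hf, gradientDeriv, sum_inner]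
  exact Finset.sum_congr rfl fun i _ => by rw [real_inner_smul_left, mul_comm]

/-- The second derivative of the gradient field, twice in the direction `v`. -/
def gradientDeriv₂ (f : Euc d → ℝ) (v x : Euc d) : Euc d :=
  ∑ i, dirDeriv v (dirDeriv v (dirDeriv (stdVec i) f)) x • stdVec i

theorem inner_gradientDeriv₂ {f : Euc d → ℝ} (hf : ContDiff ℝ ∞ f) (v x u : Euc d) :
    ⟪gradientDeriv₂ f v x, u⟫ = dirDeriv v (dirDeriv v (dirDeriv u f)) x := by
  rw [funext (dirDeriv_dirDeriv_eq_sum hf v u),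
    dirDeriv_sum _ fun i => contDiff_const.mul ((hf.dirDeriv _).dirDeriv _),
    gradientDeriv₂, sum_inner]
  refine Finset.sum_congr rfl fun i _ => ?_
  rw [dirDeriv_const_mul ((hf.dirDeriv _).dirDeriv _), real_inner_smul_left, mul_comm]

end Torus

/-! ### Explicit Picard approximants of the proposals -/

section Approximants

variable {d : ℕ}

/-- The point at which the approximate proposal evaluates the drift. -/
def approxPoint (ε : ℝ) (Φ : Euc d → ℝ) (p : Euc d × Euc d) (h : ℝ) : Euc d :=
  ((1 / 2 : ℝ) * h ^ 1) • p.2 + (ε / 4 * h ^ 2) • ∇ Φ (p.1 + ((1 / 2 : ℝ) * h ^ 1) • p.2)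

/-- The displacement of the approximate proposal. -/
def approxDisp (ε : ℝ) (Φ : Euc d → ℝ) (p : Euc d × Euc d) (h : ℝ) : Euc d :=
  h ^ 1 • p.2 + ((1 / 2 : ℝ) * h ^ 2) • ∇ Φ (p.1 + approxPoint ε Φ p h)

/-- The increment of an observable along the approximate proposal. -/
def approxIncr (ε : ℝ) (Φ ψ : Euc d → ℝ) (p : Euc d × Euc d) (h : ℝ) : ℝ :=
  ψ (p.1 + approxDisp ε Φ p h) - ψ p.1

/-- The exponent in the acceptance rate of the approximate proposal. -/
def approxExponent (ε : ℝ) (Φ : Euc d → ℝ) (p : Euc d × Euc d) (h : ℝ) : ℝ :=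
  ⟪∇ Φ (p.1 + approxPoint ε Φ p h), approxDisp ε Φ p h⟫ - approxIncr ε Φ Φ p h

variable {ε : ℝ} {Φ ψ : Euc d → ℝ}

/-- In the explicit formulas `g` occurs only in the product `h g`, and otherwise `h` occurs only
squared. Reflecting the Gaussian is therefore reflecting `h`, which is why the approximants are
defined for negative `h` as well. -/
theorem approxPoint_neg (p : Euc d × Euc d) (h : ℝ) :
    approxPoint ε Φ (p.1, -p.2) h = approxPoint ε Φ p (-h) := by
  simp [approxPoint]

theorem approxDisp_neg (p : Euc d × Euc d) (h : ℝ) :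
    approxDisp ε Φ (p.1, -p.2) h = approxDisp ε Φ p (-h) := by
  simp [approxDisp, approxPoint_neg]

theorem approxIncr_neg (p : Euc d × Euc d) (h : ℝ) :
    approxIncr ε Φ ψ (p.1, -p.2) h = approxIncr ε Φ ψ p (-h) := by
  simp [approxIncr, approxDisp_neg]

theorem approxExponent_neg (p : Euc d × Euc d) (h : ℝ) :
    approxExponent ε Φ (p.1, -p.2) h = approxExponent ε Φ p (-h) := by
  simp [approxExponent, approxDisp_neg, approxPoint_neg, approxIncr_neg]

/-- The weight `1 + |g|`. -/
def gaussWeight (p : Euc d × Euc d) : ℝ := 1 + ‖p.2‖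

theorem one_le_gaussWeight (p : Euc d × Euc d) : 1 ≤ gaussWeight p := by
  simp [gaussWeight]

theorem polyBdd_mul_pow_smul (c : ℝ) (k : ℕ) :
    PolyBdd gaussWeight (fun (p : Euc d × Euc d) (h : ℝ) => (c * h ^ k) • p.2) :=
  ((PolyBdd.monomial one_le_gaussWeight k).const_mul c).smul one_le_gaussWeight
    (PolyBdd.const one_le_gaussWeight (C := 1) (N := 1) zero_le_one
      fun p => by simp [gaussWeight])

/-- The approximants are finite compositions of monomials in `h`, of `g` and of bounded smooth maps,
so the closure rules of `PolyBdd` apply. -/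
theorem polyBdd_approxPoint (hF : SmoothBdd (∇ Φ)) :
    PolyBdd gaussWeight (approxPoint ε Φ) :=
  (polyBdd_mul_pow_smul (1 / 2) 1).add one_le_gaussWeight
    (((PolyBdd.monomial one_le_gaussWeight 2).const_mul (ε / 4)).smul one_le_gaussWeight
      ((polyBdd_mul_pow_smul (1 / 2) 1).comp one_le_gaussWeight hF.smooth hF.bound Prod.fst))

theorem polyBdd_gradient_approxPoint (hF : SmoothBdd (∇ Φ)) :
    PolyBdd gaussWeight (fun p h => ∇ Φ (p.1 + approxPoint ε Φ p h)) :=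
  (polyBdd_approxPoint hF).comp one_le_gaussWeight hF.smooth hF.bound Prod.fst

theorem polyBdd_approxDisp (hF : SmoothBdd (∇ Φ)) :
    PolyBdd gaussWeight (approxDisp ε Φ) := by
  refine PolyBdd.add one_le_gaussWeight ?_
    (((PolyBdd.monomial one_le_gaussWeight 2).const_mul (1 / 2)).smul one_le_gaussWeight
      (polyBdd_gradient_approxPoint hF))
  simpa using polyBdd_mul_pow_smul (d := d) 1 1

theorem polyBdd_approxIncr (hF : SmoothBdd (∇ Φ)) (hψ : SmoothBdd ψ) :
    PolyBdd gaussWeight (approxIncr ε Φ ψ) := by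
  obtain ⟨C, hC0, hC⟩ := hψ.exists_norm_le
  exact ((polyBdd_approxDisp hF).comp one_le_gaussWeight hψ.smooth hψ.bound Prod.fst).sub
    one_le_gaussWeight (PolyBdd.const one_le_gaussWeight (N := 0) hC0 fun p => by simpa using hC p.1)

theorem polyBdd_approxExponent (hF : SmoothBdd (∇ Φ)) (hΦ : SmoothBdd Φ) :
    PolyBdd gaussWeight (approxExponent ε Φ) := by
  refine PolyBdd.sub one_le_gaussWeight ?_ (polyBdd_approxIncr hF hΦ)
  -- The inner product is split into coordinates, which reduces it to the scalar product rule.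
  have h := PolyBdd.sum one_le_gaussWeight (Finset.univ : Finset (Fin d)) fun i _ =>
    ((polyBdd_gradient_approxPoint (ε := ε) hF).clm (innerSL ℝ (stdVec i))).mul one_le_gaussWeight
      ((polyBdd_approxDisp (ε := ε) hF).clm (innerSL ℝ (stdVec i)))
  refine h.congr fun p h => ?_
  simp only [innerSL_apply_apply]
  conv_lhs => rw [← sum_inner_stdVec_smul (approxDisp ε Φ p h), inner_sum]
  refine Finset.sum_congr rfl fun i _ => ?_
  rw [real_inner_smul_right, real_inner_comm (stdVec i)]
  ring

end Approximants

/-! ### Expansions in `h` for a fixed starting point and increment -/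

section PointwiseExpansion

open Asymptotics Topology

variable {d : ℕ}

theorem isBigO_inner {E : Type*} [NormedAddCommGroup E] [InnerProductSpace ℝ E] {u v : ℝ → E}
    {m n : ℕ} (hu : u =O[𝓝 0] fun h => h ^ m) (hv : v =O[𝓝 0] fun h => h ^ n) :
    (fun h => ⟪u h, v h⟫) =O[𝓝 0] fun h => h ^ (m + n) := by
  have h1 := hu.norm_left.mul hv.norm_left
  simp_rw [pow_add]
  refine IsBigO.trans (IsBigO.of_bound 1 (Filter.Eventually.of_forall fun h => ?_)) h1
  rw [one_mul, norm_mul, norm_norm, norm_norm]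
  exact norm_inner_le_norm _ _

theorem SmoothBdd.isBigO_sub {E G : Type*} [NormedAddCommGroup E] [NormedSpace ℝ E]
    [NormedAddCommGroup G] [NormedSpace ℝ G] {V : E → G} (hV : SmoothBdd V) {u v : ℝ → E} {n : ℕ}
    (h : (fun x => u x - v x) =O[𝓝 0] fun x => x ^ n) :
    (fun x => V (u x) - V (v x)) =O[𝓝 0] fun x => x ^ n := by
  obtain ⟨C, -, hC⟩ := hV.exists_lipschitz
  exact IsBigO.trans (IsBigO.of_bound C (Filter.Eventually.of_forall fun x => hC _ _)) h

theorem isBigO_const_mul_pow_smul {E : Type*} [NormedAddCommGroup E] [NormedSpace ℝ E]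
    {f : ℝ → E} {n : ℕ} (k : ℕ) (r : ℝ) (hf : f =O[𝓝 0] fun x => x ^ n) :
    (fun x => (r * x ^ k) • f x) =O[𝓝 0] fun x => x ^ (k + n) := by
  have : (fun x : ℝ => r * x ^ k) =O[𝓝 0] fun x => x ^ k := isBigO_const_mul_self r _ _
  simpa [pow_add] using this.smul hf

theorem isBigO_const_mul_pow_smul_const {E : Type*} [NormedAddCommGroup E] [NormedSpace ℝ E]
    (k : ℕ) (r : ℝ) (v : E) :
    (fun x : ℝ => (r * x ^ k) • v) =O[𝓝 0] fun x => x ^ k := by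
  have h : (fun _ : ℝ => v) =O[𝓝 0] fun x : ℝ => x ^ 0 := by
    simpa using isBigO_const_const v (one_ne_zero (α := ℝ)) (𝓝 0)
  simpa using isBigO_const_mul_pow_smul k r h

theorem dirDeriv_smul_dirDeriv_smul {φ : Euc d → ℝ} (hφ : ContDiff ℝ ∞ φ) (r : ℝ) (v x : Euc d) :
    dirDeriv (r • v) (dirDeriv (r • v) φ) x = r ^ 2 * dirDeriv v (dirDeriv v φ) x := by
  rw [funext (dirDeriv_smul_left r v φ), dirDeriv_smul_left,
    dirDeriv_const_mul (hφ.dirDeriv v)]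
  ring

variable {ε : ℝ} {Φ ψ : Euc d → ℝ}

/-- The coefficient of `h ^ 2` in the expansion of the drift. -/
def driftCoeff (ε : ℝ) (Φ : Euc d → ℝ) (p : Euc d × Euc d) : Euc d :=
  (1 / 8 : ℝ) • gradientDeriv₂ Φ p.2 p.1 + (ε / 4) • gradientDeriv Φ (∇ Φ p.1) p.1

theorem gradient_approxPoint_isBigO (hΦ : SmoothBdd Φ) (hF : SmoothBdd (∇ Φ))
    (p : Euc d × Euc d) :
    (fun h => ∇ Φ (p.1 + approxPoint ε Φ p h) - (∇ Φ p.1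
      + ((1 / 2 : ℝ) * h ^ 1) • gradientDeriv Φ p.2 p.1 + h ^ 2 • driftCoeff ε Φ p))
      =O[𝓝 0] fun h => h ^ 3 := by
  obtain ⟨q, g⟩ := p
  simp only
  have h1 : (fun h : ℝ => (q + ((1 / 2 : ℝ) * h ^ 1) • g) - q) =O[𝓝 0] fun h => h ^ 1 := by
    simpa using isBigO_const_mul_pow_smul_const 1 (1 / 2) g
  -- Freezing the inner drift at `q` costs `O(h)`, multiplied by `h ^ 2`.
  have h2 : (fun h => (q + approxPoint ε Φ (q, g) h)
      - quarticCurve q ((1 / 2 : ℝ) • g) ((ε / 4) • ∇ Φ q) 0 0 h) =O[𝓝 0] fun h => h ^ 3 := by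
    refine (isBigO_const_mul_pow_smul 2 (ε / 4) (hF.isBigO_sub h1)).congr_left fun h => ?_
    simp only [approxPoint, quarticCurve]
    module
  have h3 : (fun h => ∇ Φ (quarticCurve q ((1 / 2 : ℝ) • g) ((ε / 4) • ∇ Φ q) 0 0 h) - (∇ Φ q
      + ((1 / 2 : ℝ) * h ^ 1) • gradientDeriv Φ g q + h ^ 2 • driftCoeff ε Φ (q, g)))
      =O[𝓝 0] fun h => h ^ 3 := by
    have h4 : ∀ i : Fin d, (fun h => (dirDeriv (stdVec i) Φ
        (quarticCurve q ((1 / 2 : ℝ) • g) ((ε / 4) • ∇ Φ q) 0 0 h)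
        - (dirDeriv (stdVec i) Φ q + h * dirDeriv ((1 / 2 : ℝ) • g) (dirDeriv (stdVec i) Φ) q
        + h ^ 2 * (dirDeriv ((ε / 4) • ∇ Φ q) (dirDeriv (stdVec i) Φ) q + 1 / 2 *
          dirDeriv ((1 / 2 : ℝ) • g) (dirDeriv ((1 / 2 : ℝ) • g) (dirDeriv (stdVec i) Φ)) q)))
        • stdVec i) =O[𝓝 0] fun h => h ^ 3 := fun i => by
      have e1 := comp_quarticCurve_isBigO_three q ((1 / 2 : ℝ) • g) ((ε / 4) • ∇ Φ q) 0 0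
        (hΦ.smooth.dirDeriv (stdVec i))
      have e2 : (fun _ : ℝ => stdVec i) =O[𝓝 0] fun _ : ℝ => (1 : ℝ) :=
        isBigO_const_const _ one_ne_zero _
      simpa using e1.smul e2
    have h5 := IsBigO.fun_sum (s := (Finset.univ : Finset (Fin d))) fun i _ => h4 i
    refine h5.congr_left fun h => ?_
    refine Eq.trans ?_ (congrArg₂ (fun u v => u - (v + ((1 / 2 : ℝ) * h ^ 1) • gradientDeriv Φ g q
      + h ^ 2 • driftCoeff ε Φ (q, g))) (gradient_eq_sum_dirDeriv Φ _).symm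
      (gradient_eq_sum_dirDeriv Φ q).symm)
    simp only [driftCoeff, gradientDeriv, gradientDeriv₂]
    simp only [Finset.smul_sum, ← Finset.sum_add_distrib, ← Finset.sum_sub_distrib]
    refine Finset.sum_congr rfl fun i _ => ?_
    rw [dirDeriv_smul_dirDeriv_smul (hΦ.smooth.dirDeriv _), dirDeriv_smul_left,
      dirDeriv_smul_left]
    module
  exact ((hF.isBigO_sub h2).add h3).congr_left fun h => by abel

/-- The drift enters the displacement with the factor `h ^ 2 / 2`, so its third-order error becomes
a fifth-order one. -/
theorem approxDisp_isBigO (hΦ : SmoothBdd Φ) (hF : SmoothBdd (∇ Φ)) (p : Euc d × Euc d) :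
    (fun h => (p.1 + approxDisp ε Φ p h) - quarticCurve p.1 p.2 ((1 / 2 : ℝ) • ∇ Φ p.1)
      ((1 / 4 : ℝ) • gradientDeriv Φ p.2 p.1) ((1 / 2 : ℝ) • driftCoeff ε Φ p) h)
      =O[𝓝 0] fun h => h ^ 5 := by
  refine (isBigO_const_mul_pow_smul 2 (1 / 2)
    (gradient_approxPoint_isBigO (ε := ε) hΦ hF p)).congr_left fun h => ?_
  simp only [approxDisp, quarticCurve]
  module

/-- The coefficient of `h ^ 2` in the expansion of the increment of `ψ`. -/
def incrCoeff₂ (Φ ψ : Euc d → ℝ) (p : Euc d × Euc d) : ℝ :=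
  1 / 2 * dirDeriv (∇ Φ p.1) ψ p.1 + 1 / 2 * dirDeriv p.2 (dirDeriv p.2 ψ) p.1

/-- The coefficient of `h ^ 3` in the expansion of the increment of `ψ`. -/
def incrCoeff₃ (Φ ψ : Euc d → ℝ) (p : Euc d × Euc d) : ℝ :=
  1 / 4 * dirDeriv (gradientDeriv Φ p.2 p.1) ψ p.1
    + 1 / 2 * dirDeriv (∇ Φ p.1) (dirDeriv p.2 ψ) p.1
    + 1 / 6 * dirDeriv p.2 (dirDeriv p.2 (dirDeriv p.2 ψ)) p.1

/-- The coefficient of `h ^ 4` in the expansion of the increment of `ψ`. -/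
def incrCoeff₄ (ε : ℝ) (Φ ψ : Euc d → ℝ) (p : Euc d × Euc d) : ℝ :=
  1 / 2 * dirDeriv (driftCoeff ε Φ p) ψ p.1
    + 1 / 4 * dirDeriv (gradientDeriv Φ p.2 p.1) (dirDeriv p.2 ψ) p.1
    + 1 / 8 * dirDeriv (∇ Φ p.1) (dirDeriv (∇ Φ p.1) ψ) p.1
    + 1 / 4 * dirDeriv (∇ Φ p.1) (dirDeriv p.2 (dirDeriv p.2 ψ)) p.1
    + 1 / 24 * dirDeriv p.2 (dirDeriv p.2 (dirDeriv p.2 (dirDeriv p.2 ψ))) p.1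

theorem approxIncr_isBigO_five (hΦ : SmoothBdd Φ) (hF : SmoothBdd (∇ Φ)) (hψ : SmoothBdd ψ)
    (p : Euc d × Euc d) :
    (fun h => approxIncr ε Φ ψ p h - (h * dirDeriv p.2 ψ p.1 + h ^ 2 * incrCoeff₂ Φ ψ p
      + h ^ 3 * incrCoeff₃ Φ ψ p + h ^ 4 * incrCoeff₄ ε Φ ψ p)) =O[𝓝 0] fun h => h ^ 5 := by
  have h1 := comp_quarticCurve_isBigO_five p.1 p.2 ((1 / 2 : ℝ) • ∇ Φ p.1)
      ((1 / 4 : ℝ) • gradientDeriv Φ p.2 p.1) ((1 / 2 : ℝ) • driftCoeff ε Φ p) hψ.smooth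
  refine ((hψ.isBigO_sub (approxDisp_isBigO (ε := ε) hΦ hF p)).add h1).congr_left fun h => ?_
  rw [dirDeriv_smul_dirDeriv_smul hψ.smooth]
  simp only [approxIncr, incrCoeff₂, incrCoeff₃, incrCoeff₄, dirDeriv_smul_left]
  ring

theorem approxIncr_isBigO_four (hΦ : SmoothBdd Φ) (hF : SmoothBdd (∇ Φ)) (hψ : SmoothBdd ψ)
    (p : Euc d × Euc d) :
    (fun h => approxIncr ε Φ ψ p h - (h * dirDeriv p.2 ψ p.1 + h ^ 2 * incrCoeff₂ Φ ψ p
      + h ^ 3 * incrCoeff₃ Φ ψ p)) =O[𝓝 0] fun h => h ^ 4 := by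
  have h1 : (fun h : ℝ => incrCoeff₄ ε Φ ψ p * h ^ 4) =O[𝓝 0] fun h => h ^ 4 :=
    isBigO_const_mul_self _ _ _
  refine (((approxIncr_isBigO_five (ε := ε) hΦ hF hψ p).trans
    (pow_isBigO_pow_of_le (by norm_num : 4 ≤ 5))).add h1).congr_left fun h => ?_
  ring

theorem approxIncr_isBigO_one (hΦ : SmoothBdd Φ) (hF : SmoothBdd (∇ Φ)) (hψ : SmoothBdd ψ)
    (p : Euc d × Euc d) :
    approxIncr ε Φ ψ p =O[𝓝 0] fun h => h ^ 1 := by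
  have h1 : (fun h : ℝ => dirDeriv p.2 ψ p.1 * h ^ 1) =O[𝓝 0] fun h => h ^ 1 :=
    isBigO_const_mul_self _ _ _
  have h2 : (fun h : ℝ => incrCoeff₂ Φ ψ p * h ^ 2) =O[𝓝 0] fun h => h ^ 1 :=
    (isBigO_const_mul_self _ _ _).trans (pow_isBigO_pow_of_le (by norm_num))
  have h3 : (fun h : ℝ => incrCoeff₃ Φ ψ p * h ^ 3) =O[𝓝 0] fun h => h ^ 1 :=
    (isBigO_const_mul_self _ _ _).trans (pow_isBigO_pow_of_le (by norm_num))
  refine ((((approxIncr_isBigO_four (ε := ε) hΦ hF hψ p).trans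
    (pow_isBigO_pow_of_le (by norm_num : 1 ≤ 4))).add h1).add (h2.add h3)).congr_left fun h => ?_
  ring

/-- The leading coefficient of the exponent in the acceptance rate. -/
def exponentCoeff (ε : ℝ) (Φ : Euc d → ℝ) (p : Euc d × Euc d) : ℝ :=
  -((1 - ε) / 4 * dirDeriv (∇ Φ p.1) (dirDeriv p.2 Φ) p.1
    + 1 / 24 * dirDeriv p.2 (dirDeriv p.2 (dirDeriv p.2 Φ)) p.1)

/-- The drift is evaluated near the middle of the move, so the terms in `h` and `h ^ 2` of the work
of the drift and of the increment of `Φ` agree and cancel. -/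
theorem approxExponent_isBigO (hΦ : SmoothBdd Φ) (hF : SmoothBdd (∇ Φ)) (p : Euc d × Euc d) :
    (fun h => approxExponent ε Φ p h - h ^ 3 * exponentCoeff ε Φ p) =O[𝓝 0] fun h => h ^ 4 := by
  obtain ⟨q, g⟩ := p
  have hR := gradient_approxPoint_isBigO (ε := ε) hΦ hF (q, g)
  have hD := approxIncr_isBigO_four (ε := ε) hΦ hF hΦ (q, g)
  have c0 : ∀ v : Euc d, (fun _ : ℝ => v) =O[𝓝 0] fun h : ℝ => h ^ 0 := fun v => by
    simpa using isBigO_const_const v (one_ne_zero (α := ℝ)) (𝓝 0)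
  set Fm : ℝ → Euc d := fun h => ∇ Φ (q + approxPoint ε Φ (q, g) h) with hFm
  set F₀ := ∇ Φ q with hF₀
  set K := gradientDeriv Φ g q with hK
  set A := driftCoeff ε Φ (q, g) with hA
  have hR2 : (fun h => Fm h - (F₀ + ((1 / 2 : ℝ) * h ^ 1) • K)) =O[𝓝 0] fun h => h ^ 2 := by
    refine ((hR.trans (pow_isBigO_pow_of_le (by norm_num : 2 ≤ 3))).add
      (isBigO_const_mul_pow_smul_const 2 1 A)).congr_left fun h => ?_
    simp only [hFm, hF₀, hK]
    module
  -- Writing `X` for the first-order expansion of `Fm`, `‖Fm‖² - ‖X‖² = ⟪Fm + X, Fm - X⟫` is a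
  -- bounded factor against one of order `h ^ 2`. The leftover `‖h K / 2‖²` from `‖X‖²` gives `t3`.
  have hS : (fun h => Fm h + (F₀ + ((1 / 2 : ℝ) * h ^ 1) • K)) =O[𝓝 0] fun h => h ^ 0 := by
    refine (((hR2.trans (pow_isBigO_pow_of_le (by norm_num : 0 ≤ 2))).add
      (c0 ((2 : ℝ) • F₀))).add ((isBigO_const_mul_pow_smul_const 1 1 K).trans
        (pow_isBigO_pow_of_le (by norm_num : 0 ≤ 1)))).congr_left fun h => ?_
    module
  have t1 := isBigO_const_mul_pow_mul 1 1 (isBigO_inner hR (c0 g))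
  have t2 := isBigO_const_mul_pow_mul 2 (1 / 2) (isBigO_inner hS hR2)
  have t3 : (fun h : ℝ => (1 / 8 * ⟪K, K⟫) * h ^ 4) =O[𝓝 0] fun h => h ^ 4 :=
    isBigO_const_mul_self _ _ _
  refine (((t1.add t2).add t3).sub hD).congr_left fun h => ?_
  have e1 : dirDeriv g Φ q = ⟪F₀, g⟫ := (inner_gradient_eq_dirDeriv Φ q g).symm
  have e2 : dirDeriv F₀ Φ q = ⟪F₀, F₀⟫ := (inner_gradient_eq_dirDeriv Φ q _).symm
  have e3 : dirDeriv g (dirDeriv g Φ) q = ⟪K, g⟫ := (inner_gradientDeriv hΦ.smooth g q g).symm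
  have e4 : dirDeriv K Φ q = ⟪K, F₀⟫ := by
    rw [real_inner_comm]; exact (inner_gradient_eq_dirDeriv Φ q _).symm
  have e5 : dirDeriv F₀ (dirDeriv g Φ) q = ⟪K, F₀⟫ := by
    rw [dirDeriv_comm hΦ.smooth]; exact (inner_gradientDeriv hΦ.smooth g q F₀).symm
  have e6 : ⟪A, g⟫ = 1 / 8 * dirDeriv g (dirDeriv g (dirDeriv g Φ)) q + ε / 4 * ⟪K, F₀⟫ := by
    rw [hA, driftCoeff, inner_add_left, real_inner_smul_left, real_inner_smul_left,
      inner_gradientDeriv₂ hΦ.smooth, inner_gradientDeriv hΦ.smooth]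
    simp only
    rw [← hF₀, e5]
  have e7 : approxExponent ε Φ (q, g) h =
      h * ⟪Fm h, g⟫ + 1 / 2 * h ^ 2 * ⟪Fm h, Fm h⟫ - approxIncr ε Φ Φ (q, g) h := by
    simp only [approxExponent, approxDisp, inner_add_right, real_inner_smul_right, hFm]
    ring
  rw [e7]
  simp only [incrCoeff₂, incrCoeff₃, exponentCoeff, inner_add_left, inner_sub_left,
    inner_sub_right, inner_add_right, real_inner_smul_left, real_inner_smul_right,
    ← hF₀, ← hK, e1, e2, e3, e4, e5, e6]
  have e8 : ⟪Fm h, K⟫ = ⟪K, Fm h⟫ := real_inner_comm _ _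
  have e9 : ⟪Fm h, F₀⟫ = ⟪F₀, Fm h⟫ := real_inner_comm _ _
  have e10 : ⟪F₀, K⟫ = ⟪K, F₀⟫ := real_inner_comm _ _
  rw [e8, e9, e10]
  change 1 * h ^ 1 * (⟪Fm h, g⟫ - _) + _ + _ - _ = _
  ring

/-- The coefficient of `h ^ 4` in the averaged expansion of the accepted increment. -/
def acceptedCoeff (ε : ℝ) (Φ ψ : Euc d → ℝ) (p : Euc d × Euc d) : ℝ :=
  1 / 2 * incrCoeff₄ ε Φ ψ p - 1 / 4 * (exponentCoeff ε Φ p * dirDeriv p.2 ψ p.1)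

/-- The increment weighted by the linearised Barker rate. -/
def approxAccepted (ε : ℝ) (Φ ψ : Euc d → ℝ) (p : Euc d × Euc d) (h : ℝ) : ℝ :=
  (1 / 2 - 1 / 4 * approxExponent ε Φ p h) * approxIncr ε Φ ψ p h

/-- The exponent is `O(h ^ 3)` and the increment `O(h)`, so up to fourth order their product
contributes only the product of the leading coefficients. -/
theorem approxAccepted_isBigO (hΦ : SmoothBdd Φ) (hF : SmoothBdd (∇ Φ)) (hψ : SmoothBdd ψ)
    (p : Euc d × Euc d) :
    (fun h => approxAccepted ε Φ ψ p h - (h * (1 / 2 * dirDeriv p.2 ψ p.1)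
      + h ^ 2 * (1 / 2 * incrCoeff₂ Φ ψ p) + h ^ 3 * (1 / 2 * incrCoeff₃ Φ ψ p)
      + h ^ 4 * acceptedCoeff ε Φ ψ p)) =O[𝓝 0] fun h => h ^ 5 := by
  have hD := approxIncr_isBigO_five (ε := ε) hΦ hF hψ p
  have hα := approxExponent_isBigO (ε := ε) hΦ hF p
  have hD1 := approxIncr_isBigO_one (ε := ε) hΦ hF hψ p
  have hD2 : (fun h => approxIncr ε Φ ψ p h - h * dirDeriv p.2 ψ p.1) =O[𝓝 0]
      fun h => h ^ 2 := by
    have h2 : (fun h : ℝ => incrCoeff₂ Φ ψ p * h ^ 2) =O[𝓝 0] fun h => h ^ 2 :=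
      isBigO_const_mul_self _ _ _
    have h3 : (fun h : ℝ => incrCoeff₃ Φ ψ p * h ^ 3) =O[𝓝 0] fun h => h ^ 2 :=
      (isBigO_const_mul_self _ _ _).trans (pow_isBigO_pow_of_le (by norm_num))
    refine (((approxIncr_isBigO_four (ε := ε) hΦ hF hψ p).trans
      (pow_isBigO_pow_of_le (by norm_num : 2 ≤ 4))).add (h2.add h3)).congr_left fun h => ?_
    ring
  have t1 := (hα.mul hD1).congr_right fun h => (pow_add h 4 1).symm
  have t2 := isBigO_const_mul_pow_mul 3 (exponentCoeff ε Φ p) hD2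
  refine ((hD.const_mul_left (1 / 2)).sub ((t1.add t2).const_mul_left (1 / 4))).congr_left
    fun h => ?_
  simp only [approxAccepted, acceptedCoeff]
  ring

end PointwiseExpansion

/-! ### Uniform estimates, and comparison of the proposals with their approximants -/

section UniformEstimates

open Asymptotics Topology

/-- Subtracting the expansion does not change the sixth derivative, so no bound on its coefficients
is needed. -/
theorem iteratedDeriv_six_quartic (a b x : ℝ) :
    iteratedDeriv 6 (fun x : ℝ => x ^ 2 * a + x ^ 4 * b) x = 0 := by
  have step : ∀ c₀ c₁ c₂ c₃ c₄ : ℝ,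
      deriv (fun x : ℝ => c₀ + c₁ * x + c₂ * x ^ 2 + c₃ * x ^ 3 + c₄ * x ^ 4) =
        fun x => c₁ + (2 * c₂) * x + (3 * c₃) * x ^ 2 + (4 * c₄) * x ^ 3 + 0 * x ^ 4 := by
    intro c₀ c₁ c₂ c₃ c₄
    funext x
    have := (((((hasDerivAt_id x).const_mul c₁).const_add c₀).fun_add
      ((hasDerivAt_pow 2 x).const_mul c₂)).fun_add ((hasDerivAt_pow 3 x).const_mul c₃)).fun_add
      ((hasDerivAt_pow 4 x).const_mul c₄)
    refine this.deriv.trans ?_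
    norm_num
    ring
  have e : (fun x : ℝ => x ^ 2 * a + x ^ 4 * b) =
      fun x => 0 + 0 * x + a * x ^ 2 + 0 * x ^ 3 + b * x ^ 4 := by
    funext x; ring
  rw [e]
  iterate 6 rw [iteratedDeriv_succ', step]
  simp

/-- In a family of even functions, the remainder of a fourth order expansion has order six. -/
theorem PolyBdd.uniform_of_even_of_isBigO_five {Ω : Type*} {w : Ω → ℝ} {f : Ω → ℝ → ℝ}
    (hf : PolyBdd w f) (heven : ∀ p x, f p (-x) = f p x) (a b : Ω → ℝ)
    (h : ∀ p, (fun x => f p x - (x ^ 2 * a p + x ^ 4 * b p)) =O[𝓝 0] fun x => x ^ 5) :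
    ∃ (C : ℝ) (N : ℕ), 0 ≤ C ∧ ∀ p x, |x| ≤ 1 →
      |f p x - (x ^ 2 * a p + x ^ 4 * b p)| ≤ C * w p ^ N * |x| ^ 6 := by
  obtain ⟨C, N, hC, hb⟩ := hf.bound 6
  have hpoly : ∀ p, ContDiff ℝ ∞ fun x : ℝ => x ^ 2 * a p + x ^ 4 * b p := fun p => by fun_prop
  have hs : ∀ p, ContDiff ℝ ∞ fun x => f p x - (x ^ 2 * a p + x ^ 4 * b p) := fun p =>
    (hf.smooth p).sub (hpoly p)
  refine ⟨C, N, hC, fun p x hx => norm_le_of_iteratedDeriv_eq_zero (hs p)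
    (fun k hk => ?_) (fun y hy => ?_) hx⟩
  · rcases Nat.lt_succ_iff_lt_or_eq.1 hk with hk | rfl
    · exact iteratedDeriv_eq_zero_of_isBigO (hs p) (h p) hk
    -- The fifth derivative of an even function is odd, hence vanishes at `0`.
    · have := iteratedDeriv_comp_neg 5 (fun x => f p x - (x ^ 2 * a p + x ^ 4 * b p)) 0
      have e : (fun x => f p (-x) - ((-x) ^ 2 * a p + (-x) ^ 4 * b p)) =
          fun x => f p x - (x ^ 2 * a p + x ^ 4 * b p) := by
        funext x
        rw [heven]
        ring
      rw [e] at this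
      norm_num at this
      linarith
  · have h6 := hb p y hy
    rw [norm_iteratedFDeriv_eq_norm_iteratedDeriv] at h6
    rw [iteratedDeriv_fun_sub (contDiff_infty.1 (hf.smooth p) 6).contDiffAt
      (contDiff_infty.1 (hpoly p) 6).contDiffAt, iteratedDeriv_six_quartic, sub_zero]
    exact h6

theorem le_mul_pow_mono {x y w C C' : ℝ} {N N' : ℕ} (hx : x ≤ C * w ^ N * y) (hy : 0 ≤ y)
    (hw : 1 ≤ w) (hC : C ≤ C') (hC' : 0 ≤ C') (hN : N ≤ N') : x ≤ C' * w ^ N' * y := by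
  refine hx.trans ?_
  have := pow_le_pow_right₀ hw hN
  gcongr

theorem isBigO_pow_comp_neg {f : ℝ → ℝ} {n : ℕ} (hf : f =O[𝓝 0] fun h => h ^ n) :
    (fun h => f (-h)) =O[𝓝 0] fun h => h ^ n := by
  have ht : Filter.Tendsto (fun h : ℝ => -h) (𝓝 0) (𝓝 0) := by
    simpa using (continuous_neg (G := ℝ)).tendsto 0
  have h1 := hf.comp_tendsto ht
  refine h1.trans (IsBigO.of_bound 1 (Filter.Eventually.of_forall fun h => ?_))
  simp

variable {d : ℕ} {ε : ℝ} {Φ ψ : Euc d → ℝ}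

/-- Symmetrising in `h` makes each family even, so each odd order of vanishing improves by one: `1`
to `2`, `3` to `4`, `5` to `6`. -/
theorem exists_approx_bounds (ε : ℝ) (hΦ : SmoothBdd Φ) (hF : SmoothBdd (∇ Φ))
    (hψ : SmoothBdd ψ) :
    ∃ (C : ℝ) (N : ℕ), 1 ≤ C ∧ ∀ (p : Euc d × Euc d) (h : ℝ), |h| ≤ 1 →
      |approxIncr ε Φ ψ p h| ≤ C * gaussWeight p ^ N * |h| ∧
      |approxExponent ε Φ p h| ≤ C * gaussWeight p ^ N * |h| ^ 3 ∧
      |approxIncr ε Φ ψ p h + approxIncr ε Φ ψ p (-h)| ≤ C * gaussWeight p ^ N * |h| ^ 2 ∧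
      |approxExponent ε Φ p h + approxExponent ε Φ p (-h)| ≤ C * gaussWeight p ^ N * |h| ^ 4 ∧
      |approxAccepted ε Φ ψ p h + approxAccepted ε Φ ψ p (-h)
        - (h ^ 2 * incrCoeff₂ Φ ψ p + h ^ 4 * (2 * acceptedCoeff ε Φ ψ p))|
        ≤ C * gaussWeight p ^ N * |h| ^ 6 := by
  have pD := polyBdd_approxIncr (ε := ε) hF hψ
  have pA := polyBdd_approxExponent (ε := ε) hF hΦ
  have pJ : PolyBdd gaussWeight (approxAccepted ε Φ ψ) :=
    ((PolyBdd.const one_le_gaussWeight (c := fun _ : Euc d × Euc d => (1 / 2 : ℝ)) (C := 1) (N := 0)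
      zero_le_one (by norm_num)).sub one_le_gaussWeight (pA.const_mul (1 / 4))).mul
      one_le_gaussWeight pD
  have oD := approxIncr_isBigO_one (ε := ε) hΦ hF hψ
  have oA : ∀ p, approxExponent ε Φ p =O[𝓝 0] fun h => h ^ 3 := fun p => by
    refine (((approxExponent_isBigO (ε := ε) hΦ hF p).trans
      (pow_isBigO_pow_of_le (by norm_num : 3 ≤ 4))).add (isBigO_const_mul_self
        (exponentCoeff ε Φ p) (fun h : ℝ => h ^ 3) _)).congr_left fun h => ?_
    ring
  obtain ⟨C₁, N₁, hC₁, h₁⟩ := pD.uniform_of_isBigO oD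
  obtain ⟨C₂, N₂, hC₂, h₂⟩ := pA.uniform_of_isBigO oA
  obtain ⟨C₃, N₃, hC₃, h₃⟩ := (pD.add one_le_gaussWeight pD.reflect).uniform_of_isBigO_of_even
    (n := 1) odd_one (fun p x => by rw [neg_neg, add_comm])
    (fun p => (oD p).add (isBigO_pow_comp_neg (oD p)))
  obtain ⟨C₄, N₄, hC₄, h₄⟩ := (pA.add one_le_gaussWeight pA.reflect).uniform_of_isBigO_of_even
    (n := 3) (by decide) (fun p x => by rw [neg_neg, add_comm])
    (fun p => (oA p).add (isBigO_pow_comp_neg (oA p)))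
  obtain ⟨C₅, N₅, hC₅, h₅⟩ := (pJ.add one_le_gaussWeight
    pJ.reflect).uniform_of_even_of_isBigO_five (fun p x => by rw [neg_neg, add_comm])
    (fun p => incrCoeff₂ Φ ψ p) (fun p => 2 * acceptedCoeff ε Φ ψ p) (fun p => by
      have := approxAccepted_isBigO (ε := ε) hΦ hF hψ p
      refine (this.add (isBigO_pow_comp_neg this)).congr_left fun h => ?_
      ring)
  refine ⟨1 + (C₁ + C₂ + C₃ + C₄ + C₅), N₁ + N₂ + N₃ + N₄ + N₅, by linarith, fun p h hh => ?_⟩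
  have hw := one_le_gaussWeight p
  refine ⟨?_, ?_, ?_, ?_, ?_⟩
  · exact le_mul_pow_mono (by simpa using h₁ p h hh) (by positivity) hw (by linarith)
      (by linarith) (by omega)
  · exact le_mul_pow_mono (h₂ p h hh) (by positivity) hw (by linarith) (by linarith) (by omega)
  · exact le_mul_pow_mono (h₃ p h hh) (by positivity) hw (by linarith) (by linarith) (by omega)
  · exact le_mul_pow_mono (h₄ p h hh) (by positivity) hw (by linarith) (by linarith) (by omega)
  · exact le_mul_pow_mono (h₅ p h hh) (by positivity) hw (by linarith) (by linarith) (by omega)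

/-- `δ` is the displacement from `q` of the proposal with increment `g` and `√(2 Δt) = h`, when
the drift is evaluated at `q + m`. -/
structure IsDisplacement (ε : ℝ) (Φ : Euc d → ℝ) (q g : Euc d) (h : ℝ) (m δ : Euc d) : Prop where
  point : m = (1 / 2 * h) • g + (ε / 4 * h ^ 2) • ∇ Φ (q + m)
  disp : δ = h • g + (1 / 2 * h ^ 2) • ∇ Φ (q + m)

/-- The exponent in the acceptance rate of a displacement. -/
def dispExponent (Φ : Euc d → ℝ) (q m δ : Euc d) : ℝ :=
  ⟪∇ Φ (q + m), δ⟫ - (Φ (q + δ) - Φ q)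

/-- Each use of the drift gains a factor `h ^ 2`: the drift points differ by `O(h ^ 4)` and the
displacements by `O(h ^ 6)`. The exponent pairs a drift error `h ^ 4` with a displacement of size
`(1 + ‖g‖) h`, whence `h ^ 5`. -/
theorem exists_displacement_bounds (ε : ℝ) (hΦ : SmoothBdd Φ) (hF : SmoothBdd (∇ Φ))
    (hψ : SmoothBdd ψ) :
    ∃ C : ℝ, 1 ≤ C ∧ ∀ (q g : Euc d) (h : ℝ) (m δ : Euc d), 0 < h → h ≤ 1 →
      IsDisplacement ε Φ q g h m δ →
      |ψ (q + δ) - ψ q - approxIncr ε Φ ψ (q, g) h| ≤ C * gaussWeight (q, g) * h ^ 6 ∧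
      |dispExponent Φ q m δ - approxExponent ε Φ (q, g) h| ≤ C * gaussWeight (q, g) * h ^ 5 := by
  obtain ⟨M, hM0, hM⟩ := hF.exists_norm_le
  obtain ⟨L, hL0, hL⟩ := hF.exists_lipschitz
  obtain ⟨LΦ, hLΦ0, hLΦ⟩ := hΦ.exists_lipschitz
  obtain ⟨Lψ, hLψ0, hLψ⟩ := hψ.exists_lipschitz
  set c₁ := |ε / 4| * (L * (|ε / 4| * M)) with hc₁
  set c₂ := 1 / 2 * (L * c₁) with hc₂
  have hc₁0 : 0 ≤ c₁ := by positivity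
  have hc₂0 : 0 ≤ c₂ := by positivity
  refine ⟨1 + Lψ * c₂ + (L * c₁ * (1 + M) + M * c₂ + LΦ * c₂), by
    have : 0 ≤ L * c₁ * (1 + M) + M * c₂ + LΦ * c₂ := by positivity
    have : 0 ≤ Lψ * c₂ := by positivity
    linarith, fun q g h m δ h0 h1 hd => ?_⟩
  have hw := one_le_gaussWeight (q, g)
  have em : ‖m - approxPoint ε Φ (q, g) h‖ ≤ c₁ * h ^ 4 := by
    have e1 : m - approxPoint ε Φ (q, g) h =
        (ε / 4 * h ^ 2) • (∇ Φ (q + m) - ∇ Φ (q + ((1 / 2 : ℝ) * h ^ 1) • g)) := by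
      conv_lhs => rw [hd.point]
      simp only [approxPoint]
      module
    have e2 : (q + m) - (q + ((1 / 2 : ℝ) * h ^ 1) • g) = (ε / 4 * h ^ 2) • ∇ Φ (q + m) := by
      conv_lhs => rw [hd.point]
      module
    have e3 := hL (q + m) (q + ((1 / 2 : ℝ) * h ^ 1) • g)
    rw [e2, norm_smul, Real.norm_eq_abs, abs_mul, abs_of_pos (pow_pos h0 2)] at e3
    rw [e1, norm_smul, Real.norm_eq_abs, abs_mul, abs_of_pos (pow_pos h0 2)]
    calc |ε / 4| * h ^ 2 * ‖∇ Φ (q + m) - ∇ Φ (q + ((1 / 2 : ℝ) * h ^ 1) • g)‖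
        ≤ |ε / 4| * h ^ 2 * (L * (|ε / 4| * h ^ 2 * M)) := by
          gcongr
          exact e3.trans (by gcongr; exact hM _)
      _ = c₁ * h ^ 4 := by rw [hc₁]; ring
  have eF : ‖∇ Φ (q + m) - ∇ Φ (q + approxPoint ε Φ (q, g) h)‖ ≤ L * c₁ * h ^ 4 := by
    refine (hL _ _).trans ?_
    rw [add_sub_add_left_eq_sub, mul_assoc]
    gcongr
  have ed : ‖δ - approxDisp ε Φ (q, g) h‖ ≤ c₂ * h ^ 6 := by
    have e1 : δ - approxDisp ε Φ (q, g) h =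
        (1 / 2 * h ^ 2) • (∇ Φ (q + m) - ∇ Φ (q + approxPoint ε Φ (q, g) h)) := by
      conv_lhs => rw [hd.disp]
      simp only [approxDisp]
      module
    rw [e1, norm_smul, Real.norm_eq_abs, abs_of_pos (by positivity)]
    calc 1 / 2 * h ^ 2 * _ ≤ 1 / 2 * h ^ 2 * (L * c₁ * h ^ 4) := by gcongr
      _ = c₂ * h ^ 6 := by rw [hc₂]; ring
  -- Used twice: for the observable `ψ`, and for `Φ` inside the exponent.
  have ediff : ∀ {χ : Euc d → ℝ} {l : ℝ}, 0 ≤ l → (∀ x y, ‖χ x - χ y‖ ≤ l * ‖x - y‖) →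
      |χ (q + δ) - χ q - approxIncr ε Φ χ (q, g) h| ≤ l * c₂ * h ^ 6 := by
    intro χ l hl hχ
    have e1 : χ (q + δ) - χ q - approxIncr ε Φ χ (q, g) h =
        χ (q + δ) - χ (q + approxDisp ε Φ (q, g) h) := by
      simp only [approxIncr]; ring
    rw [e1]
    refine (hχ _ _).trans ?_
    rw [add_sub_add_left_eq_sub, mul_assoc]
    gcongr
  have eδ : ‖δ‖ ≤ (1 + M) * gaussWeight (q, g) * h := by
    rw [hd.disp]
    refine (norm_add_le _ _).trans ?_
    rw [norm_smul, norm_smul, Real.norm_eq_abs, Real.norm_eq_abs, abs_of_pos h0,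
      abs_of_pos (by positivity)]
    have g0 : ‖g‖ ≤ gaussWeight (q, g) := by simp [gaussWeight]
    calc h * ‖g‖ + 1 / 2 * h ^ 2 * ‖∇ Φ (q + m)‖
        ≤ h * gaussWeight (q, g) + 1 * (h * 1) * (M * gaussWeight (q, g)) := by
          have : ‖∇ Φ (q + m)‖ ≤ M * gaussWeight (q, g) :=
            (hM _).trans (le_mul_of_one_le_right hM0 hw)
          have h2 : h ^ 2 ≤ h * 1 := by nlinarith
          gcongr
          norm_num
      _ = (1 + M) * gaussWeight (q, g) * h := by ring
  have h65 : h ^ 6 ≤ h ^ 5 := pow_le_pow_of_le_one h0.le h1 (by norm_num)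
  constructor
  · refine (ediff hLψ0 hLψ).trans ?_
    have : Lψ * c₂ ≤ (1 + Lψ * c₂ + (L * c₁ * (1 + M) + M * c₂ + LΦ * c₂))
        * gaussWeight (q, g) := by
      have h3 : 0 ≤ L * c₁ * (1 + M) + M * c₂ + LΦ * c₂ := by positivity
      have h4 : 0 ≤ Lψ * c₂ := by positivity
      nlinarith
    gcongr
  · have e1 : dispExponent Φ q m δ - approxExponent ε Φ (q, g) h =
        ⟪∇ Φ (q + m) - ∇ Φ (q + approxPoint ε Φ (q, g) h), δ⟫
        + ⟪∇ Φ (q + approxPoint ε Φ (q, g) h), δ - approxDisp ε Φ (q, g) h⟫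
        - (Φ (q + δ) - Φ q - approxIncr ε Φ Φ (q, g) h) := by
      simp only [dispExponent, approxExponent, inner_sub_left, inner_sub_right]
      ring
    rw [e1]
    refine (abs_sub _ _).trans ((add_le_add (abs_add_le _ _) (ediff hLΦ0 hLΦ)).trans ?_)
    have i1 := (abs_real_inner_le_norm (∇ Φ (q + m) - ∇ Φ (q + approxPoint ε Φ (q, g) h)) δ).trans
      (mul_le_mul eF eδ (norm_nonneg _) (by positivity))
    have i2 := (abs_real_inner_le_norm (∇ Φ (q + approxPoint ε Φ (q, g) h))
      (δ - approxDisp ε Φ (q, g) h)).trans (mul_le_mul (hM _) ed (norm_nonneg _) hM0)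
    calc _ ≤ L * c₁ * h ^ 4 * ((1 + M) * gaussWeight (q, g) * h) + M * (c₂ * h ^ 6)
          + LΦ * c₂ * h ^ 6 := by gcongr
      _ ≤ L * c₁ * h ^ 4 * ((1 + M) * gaussWeight (q, g) * h)
          + M * (c₂ * (gaussWeight (q, g) * h ^ 5))
          + LΦ * c₂ * (gaussWeight (q, g) * h ^ 5) := by
          have : h ^ 6 ≤ gaussWeight (q, g) * h ^ 5 :=
            h65.trans (le_mul_of_one_le_left (by positivity) hw)
          gcongr
      _ = (L * c₁ * (1 + M) + M * c₂ + LΦ * c₂) * gaussWeight (q, g) * h ^ 5 := by ring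
      _ ≤ _ := by
          have : 0 ≤ Lψ * c₂ := by positivity
          refine mul_le_mul_of_nonneg_right (mul_le_mul_of_nonneg_right ?_ (by linarith))
            (by positivity)
          linarith

end UniformEstimates

/-! ### Expansion of the acceptance rates -/

section AcceptanceRate

/-- The weight of the term `-|x| / 2` in the expansion of the acceptance rate at `x = 0`. -/
def AcceptanceRule.kink : AcceptanceRule → ℝ
  | .metropolis => 1
  | .barker => 0

/-- The order in `√Δt` of the remainder in the expansion of the mean accepted increment. -/
def AcceptanceRule.remainderOrder : AcceptanceRule → ℕ
  | .metropolis => 5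
  | .barker => 6

theorem abs_exp_neg_sub_le {x : ℝ} (hx : |x| ≤ 1) : |Real.exp (-x) - 1 + x| ≤ x ^ 2 := by
  have := Real.abs_exp_sub_one_sub_id_le (x := -x) (by simpa using hx)
  simpa using this

/-- The Metropolis model is `1 - max x 0`, exact for `x ≤ 0`. Where `|x| ≤ 1` the bound comes from
the expansion of `exp`; beyond that the rate is in `[0, 1]` and the model grows linearly. A bound
for all `x` is needed because large `g` gives large exponents. -/
theorem AcceptanceRule.abs_rate_sub_le (R : AcceptanceRule) (x : ℝ) :
    |R.rate x - (2 * R.prefactor * (1 / 2 - 1 / 4 * x) - R.kink / 2 * |x|)| ≤ x ^ 2 := by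
  cases R with
  | metropolis =>
    simp only [rate, prefactor, kink]
    rcases le_total 0 x with h0 | h0
    · rw [min_eq_right (Real.exp_le_one_iff.2 (by linarith)), abs_of_nonneg h0]
      have e : Real.exp (-x) - (2 * 1 * (1 / 2 - 1 / 4 * x) - 1 / 2 * x) =
        Real.exp (-x) - 1 + x := by ring
      rw [e]
      rcases le_total x 1 with h1 | h1
      · exact abs_exp_neg_sub_le (by rwa [abs_of_nonneg h0])
      · have h2 := Real.add_one_le_exp (-x)
        have h3 : Real.exp (-x) ≤ 1 := Real.exp_le_one_iff.2 (by linarith)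
        rw [abs_of_nonneg (by linarith)]
        nlinarith
    · rw [min_eq_left (Real.one_le_exp (by linarith)), abs_of_nonpos h0]
      ring_nf
      simpa using sq_nonneg x
  | barker =>
    simp only [rate, prefactor, kink]
    set t := Real.exp (-x) with ht
    have ht0 : 0 < t := Real.exp_pos _
    rcases le_total |x| 1 with h1 | h1
    · have h2 := abs_exp_neg_sub_le h1
      rw [← ht] at h2
      have e : t / (1 + t) - (2 * (1 / 2) * (1 / 2 - 1 / 4 * x) - 0 / 2 * |x|) =
          (2 * (t - 1 + x) - x ^ 2 + x * (t - 1 + x)) / (4 * (1 + t)) := by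
        field_simp
        ring
      rw [e, abs_div, abs_of_pos (by linarith : 0 < 4 * (1 + t)), div_le_iff₀ (by linarith)]
      have h3 : |x * (t - 1 + x)| ≤ 1 * x ^ 2 := by
        rw [abs_mul]
        exact mul_le_mul h1 h2 (abs_nonneg _) zero_le_one
      have h4 := abs_le.1 h2
      have h5 := abs_le.1 h3
      have h6 : 0 ≤ x ^ 2 * t := by positivity
      rw [abs_le]
      constructor <;> nlinarith
    · have h2 : 0 < t / (1 + t) := by positivity
      have h3 : t / (1 + t) < 1 := by rw [div_lt_one (by linarith)]; linarith
      have h4 : |x| ≤ x ^ 2 := by rw [← sq_abs]; nlinarith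
      have h5 := abs_le.1 (le_refl |x|)
      rw [abs_le]
      constructor <;> linarith

theorem AcceptanceRule.prefactor_mem (R : AcceptanceRule) :
    0 ≤ R.prefactor ∧ R.prefactor ≤ 1 := by
  cases R <;> norm_num [prefactor]

theorem AcceptanceRule.kink_mem (R : AcceptanceRule) : 0 ≤ R.kink ∧ R.kink ≤ 1 := by
  cases R <;> simp [kink]

/-- Power counting: an exponent error times an increment is `h ^ 5 · h`, an exponent times an
increment error is `h ^ 3 · h ^ 6`, and the quadratic remainder of the rate times an increment is `h
^ 6 · h`. -/
theorem AcceptanceRule.abs_rate_mul_sub_le (R : AcceptanceRule) {h B D D₁ α α₁ : ℝ}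
    (h0 : 0 < h) (h1 : h ≤ 1) (hB : 1 ≤ B) (hD : |D - D₁| ≤ B * h ^ 6)
    (hα : |α - α₁| ≤ B * h ^ 5) (hD₁ : |D₁| ≤ B * h) (hα₁ : |α₁| ≤ B * h ^ 3) :
    |R.rate α * D - (2 * R.prefactor * ((1 / 2 - 1 / 4 * α₁) * D₁)
      - R.kink / 2 * (|α₁| * D₁))| ≤ 12 * B ^ 3 * h ^ 6 := by
  have hB0 : 0 ≤ B := zero_le_one.trans hB
  have hpow : ∀ {m n : ℕ}, m ≤ n → h ^ n ≤ h ^ m := fun hmn => pow_le_pow_of_le_one h0.le h1 hmn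
  have bD : |D| ≤ 2 * B * h := by
    have := abs_sub_abs_le_abs_sub D D₁
    have h6 : h ^ 6 ≤ h ^ 1 := hpow (by norm_num)
    rw [pow_one] at h6
    nlinarith
  have bα : |α| ≤ 2 * B * h ^ 3 := by
    have := abs_sub_abs_le_abs_sub α α₁
    have h6 : h ^ 5 ≤ h ^ 3 := hpow (by norm_num)
    nlinarith
  have prod : ∀ s s₁ : ℝ, |s - s₁| ≤ B * h ^ 5 → |s₁| ≤ B * h ^ 3 →
      |s * D - s₁ * D₁| ≤ 3 * B ^ 2 * h ^ 6 := by
    intro s s₁ hs hs₁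
    have e : s * D - s₁ * D₁ = (s - s₁) * D + s₁ * (D - D₁) := by ring
    rw [e]
    refine (abs_add_le _ _).trans ?_
    rw [abs_mul, abs_mul]
    calc _ ≤ B * h ^ 5 * (2 * B * h) + B * h ^ 3 * (B * h ^ 6) := by gcongr
      _ = 2 * B ^ 2 * h ^ 6 + B ^ 2 * h ^ 9 := by ring
      _ ≤ 2 * B ^ 2 * h ^ 6 + B ^ 2 * h ^ 6 := by
        have := hpow (show 6 ≤ 9 by norm_num)
        gcongr
      _ = _ := by ring
  have p1 := prod α α₁ hα hα₁
  have p2 := prod |α| |α₁| ((abs_abs_sub_abs_le _ _).trans hα) (by rwa [abs_abs])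
  have p3 : |(R.rate α - (2 * R.prefactor * (1 / 2 - 1 / 4 * α) - R.kink / 2 * |α|)) * D|
      ≤ 8 * B ^ 3 * h ^ 6 := by
    rw [abs_mul]
    calc _ ≤ α ^ 2 * |D| := by gcongr; exact R.abs_rate_sub_le α
      _ = |α| ^ 2 * |D| := by rw [sq_abs]
      _ ≤ (2 * B * h ^ 3) ^ 2 * (2 * B * h) := by gcongr
      _ = 8 * B ^ 3 * h ^ 7 := by ring
      _ ≤ _ := by
        have := hpow (show 6 ≤ 7 by norm_num)
        gcongr
  have e : R.rate α * D - (2 * R.prefactor * ((1 / 2 - 1 / 4 * α₁) * D₁)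
      - R.kink / 2 * (|α₁| * D₁)) =
      R.prefactor * (D - D₁) - R.prefactor / 2 * (α * D - α₁ * D₁)
      - R.kink / 2 * (|α| * D - |α₁| * D₁)
      + (R.rate α - (2 * R.prefactor * (1 / 2 - 1 / 4 * α) - R.kink / 2 * |α|)) * D := by ring
  rw [e]
  obtain ⟨a0, a1⟩ := R.prefactor_mem
  obtain ⟨k0, k1⟩ := R.kink_mem
  have q1 : |R.prefactor * (D - D₁)| ≤ 1 * (B * h ^ 6) := by
    rw [abs_mul, abs_of_nonneg a0]; gcongr
  have q2 : |R.prefactor / 2 * (α * D - α₁ * D₁)| ≤ 1 / 2 * (3 * B ^ 2 * h ^ 6) := by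
    rw [abs_mul, abs_of_nonneg (by linarith)]; gcongr
  have q3 : |R.kink / 2 * (|α| * D - |α₁| * D₁)| ≤ 1 / 2 * (3 * B ^ 2 * h ^ 6) := by
    rw [abs_mul, abs_of_nonneg (by linarith)]; gcongr
  have B2 : B ^ 2 ≤ B ^ 3 := pow_le_pow_right₀ hB (by norm_num)
  have B1 : B ≤ B ^ 3 := le_self_pow₀ hB (by norm_num)
  calc _ ≤ 1 * (B * h ^ 6) + 1 / 2 * (3 * B ^ 2 * h ^ 6) + 1 / 2 * (3 * B ^ 2 * h ^ 6)
        + 8 * B ^ 3 * h ^ 6 :=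
        (abs_add_le _ _).trans (add_le_add ((abs_sub _ _).trans (add_le_add
          ((abs_sub _ _).trans (add_le_add q1 q2)) q3)) p3)
    _ ≤ 1 * (B ^ 3 * h ^ 6) + 1 / 2 * (3 * B ^ 3 * h ^ 6) + 1 / 2 * (3 * B ^ 3 * h ^ 6)
        + 8 * B ^ 3 * h ^ 6 := by gcongr
    _ = _ := by ring

/-- Here primes denote the quantities for the reflected increment. Everything is of order `h ^ 6`
except the kink, which gives `h ^ 5`; this is where the two rules part. -/
theorem AcceptanceRule.abs_rate_mul_add_rate_mul_sub_le (R : AcceptanceRule)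
    {h B T D D₁ α α₁ D' D₁' α' α₁' : ℝ} (h0 : 0 < h) (h1 : h ≤ 1) (hB : 1 ≤ B)
    (hD : |D - D₁| ≤ B * h ^ 6) (hα : |α - α₁| ≤ B * h ^ 5)
    (hD₁ : |D₁| ≤ B * h) (hα₁ : |α₁| ≤ B * h ^ 3)
    (hD' : |D' - D₁'| ≤ B * h ^ 6) (hα' : |α' - α₁'| ≤ B * h ^ 5)
    (hD₁' : |D₁'| ≤ B * h) (hα₁' : |α₁'| ≤ B * h ^ 3)
    (hDD : |D₁ + D₁'| ≤ B * h ^ 2) (hαα : |α₁ + α₁'| ≤ B * h ^ 4)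
    (hT : |(1 / 2 - 1 / 4 * α₁) * D₁ + (1 / 2 - 1 / 4 * α₁') * D₁' - T| ≤ B * h ^ 6) :
    |R.rate α * D + R.rate α' * D' - 2 * R.prefactor * T|
      ≤ 27 * B ^ 3 * h ^ R.remainderOrder := by
  have hB0 : 0 ≤ B := zero_le_one.trans hB
  have r1 := R.abs_rate_mul_sub_le h0 h1 hB hD hα hD₁ hα₁
  have r2 := R.abs_rate_mul_sub_le h0 h1 hB hD' hα' hD₁' hα₁'
  obtain ⟨a0, a1⟩ := R.prefactor_mem
  obtain ⟨k0, k1⟩ := R.kink_mem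
  have r3 : |2 * R.prefactor * ((1 / 2 - 1 / 4 * α₁) * D₁ + (1 / 2 - 1 / 4 * α₁') * D₁' - T)|
      ≤ 2 * (B * h ^ 6) := by
    rw [abs_mul, abs_of_nonneg (by linarith)]
    gcongr
    linarith
  have r4 : |(|α₁| * D₁ + |α₁'| * D₁')| ≤ 2 * B ^ 2 * h ^ 5 := by
    -- The exponent and the increment are both odd to leading order, so each summand contains one
    -- factor that is an order smaller.
    have e : |α₁| * D₁ + |α₁'| * D₁' = |α₁| * (D₁ + D₁') + (|α₁'| - |α₁|) * D₁' := by ring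
    have h3 : |(|α₁'| - |α₁|)| ≤ B * h ^ 4 := by
      have := abs_abs_sub_abs_le α₁' (-α₁)
      rw [abs_neg, sub_neg_eq_add, add_comm] at this
      exact this.trans hαα
    rw [e]
    refine (abs_add_le _ _).trans ?_
    rw [abs_mul, abs_mul, abs_abs]
    calc _ ≤ B * h ^ 3 * (B * h ^ 2) + B * h ^ 4 * (B * h) := by gcongr
      _ = _ := by ring
  have r5 : |R.kink / 2 * (|α₁| * D₁ + |α₁'| * D₁')| ≤ R.kink * (B ^ 2 * h ^ 5) := by
    rw [abs_mul, abs_of_nonneg (by linarith)]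
    calc _ ≤ R.kink / 2 * (2 * B ^ 2 * h ^ 5) := by gcongr
      _ = _ := by ring
  have e : R.rate α * D + R.rate α' * D' - 2 * R.prefactor * T =
      (R.rate α * D - (2 * R.prefactor * ((1 / 2 - 1 / 4 * α₁) * D₁)
        - R.kink / 2 * (|α₁| * D₁)))
      + (R.rate α' * D' - (2 * R.prefactor * ((1 / 2 - 1 / 4 * α₁') * D₁')
        - R.kink / 2 * (|α₁'| * D₁')))
      + 2 * R.prefactor * ((1 / 2 - 1 / 4 * α₁) * D₁ + (1 / 2 - 1 / 4 * α₁') * D₁' - T)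
      - R.kink / 2 * (|α₁| * D₁ + |α₁'| * D₁') := by ring
  rw [e]
  have hk : R.kink * (B ^ 2 * h ^ 5) ≤ B ^ 3 * h ^ R.remainderOrder := by
    have B2 : B ^ 2 ≤ B ^ 3 := pow_le_pow_right₀ hB (by norm_num)
    cases R with
    | metropolis => simp only [kink, remainderOrder, one_mul]; gcongr
    | barker => simp only [kink, zero_mul]; positivity
  have h6 : h ^ 6 ≤ h ^ R.remainderOrder :=
    pow_le_pow_of_le_one h0.le h1 (by cases R <;> simp [remainderOrder])
  have B1 : B ≤ B ^ 3 := le_self_pow₀ hB (by norm_num)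
  -- `27 = 12 + 12 + 2 + 1`.
  calc _ ≤ 12 * B ^ 3 * h ^ 6 + 12 * B ^ 3 * h ^ 6 + 2 * (B * h ^ 6)
        + R.kink * (B ^ 2 * h ^ 5) :=
        (abs_sub _ _).trans (add_le_add ((abs_add_le _ _).trans (add_le_add
          ((abs_add_le _ _).trans (add_le_add r1 r2)) r3)) r5)
    _ ≤ 12 * B ^ 3 * h ^ R.remainderOrder + 12 * B ^ 3 * h ^ R.remainderOrder
        + 2 * (B ^ 3 * h ^ R.remainderOrder) + B ^ 3 * h ^ R.remainderOrder := by gcongr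
    _ = _ := by ring

end AcceptanceRate

/-! ### Expansion of the accepted increment, symmetrised over `g` and `-g` -/

section SymmetrisedExpansion

variable {d : ℕ} {ε : ℝ} {Φ ψ : Euc d → ℝ}

theorem exists_symmetrised_bound (R : AcceptanceRule) (ε : ℝ) (hΦ : SmoothBdd Φ)
    (hF : SmoothBdd (∇ Φ)) (hψ : SmoothBdd ψ) :
    ∃ (C : ℝ) (N : ℕ), 0 ≤ C ∧ ∀ (q g : Euc d) (h : ℝ) (m δ m' δ' : Euc d), 0 < h → h ≤ 1 →
      IsDisplacement ε Φ q g h m δ → IsDisplacement ε Φ q (-g) h m' δ' →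
      |R.rate (dispExponent Φ q m δ) * (ψ (q + δ) - ψ q)
        + R.rate (dispExponent Φ q m' δ') * (ψ (q + δ') - ψ q)
        - 2 * R.prefactor * (h ^ 2 * incrCoeff₂ Φ ψ (q, g)
          + h ^ 4 * (2 * acceptedCoeff ε Φ ψ (q, g)))|
        ≤ C * (1 + ‖g‖) ^ N * h ^ R.remainderOrder := by
  obtain ⟨C₁, N, hC₁, h₁⟩ := exists_approx_bounds ε hΦ hF hψ
  obtain ⟨C₂, hC₂, h₂⟩ := exists_displacement_bounds ε hΦ hF hψ
  refine ⟨27 * (C₁ + C₂) ^ 3, (N + 1) * 3, by positivity,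
    fun q g h m δ m' δ' h0 h1 hd hd' => ?_⟩
  have hw := one_le_gaussWeight (q, g)
  have hw' : gaussWeight (q, -g) = gaussWeight (q, g) := by simp [gaussWeight]
  have hh : |h| ≤ 1 := by rwa [abs_of_pos h0]
  have hneg : |-h| ≤ 1 := by rwa [abs_neg]
  -- One constant `B` dominates the approximant bounds (weight to the power `N`) and the comparison
  -- bounds (weight to the power `1`). The final estimate is cubic in it.
  have hB : 1 ≤ (C₁ + C₂) * gaussWeight (q, g) ^ (N + 1) := by
    have := one_le_pow₀ hw (n := N + 1)
    nlinarith
  have mono₁ : ∀ {x y : ℝ}, 0 ≤ y → x ≤ C₁ * gaussWeight (q, g) ^ N * y →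
      x ≤ (C₁ + C₂) * gaussWeight (q, g) ^ (N + 1) * y := fun hy hx =>
    le_mul_pow_mono hx hy hw (by linarith) (by linarith) (by omega)
  have mono₂ : ∀ {x y : ℝ}, 0 ≤ y → x ≤ C₂ * gaussWeight (q, g) * y →
      x ≤ (C₁ + C₂) * gaussWeight (q, g) ^ (N + 1) * y := fun hy hx =>
    le_mul_pow_mono (N := 1) (by simpa using hx) hy hw (by linarith) (by linarith) (by omega)
  obtain ⟨a1, a2, a3, a4, a5⟩ := h₁ (q, g) h hh
  obtain ⟨b1, b2, -, -, -⟩ := h₁ (q, g) (-h) hneg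
  obtain ⟨c1, c2⟩ := h₂ q g h m δ h0 h1 hd
  obtain ⟨e1, e2⟩ := h₂ q (-g) h m' δ' h0 h1 hd'
  rw [abs_neg] at b1 b2
  rw [abs_of_pos h0] at a1 a2 a3 a4 a5 b1 b2
  rw [hw'] at e1 e2
  have i1 : approxIncr ε Φ ψ (q, -g) h = approxIncr ε Φ ψ (q, g) (-h) :=
    approxIncr_neg (q, g) h
  have i2 : approxExponent ε Φ (q, -g) h = approxExponent ε Φ (q, g) (-h) :=
    approxExponent_neg (q, g) h
  rw [i1] at e1
  rw [i2] at e2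
  have p6 : 0 ≤ h ^ 6 := by positivity
  have p5 : 0 ≤ h ^ 5 := by positivity
  have key := R.abs_rate_mul_add_rate_mul_sub_le h0 h1 hB (mono₂ p6 c1) (mono₂ p5 c2)
    (mono₁ h0.le a1) (mono₁ (by positivity) a2) (mono₂ p6 e1) (mono₂ p5 e2) (mono₁ h0.le b1)
    (mono₁ (by positivity) b2) (mono₁ (by positivity) a3) (mono₁ (by positivity) a4)
    (mono₁ p6 a5)
  refine key.trans (le_of_eq ?_)
  rw [mul_pow, ← pow_mul]
  simp only [gaussWeight]
  ring

end SymmetrisedExpansion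

/-! ### Gaussian means of products of directional derivatives -/

section GaussianMeans

variable {d : ℕ}

/-- `f` is integrable for the standard Gaussian measure, with mean `m`. -/
structure HasGaussianMean (f : Euc d → ℝ) (m : ℝ) : Prop where
  integrable : Integrable f (stdGaussian (Euc d))
  integral_eq : ∫ g, f g ∂(stdGaussian (Euc d)) = m

namespace HasGaussianMean

variable {f f' : Euc d → ℝ} {m m' : ℝ}

theorem const (c : ℝ) : HasGaussianMean (fun _ : Euc d => c) c :=
  ⟨integrable_const c, by simp⟩

theorem add (h : HasGaussianMean f m) (h' : HasGaussianMean f' m') :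
    HasGaussianMean (fun g => f g + f' g) (m + m') :=
  ⟨h.integrable.add h'.integrable, by
    rw [integral_add h.integrable h'.integrable, h.integral_eq, h'.integral_eq]⟩

theorem const_mul (c : ℝ) (h : HasGaussianMean f m) :
    HasGaussianMean (fun g => c * f g) (c * m) :=
  ⟨h.integrable.const_mul c, by rw [integral_const_mul, h.integral_eq]⟩

theorem sum {ι : Type*} {s : Finset ι} {f : ι → Euc d → ℝ} {m : ι → ℝ}
    (h : ∀ i, HasGaussianMean (f i) (m i)) :
    HasGaussianMean (fun g => ∑ i ∈ s, f i g) (∑ i ∈ s, m i) :=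
  ⟨integrable_finsetSum _ fun i _ => (h i).integrable, by
    rw [integral_finsetSum _ fun i _ => (h i).integrable]
    exact Finset.sum_congr rfl fun i _ => (h i).integral_eq⟩

theorem congr (h : HasGaussianMean f m) (hf : ∀ g, f' g = f g) (hm : m' = m) :
    HasGaussianMean f' m' := by
  rw [funext hf, hm]
  exact h

end HasGaussianMean

variable {φ χ : Euc d → ℝ}

theorem dirDeriv_two_eq_sum (hφ : ContDiff ℝ ∞ φ) (g x : Euc d) :
    dirDeriv g (dirDeriv g φ) x = ∑ i, ∑ j,
      ⟪stdVec i, g⟫ * ⟪stdVec j, g⟫ * dirDeriv (stdVec j) (dirDeriv (stdVec i) φ) x := by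
  rw [dirDeriv_eq_sum]
  refine Finset.sum_congr rfl fun i _ => ?_
  rw [dirDeriv_comm hφ, dirDeriv_eq_sum, Finset.mul_sum]
  exact Finset.sum_congr rfl fun j _ => by ring

theorem dirDeriv_three_eq_sum (hφ : ContDiff ℝ ∞ φ) (g x : Euc d) :
    dirDeriv g (dirDeriv g (dirDeriv g φ)) x = ∑ i, ∑ j, ∑ k,
      ⟪stdVec i, g⟫ * ⟪stdVec j, g⟫ * ⟪stdVec k, g⟫ *
        dirDeriv (stdVec k) (dirDeriv (stdVec j) (dirDeriv (stdVec i) φ)) x := by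
  rw [dirDeriv_eq_sum]
  refine Finset.sum_congr rfl fun i _ => ?_
  rw [dirDeriv_comm (hφ.dirDeriv g), dirDeriv_comm hφ, dirDeriv_two_eq_sum (hφ.dirDeriv _),
    Finset.mul_sum]
  refine Finset.sum_congr rfl fun j _ => ?_
  rw [Finset.mul_sum]
  exact Finset.sum_congr rfl fun k _ => by ring

theorem dirDeriv_four_eq_sum (hφ : ContDiff ℝ ∞ φ) (g x : Euc d) :
    dirDeriv g (dirDeriv g (dirDeriv g (dirDeriv g φ))) x = ∑ i, ∑ j, ∑ k, ∑ l,
      dirDeriv (stdVec l) (dirDeriv (stdVec k) (dirDeriv (stdVec j) (dirDeriv (stdVec i) φ))) x *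
      (⟪stdVec i, g⟫ * ⟪stdVec j, g⟫ * ⟪stdVec k, g⟫ * ⟪stdVec l, g⟫) := by
  rw [dirDeriv_eq_sum]
  refine Finset.sum_congr rfl fun i _ => ?_
  rw [dirDeriv_comm ((hφ.dirDeriv g).dirDeriv g), dirDeriv_comm (hφ.dirDeriv g), dirDeriv_comm hφ,
    dirDeriv_three_eq_sum (hφ.dirDeriv _), Finset.mul_sum]
  refine Finset.sum_congr rfl fun j _ => ?_
  rw [Finset.mul_sum]
  refine Finset.sum_congr rfl fun k _ => ?_
  rw [Finset.mul_sum]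
  exact Finset.sum_congr rfl fun l _ => by ring

theorem hasGaussianMean_dirDeriv_two (hφ : ContDiff ℝ ∞ φ) (x : Euc d) :
    HasGaussianMean (fun g => dirDeriv g (dirDeriv g φ) x)
      (∑ i, dirDeriv (stdVec i) (dirDeriv (stdVec i) φ) x) :=
  HasGaussianMean.congr ⟨integrable_quadratic _, integral_quadratic
    fun i j => dirDeriv (stdVec j) (dirDeriv (stdVec i) φ) x⟩ (fun g => by
      rw [dirDeriv_two_eq_sum hφ]
      exact Finset.sum_congr rfl fun i _ => Finset.sum_congr rfl fun j _ => mul_comm _ _) rfl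

theorem hasGaussianMean_dirDeriv_mul_dirDeriv (φ χ : Euc d → ℝ) (x : Euc d) :
    HasGaussianMean (fun g => dirDeriv g φ x * dirDeriv g χ x)
      (∑ i, dirDeriv (stdVec i) φ x * dirDeriv (stdVec i) χ x) :=
  HasGaussianMean.congr ⟨integrable_quadratic _, integral_quadratic
    fun i j => dirDeriv (stdVec i) φ x * dirDeriv (stdVec j) χ x⟩ (fun g => by
      rw [dirDeriv_eq_sum g φ, dirDeriv_eq_sum g χ, Finset.sum_mul_sum]
      exact Finset.sum_congr rfl fun i _ => Finset.sum_congr rfl fun j _ => by ring) rfl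

/-- Since partial derivatives commute, the three Wick pairings contribute equally; hence the factor
`3`, here and in the next mean of four factors. -/
theorem hasGaussianMean_dirDeriv_four (hφ : ContDiff ℝ ∞ φ) (x : Euc d) :
    HasGaussianMean (fun g => dirDeriv g (dirDeriv g (dirDeriv g (dirDeriv g φ))) x)
      (3 * ∑ i, ∑ j, dirDeriv (stdVec j) (dirDeriv (stdVec j)
        (dirDeriv (stdVec i) (dirDeriv (stdVec i) φ))) x) :=
  HasGaussianMean.congr ⟨integrable_quartic _, integral_quartic
    fun i j k l => dirDeriv (stdVec l) (dirDeriv (stdVec k)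
      (dirDeriv (stdVec j) (dirDeriv (stdVec i) φ))) x⟩ (fun g => dirDeriv_four_eq_sum hφ g x) (by
    rw [Finset.mul_sum]
    refine Finset.sum_congr rfl fun i _ => ?_
    rw [Finset.mul_sum]
    refine Finset.sum_congr rfl fun j _ => ?_
    have e1 : dirDeriv (stdVec j) (dirDeriv (stdVec i) (dirDeriv (stdVec j)
        (dirDeriv (stdVec i) φ))) = dirDeriv (stdVec j) (dirDeriv (stdVec j)
        (dirDeriv (stdVec i) (dirDeriv (stdVec i) φ))) := by
      rw [dirDeriv_comm (hφ.dirDeriv (stdVec i)) (stdVec i) (stdVec j)]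
    have e2 : dirDeriv (stdVec i) (dirDeriv (stdVec j) (dirDeriv (stdVec j)
        (dirDeriv (stdVec i) φ))) = dirDeriv (stdVec j) (dirDeriv (stdVec j)
        (dirDeriv (stdVec i) (dirDeriv (stdVec i) φ))) := by
      rw [dirDeriv_comm ((hφ.dirDeriv (stdVec i)).dirDeriv (stdVec j)) (stdVec i) (stdVec j), e1]
    rw [e1, e2]
    ring)

theorem hasGaussianMean_dirDeriv_three_mul_dirDeriv (hφ : ContDiff ℝ ∞ φ) (χ : Euc d → ℝ)
    (x : Euc d) :
    HasGaussianMean (fun g => dirDeriv g (dirDeriv g (dirDeriv g φ)) x * dirDeriv g χ x)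
      (3 * ∑ i, ∑ j, dirDeriv (stdVec j) (dirDeriv (stdVec j) (dirDeriv (stdVec i) φ)) x
        * dirDeriv (stdVec i) χ x) :=
  HasGaussianMean.congr ⟨integrable_quartic _, integral_quartic
    fun i j k l => dirDeriv (stdVec k) (dirDeriv (stdVec j) (dirDeriv (stdVec i) φ)) x
      * dirDeriv (stdVec l) χ x⟩ (fun g => by
    rw [dirDeriv_three_eq_sum hφ, dirDeriv_eq_sum g χ]
    simp only [Finset.sum_mul]
    refine Finset.sum_congr rfl fun i _ => Finset.sum_congr rfl fun j _ =>
      Finset.sum_congr rfl fun k _ => ?_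
    rw [Finset.mul_sum]
    exact Finset.sum_congr rfl fun l _ => by ring) (by
    simp only [Finset.sum_add_distrib]
    have e1 : ∀ i j : Fin d, dirDeriv (stdVec i) (dirDeriv (stdVec j) (dirDeriv (stdVec i) φ)) =
        dirDeriv (stdVec i) (dirDeriv (stdVec i) (dirDeriv (stdVec j) φ)) := fun i j => by
      rw [dirDeriv_comm hφ (stdVec j) (stdVec i)]
    have e2 : ∀ i j : Fin d, dirDeriv (stdVec j) (dirDeriv (stdVec i) (dirDeriv (stdVec i) φ)) =
        dirDeriv (stdVec i) (dirDeriv (stdVec i) (dirDeriv (stdVec j) φ)) := fun i j => by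
      rw [dirDeriv_comm (hφ.dirDeriv (stdVec i)) (stdVec j) (stdVec i), e1]
    simp only [e1, e2]
    rw [Finset.sum_comm]
    ring)

end GaussianMeans

/-! ### The generator, its square, and the means of the coefficients -/

section Generator

variable {d : ℕ}

/-- The generator `∇Φ · ∇φ + Δφ` in coordinates. -/
def coordGenerator (Φ φ : Euc d → ℝ) (x : Euc d) : ℝ :=
  ∑ i, dirDeriv (stdVec i) Φ x * dirDeriv (stdVec i) φ x
    + ∑ i, dirDeriv (stdVec i) (dirDeriv (stdVec i) φ) x

variable {Φ φ ψ : Euc d → ℝ}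

theorem contDiff_coordGenerator (hΦ : ContDiff ℝ ∞ Φ) (hφ : ContDiff ℝ ∞ φ) :
    ContDiff ℝ ∞ (coordGenerator Φ φ) :=
  (ContDiff.sum fun _ _ => (hΦ.dirDeriv _).mul (hφ.dirDeriv _)).add
    (ContDiff.sum fun _ _ => (hφ.dirDeriv _).dirDeriv _)

theorem inner_stdVec_gradient (x : Euc d) (i : Fin d) :
    ⟪stdVec i, ∇ Φ x⟫ = dirDeriv (stdVec i) Φ x := by
  rw [real_inner_comm, inner_gradient_eq_dirDeriv]

theorem dirDeriv_gradient_eq_sum (x : Euc d) :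
    dirDeriv (∇ Φ x) φ x = ∑ i, dirDeriv (stdVec i) Φ x * dirDeriv (stdVec i) φ x := by
  rw [dirDeriv_eq_sum]
  simp only [inner_stdVec_gradient]

theorem laplacian_eq_sum_dirDeriv (hφ : ContDiff ℝ ∞ φ) (x : Euc d) :
    Δ φ x = ∑ i, dirDeriv (stdVec i) (dirDeriv (stdVec i) φ) x := by
  rw [InnerProductSpace.laplacian_eq_iteratedFDeriv_orthonormalBasis φ
    (EuclideanSpace.basisFun (Fin d) ℝ)]
  refine Finset.sum_congr rfl fun i _ => ?_
  rw [iteratedFDeriv_two_apply]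
  have hd : DifferentiableAt ℝ (fderiv ℝ φ) x :=
    (hφ.fderiv_right (m := ∞) (by simp)).differentiable (by simp) x
  have : dirDeriv (stdVec i) φ = fun y => (fderiv ℝ φ y) (stdVec i) := rfl
  rw [this]
  simp only [dirDeriv]
  rw [fderiv_clm_apply hd (differentiableAt_const _)]
  simp [stdVec]

theorem langevinGenerator_eq_coordGenerator {β : ℝ} {V : Euc d → ℝ} (hV : ContDiff ℝ ∞ V)
    (hφ : ContDiff ℝ ∞ φ) :
    langevinGenerator β V φ = coordGenerator (fun x => -β * V x) φ := by
  funext x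
  rw [langevinGenerator, coordGenerator, laplacian_eq_sum_dirDeriv hφ]
  congr 1
  rw [inner_gradient_eq_dirDeriv, dirDeriv_eq_sum, Finset.mul_sum]
  refine Finset.sum_congr rfl fun i _ => ?_
  rw [inner_stdVec_gradient, dirDeriv_const_mul hV]
  ring

theorem dirDeriv_coordGenerator (hΦ : ContDiff ℝ ∞ Φ) (hφ : ContDiff ℝ ∞ φ) (v x : Euc d) :
    dirDeriv v (coordGenerator Φ φ) x =
      ∑ i, (dirDeriv (stdVec i) Φ x * dirDeriv v (dirDeriv (stdVec i) φ) x
        + dirDeriv v (dirDeriv (stdVec i) Φ) x * dirDeriv (stdVec i) φ x)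
      + ∑ i, dirDeriv v (dirDeriv (stdVec i) (dirDeriv (stdVec i) φ)) x := by
  have e : coordGenerator Φ φ = fun x =>
      (fun x => ∑ i, dirDeriv (stdVec i) Φ x * dirDeriv (stdVec i) φ x) x
      + (fun x => ∑ i, dirDeriv (stdVec i) (dirDeriv (stdVec i) φ) x) x := rfl
  rw [e, dirDeriv_add (ContDiff.sum fun _ _ => (hΦ.dirDeriv _).mul (hφ.dirDeriv _))
    (ContDiff.sum fun _ _ => (hφ.dirDeriv _).dirDeriv _),
    dirDeriv_sum _ fun i => (hΦ.dirDeriv _).mul (hφ.dirDeriv _),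
    dirDeriv_sum _ fun i => (hφ.dirDeriv _).dirDeriv _]
  congr 1
  exact Finset.sum_congr rfl fun i _ => dirDeriv_mul (hΦ.dirDeriv _) (hφ.dirDeriv _) _ _

theorem dirDeriv_dirDeriv_coordGenerator (hΦ : ContDiff ℝ ∞ Φ) (hφ : ContDiff ℝ ∞ φ)
    (v x : Euc d) :
    dirDeriv v (dirDeriv v (coordGenerator Φ φ)) x =
      ∑ i, (dirDeriv (stdVec i) Φ x * dirDeriv v (dirDeriv v (dirDeriv (stdVec i) φ)) x
        + 2 * (dirDeriv v (dirDeriv (stdVec i) Φ) x * dirDeriv v (dirDeriv (stdVec i) φ) x)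
        + dirDeriv v (dirDeriv v (dirDeriv (stdVec i) Φ)) x * dirDeriv (stdVec i) φ x)
      + ∑ i, dirDeriv v (dirDeriv v (dirDeriv (stdVec i) (dirDeriv (stdVec i) φ))) x := by
  have s1 : ∀ i, ContDiff ℝ ∞ fun x =>
      dirDeriv (stdVec i) Φ x * dirDeriv v (dirDeriv (stdVec i) φ) x := fun i =>
    (hΦ.dirDeriv _).mul ((hφ.dirDeriv _).dirDeriv _)
  have s2 : ∀ i, ContDiff ℝ ∞ fun x =>
      dirDeriv v (dirDeriv (stdVec i) Φ) x * dirDeriv (stdVec i) φ x := fun i =>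
    ((hΦ.dirDeriv _).dirDeriv _).mul (hφ.dirDeriv _)
  have s3 : ∀ i, ContDiff ℝ ∞ fun x =>
      dirDeriv v (dirDeriv (stdVec i) (dirDeriv (stdVec i) φ)) x := fun i =>
    ((hφ.dirDeriv _).dirDeriv _).dirDeriv _
  rw [funext (dirDeriv_coordGenerator hΦ hφ v),
    dirDeriv_add (ContDiff.sum fun i _ => (s1 i).add (s2 i)) (ContDiff.sum fun i _ => s3 i),
    dirDeriv_sum _ fun i => (s1 i).add (s2 i), dirDeriv_sum _ s3]
  congr 1
  refine Finset.sum_congr rfl fun i _ => ?_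
  rw [dirDeriv_add (s1 i) (s2 i), dirDeriv_mul (hΦ.dirDeriv _) ((hφ.dirDeriv _).dirDeriv _),
    dirDeriv_mul ((hΦ.dirDeriv _).dirDeriv _) (hφ.dirDeriv _)]
  ring

theorem hasGaussianMean_incrCoeff₂ (hψ : ContDiff ℝ ∞ ψ) (q : Euc d) :
    HasGaussianMean (fun g => incrCoeff₂ Φ ψ (q, g)) (1 / 2 * coordGenerator Φ ψ q) :=
  (((HasGaussianMean.const (dirDeriv (∇ Φ q) ψ q)).const_mul (1 / 2)).add
    ((hasGaussianMean_dirDeriv_two hψ q).const_mul (1 / 2))).congr (fun _ => rfl) (by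
      rw [coordGenerator, dirDeriv_gradient_eq_sum]
      ring)

/-- The term `∇²Φ ∇Φ · ∇ψ` receives `ε / 16` from the increment and `(1 - ε) / 16` from the
exponent, so the mean does not depend on `ε`. Without the exponent, this term and the one with third
derivatives of `Φ` would fall short of those in `𝓛²ψ`. -/
theorem hasGaussianMean_acceptedCoeff (ε : ℝ) (hΦ : ContDiff ℝ ∞ Φ) (hψ : ContDiff ℝ ∞ ψ)
    (q : Euc d) :
    HasGaussianMean (fun g => acceptedCoeff ε Φ ψ (q, g))
      (1 / 16 * coordGenerator Φ (coordGenerator Φ ψ) q) := by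
  set F := ∇ Φ q with hF
  have t1 : HasGaussianMean (fun g => dirDeriv (gradientDeriv₂ Φ g q) ψ q)
      (∑ i, ∑ j, dirDeriv (stdVec j) (dirDeriv (stdVec j) (dirDeriv (stdVec i) Φ)) q
        * dirDeriv (stdVec i) ψ q) := by
    refine (HasGaussianMean.sum (s := Finset.univ) fun i =>
      (hasGaussianMean_dirDeriv_two (hΦ.dirDeriv (stdVec i)) q).const_mul
        (dirDeriv (stdVec i) ψ q)).congr (fun g => ?_) ?_
    · simp only [gradientDeriv₂, dirDeriv_sum_left, dirDeriv_smul_left]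
      exact Finset.sum_congr rfl fun i _ => mul_comm _ _
    · refine Finset.sum_congr rfl fun i _ => ?_
      rw [Finset.mul_sum]
      exact Finset.sum_congr rfl fun j _ => mul_comm _ _
  have t2 : dirDeriv (gradientDeriv Φ F q) ψ q =
      ∑ i, dirDeriv F (dirDeriv (stdVec i) Φ) q * dirDeriv (stdVec i) ψ q := by
    simp only [gradientDeriv, dirDeriv_sum_left, dirDeriv_smul_left]
  have t3 : HasGaussianMean (fun g => dirDeriv (gradientDeriv Φ g q) (dirDeriv g ψ) q)
      (∑ i, ∑ j, dirDeriv (stdVec j) (dirDeriv (stdVec i) Φ) q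
        * dirDeriv (stdVec j) (dirDeriv (stdVec i) ψ) q) := by
    refine (HasGaussianMean.sum (s := Finset.univ) fun i =>
      hasGaussianMean_dirDeriv_mul_dirDeriv (dirDeriv (stdVec i) Φ) (dirDeriv (stdVec i) ψ)
        q).congr (fun g => ?_) rfl
    simp only [gradientDeriv, dirDeriv_sum_left, dirDeriv_smul_left]
    exact Finset.sum_congr rfl fun i _ => by rw [dirDeriv_comm hψ]
  have t4 : HasGaussianMean (fun g => dirDeriv F (dirDeriv g (dirDeriv g ψ)) q)
      (∑ i, dirDeriv (stdVec i) (dirDeriv (stdVec i) (dirDeriv F ψ)) q) :=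
    (hasGaussianMean_dirDeriv_two (hψ.dirDeriv F) q).congr (fun g => by
      rw [dirDeriv_comm (hψ.dirDeriv g), dirDeriv_comm hψ]) rfl
  have t5 := hasGaussianMean_dirDeriv_four hψ q
  have t6 : HasGaussianMean (fun g => dirDeriv F (dirDeriv g Φ) q * dirDeriv g ψ q)
      (∑ i, dirDeriv F (dirDeriv (stdVec i) Φ) q * dirDeriv (stdVec i) ψ q) :=
    (hasGaussianMean_dirDeriv_mul_dirDeriv (dirDeriv F Φ) ψ q).congr (fun g => by
      rw [dirDeriv_comm hΦ]) (Finset.sum_congr rfl fun i _ => by rw [dirDeriv_comm hΦ])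
  have t7 := hasGaussianMean_dirDeriv_three_mul_dirDeriv hΦ ψ q
  have u1 : coordGenerator Φ (coordGenerator Φ ψ) q =
      dirDeriv F (coordGenerator Φ ψ) q
        + ∑ j, dirDeriv (stdVec j) (dirDeriv (stdVec j) (coordGenerator Φ ψ)) q := by
    rw [coordGenerator, dirDeriv_gradient_eq_sum]
  have u2 : dirDeriv F (dirDeriv F ψ) q =
      ∑ i, dirDeriv (stdVec i) Φ q * dirDeriv F (dirDeriv (stdVec i) ψ) q := by
    rw [dirDeriv_dirDeriv_eq_sum hψ]
    simp only [hF, inner_stdVec_gradient]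
  have u3 : ∑ i, dirDeriv F (dirDeriv (stdVec i) (dirDeriv (stdVec i) ψ)) q =
      ∑ i, dirDeriv (stdVec i) (dirDeriv (stdVec i) (dirDeriv F ψ)) q :=
    Finset.sum_congr rfl fun i _ => by
      rw [dirDeriv_comm (hψ.dirDeriv (stdVec i)), dirDeriv_comm hψ]
  have u4 : ∀ j : Fin d, dirDeriv (stdVec j) (dirDeriv (stdVec j) (dirDeriv F ψ)) q =
      ∑ i, dirDeriv (stdVec i) Φ q *
        dirDeriv (stdVec j) (dirDeriv (stdVec j) (dirDeriv (stdVec i) ψ)) q := fun j => by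
    rw [funext (dirDeriv_dirDeriv_eq_sum hψ (stdVec j) F),
      dirDeriv_sum _ fun i => contDiff_const.mul ((hψ.dirDeriv _).dirDeriv _)]
    refine Finset.sum_congr rfl fun i _ => ?_
    rw [dirDeriv_const_mul ((hψ.dirDeriv _).dirDeriv _), hF, inner_stdVec_gradient]
  have u5 : ∑ j, dirDeriv (stdVec j) (dirDeriv (stdVec j) (coordGenerator Φ ψ)) q =
      ∑ j, dirDeriv (stdVec j) (dirDeriv (stdVec j) (dirDeriv F ψ)) q
      + 2 * ∑ i, ∑ j, dirDeriv (stdVec j) (dirDeriv (stdVec i) Φ) q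
        * dirDeriv (stdVec j) (dirDeriv (stdVec i) ψ) q
      + ∑ i, ∑ j, dirDeriv (stdVec j) (dirDeriv (stdVec j) (dirDeriv (stdVec i) Φ)) q
        * dirDeriv (stdVec i) ψ q
      + ∑ i, ∑ j, dirDeriv (stdVec j) (dirDeriv (stdVec j)
        (dirDeriv (stdVec i) (dirDeriv (stdVec i) ψ))) q := by
    simp only [dirDeriv_dirDeriv_coordGenerator hΦ hψ, Finset.sum_add_distrib, u4,
      ← Finset.mul_sum]
    congr 1
    · congr 1
      · congr 2
        exact Finset.sum_comm
      · exact Finset.sum_comm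
    · exact Finset.sum_comm
  refine (((((((t1.const_mul (1 / 8)).add (HasGaussianMean.const
    (ε / 4 * dirDeriv (gradientDeriv Φ F q) ψ q))).const_mul (1 / 2)).add
    (t3.const_mul (1 / 4))).add ((HasGaussianMean.const (dirDeriv F (dirDeriv F ψ) q)).const_mul (1 / 8))).add
    (t4.const_mul (1 / 4))).add (t5.const_mul (1 / 24))).const_mul (1 / 2) |>.add
    (((t6.const_mul ((1 - ε) / 4)).add (t7.const_mul (1 / 24))).const_mul (1 / 4)) |>.congr
    (fun g => ?_) ?_
  · simp only [acceptedCoeff, incrCoeff₄, exponentCoeff, driftCoeff, dirDeriv_add_left,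
      dirDeriv_smul_left, ← hF]
    ring
  · rw [u1, u5, dirDeriv_coordGenerator hΦ hψ, t2, u2, u3]
    simp only [Finset.sum_add_distrib]
    ring

end Generator

/-! ### The two proposals in their common form -/

section ProposedMoves

variable {d : ℕ}

/-- The parameter that distinguishes the two proposals in the common form of the displacement. -/
def Proposal.implicitness : Proposal → ℝ
  | .midpoint => 1
  | .hmc => 0

/-- The point, relative to `q`, at which the drift is evaluated. -/
def Proposal.driftPoint (S : Proposal) (h : ℝ) (g δ : Euc d) : Euc d :=
  match S with
  | .midpoint => (1 / 2 : ℝ) • δ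
  | .hmc => (1 / 2 * h) • g

/-- The potential `-β V`. -/
def scaledPotential (β : ℝ) (V : Euc d → ℝ) : Euc d → ℝ := fun x => -β * V x

variable {β : ℝ} {V : Euc d → ℝ}

theorem contDiff_scaledPotential (hV : ContDiff ℝ ∞ V) : ContDiff ℝ ∞ (scaledPotential β V) :=
  contDiff_const.mul hV

theorem gradient_scaledPotential (hV : ContDiff ℝ ∞ V) (x : Euc d) :
    ∇ (scaledPotential β V) x = -(β • ∇ V x) := by
  rw [gradient_eq_sum_dirDeriv, gradient_eq_sum_dirDeriv, Finset.smul_sum, ← Finset.sum_neg_distrib]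
  refine Finset.sum_congr rfl fun i _ => ?_
  have e : scaledPotential β V = fun x => -β * V x := rfl
  rw [e, dirDeriv_const_mul hV]
  module

/-- With `h ^ 2 = 2 dt` the drift is `(h ^ 2 / 2) ∇Φ`. The midpoint proposal takes `m = δ / 2`,
whose equation is half that of `δ`; HMC takes `m = (h / 2) g`. -/
theorem isDisplacement_of_isProposedMove (hV : ContDiff ℝ ∞ V) {S : Proposal} {dt : ℝ}
    (hdt : 0 < dt) {q g Q : Euc d} (h : IsProposedMove β V dt q g S Q) :
    IsDisplacement S.implicitness (scaledPotential β V) q g (√(2 * dt))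
      (S.driftPoint (√(2 * dt)) g (Q - q)) (Q - q) := by
  have hs : √(2 * dt) ^ 2 = 2 * dt := Real.sq_sqrt (by linarith)
  cases S with
  | midpoint =>
    simp only [IsProposedMove] at h
    have hp : q + (1 / 2 : ℝ) • (Q - q) = (1 / 2 : ℝ) • (Q + q) := by module
    have hd : Q - q = √(2 * dt) • g
        + (1 / 2 * √(2 * dt) ^ 2) • ∇ (scaledPotential β V) (q + (1 / 2 : ℝ) • (Q - q)) := by
      rw [hp, gradient_scaledPotential hV, hs]
      nth_rw 1 [h]
      module
    refine ⟨?_, hd⟩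
    simp only [Proposal.driftPoint, Proposal.implicitness]
    nth_rw 1 [hd]
    module
  | hmc =>
    simp only [IsProposedMove] at h
    refine ⟨by simp [Proposal.driftPoint, Proposal.implicitness], ?_⟩
    simp only [Proposal.driftPoint]
    rw [gradient_scaledPotential hV, hs, h, show √(2 * dt) / 2 = 1 / 2 * √(2 * dt) by ring]
    module

/-- The HMC equation is explicit. The midpoint equation is a fixed point problem with Lipschitz
constant `dt L / 2 ≤ 1 / 2`, the halving coming from the average `(Q + q) / 2`. -/
theorem existsUnique_isProposedMove {dt L : ℝ} (hdt : 0 < dt)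
    (hL : ∀ x y, ‖β • ∇ V x - β • ∇ V y‖ ≤ L * ‖x - y‖) (hdL : dt * L ≤ 1)
    (S : Proposal) (q g : Euc d) : ∃! Q, IsProposedMove β V dt q g S Q := by
  cases S with
  | hmc => exact ⟨_, rfl, fun _ h => h⟩
  | midpoint =>
    set T : Euc d → Euc d := fun Q =>
      q - (β * dt) • ∇ V ((1 / 2 : ℝ) • (Q + q)) + √(2 * dt) • g with hT
    have hc : ContractingWith (1 / 2) T := by
      refine ⟨by norm_num [← NNReal.coe_lt_coe], LipschitzWith.of_dist_le_mul fun x y => ?_⟩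
      rw [dist_eq_norm, dist_eq_norm]
      have e : T x - T y = -(dt • (β • ∇ V ((1 / 2 : ℝ) • (x + q))
          - β • ∇ V ((1 / 2 : ℝ) • (y + q)))) := by
        simp only [hT]
        module
      have e2 : (1 / 2 : ℝ) • (x + q) - (1 / 2 : ℝ) • (y + q) = (1 / 2 : ℝ) • (x - y) := by module
      have h3 := hL ((1 / 2 : ℝ) • (x + q)) ((1 / 2 : ℝ) • (y + q))
      rw [e2, norm_smul, Real.norm_of_nonneg (by norm_num : (0 : ℝ) ≤ 1 / 2)] at h3
      rw [e, norm_neg, norm_smul, Real.norm_of_nonneg hdt.le]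
      calc _ ≤ dt * (L * (1 / 2 * ‖x - y‖)) := by gcongr
        _ = (dt * L) * (1 / 2 * ‖x - y‖) := by ring
        _ ≤ 1 * (1 / 2 * ‖x - y‖) := by gcongr
        _ = _ := by simp
    refine ⟨ContractingWith.fixedPoint T hc, (hc.fixedPoint_isFixedPt).symm, fun Q hQ => ?_⟩
    exact hc.fixedPoint_unique hQ.symm

theorem isProposedMove_proposalMap {dt : ℝ} {S : Proposal} {q g : Euc d}
    (h : ∃! Q, IsProposedMove β V dt q g S Q) :
    IsProposedMove β V dt q g S (proposalMap S β V dt q g) := by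
  rw [proposalMap, dif_pos h.exists]
  exact h.exists.choose_spec

/-- For the midpoint rule, `‖-δ + b‖² - ‖δ + b‖² = -4 ⟪δ, b⟫` with `b = β dt ∇V`. For HMC, expanding
the square reproduces the pairing of the drift with `h g + (h ^ 2 / 2) ∇Φ`. -/
theorem alphaExponent_eq_dispExponent (hV : ContDiff ℝ ∞ V) {S : Proposal} {dt : ℝ}
    (hdt : 0 < dt) {q g : Euc d} (h : ∃! Q, IsProposedMove β V dt q g S Q) :
    alphaExponent S β V dt q g = dispExponent (scaledPotential β V) q
      (S.driftPoint (√(2 * dt)) g (proposalMap S β V dt q g - q))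
      (proposalMap S β V dt q g - q) := by
  have hs : √(2 * dt) ^ 2 = 2 * dt := Real.sq_sqrt (by linarith)
  have hQ := isProposedMove_proposalMap h
  have hd := isDisplacement_of_isProposedMove hV hdt hQ
  cases S with
  | midpoint =>
    simp only [alphaExponent, alphaMidpoint, dispExponent, Proposal.driftPoint]
    set Q := proposalMap .midpoint β V dt q g
    have hp : q + (1 / 2 : ℝ) • (Q - q) = (1 / 2 : ℝ) • (q + Q) := by module
    rw [hp, gradient_scaledPotential hV, add_sub_cancel]
    set G := ∇ V ((1 / 2 : ℝ) • (q + Q))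
    have e : q - Q = -(Q - q) := by abel
    rw [e, norm_add_sq_real, norm_add_sq_real, norm_neg]
    simp only [inner_neg_left, real_inner_smul_right, real_inner_smul_left, scaledPotential]
    rw [real_inner_comm (Q - q) G]
    field_simp
    ring
  | hmc =>
    have hdisp := hd.disp
    simp only [alphaExponent, dispExponent, Proposal.driftPoint] at hdisp ⊢
    rw [add_sub_cancel, hdisp, gradient_scaledPotential hV,
      show √(2 * dt) / 2 = 1 / 2 * √(2 * dt) by ring]
    set G := ∇ V (q + (1 / 2 * √(2 * dt)) • g)
    rw [norm_sub_sq_real]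
    simp only [inner_neg_left, inner_neg_right, real_inner_smul_right, real_inner_smul_left,
      scaledPotential, inner_add_right, norm_smul, mul_pow, ← real_inner_self_eq_norm_sq,
      Real.norm_eq_abs, sq_abs]
    rw [real_inner_comm g G]
    ring

theorem AcceptanceRule.rate_mem (R : AcceptanceRule) (x : ℝ) : 0 ≤ R.rate x ∧ R.rate x ≤ 1 := by
  have := Real.exp_pos (-x)
  cases R with
  | metropolis => exact ⟨le_min zero_le_one this.le, min_le_left _ _⟩
  | barker =>
    refine ⟨by simp only [rate]; positivity, ?_⟩
    simp only [rate]
    rw [div_le_one (by linarith)]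
    linarith

theorem AcceptanceRule.continuous_rate (R : AcceptanceRule) : Continuous R.rate := by
  cases R with
  | metropolis => exact continuous_const.min (by fun_prop)
  | barker =>
    refine Continuous.div (by fun_prop) (by fun_prop) fun x => ?_
    have := Real.exp_pos (-x)
    linarith

end ProposedMoves

/-! ### Measurability, integration of the noise, and the estimate for the evolution operator -/

section Evolution

variable {d : ℕ} {β dt L : ℝ} {V ψ : Euc d → ℝ}

/-- The time steps for which the drift step is nonexpansive. -/
structure IsSmallStep (β : ℝ) (V : Euc d → ℝ) (dt L : ℝ) : Prop where
  pos : 0 < dt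
  le_half : dt ≤ 1 / 2
  lipschitz : ∀ x y, ‖β • ∇ V x - β • ∇ V y‖ ≤ L * ‖x - y‖
  mul_le : dt * L ≤ 1

theorem IsSmallStep.existsUnique (hs : IsSmallStep β V dt L) (S : Proposal) (q g : Euc d) :
    ∃! Q, IsProposedMove β V dt q g S Q :=
  existsUnique_isProposedMove hs.pos hs.lipschitz hs.mul_le S q g

theorem IsSmallStep.proposalMap_spec (hs : IsSmallStep β V dt L) (S : Proposal) (q g : Euc d) :
    IsProposedMove β V dt q g S (proposalMap S β V dt q g) :=
  isProposedMove_proposalMap (hs.existsUnique S q g)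

theorem IsSmallStep.sqrt_le_one (hs : IsSmallStep β V dt L) : √(2 * dt) ≤ 1 := by
  exact Real.sqrt_le_iff.2 ⟨zero_le_one, by linarith [hs.le_half]⟩

theorem IsSmallStep.sqrt_pos (hs : IsSmallStep β V dt L) : 0 < √(2 * dt) :=
  Real.sqrt_pos.2 (by linarith [hs.pos])

theorem IsSmallStep.continuous_proposalMap (hs : IsSmallStep β V dt L) (hV : ContDiff ℝ ∞ V)
    (S : Proposal) :
    Continuous (fun p : Euc d × Euc d => proposalMap S β V dt p.1 p.2) := by
  have hgrad : Continuous (∇ V) := (contDiff_gradient hV).continuous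
  cases S with
  | hmc =>
    have e : (fun p : Euc d × Euc d => proposalMap .hmc β V dt p.1 p.2) =
        fun p => p.1 - (β * dt) • ∇ V (p.1 + (√(2 * dt) / 2) • p.2) + √(2 * dt) • p.2 :=
      funext fun p => hs.proposalMap_spec .hmc p.1 p.2
    rw [e]
    fun_prop
  | midpoint =>
    -- The implicit equation gives `x ≤ n + n + (x + n) / 2`, with `x` the distance of the images
    -- and `n` that of the arguments; hence `x ≤ 5 n`.
    refine LipschitzWith.continuous (K := 5) (LipschitzWith.of_dist_le_mul fun p p' => ?_)
    rw [dist_eq_norm, dist_eq_norm]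
    have e1 := hs.proposalMap_spec .midpoint p.1 p.2
    have e2 := hs.proposalMap_spec .midpoint p'.1 p'.2
    simp only [IsProposedMove] at e1 e2
    set Q := proposalMap .midpoint β V dt p.1 p.2
    set Q' := proposalMap .midpoint β V dt p'.1 p'.2
    have e3 : Q - Q' = (p.1 - p'.1) + √(2 * dt) • (p.2 - p'.2)
        - dt • (β • ∇ V ((1 / 2 : ℝ) • (Q + p.1)) - β • ∇ V ((1 / 2 : ℝ) • (Q' + p'.1))) := by
      conv_lhs => rw [e1, e2]
      module
    have h1 : ‖p.1 - p'.1‖ ≤ ‖p - p'‖ := norm_fst_le (p - p')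
    have h2 : ‖p.2 - p'.2‖ ≤ ‖p - p'‖ := norm_snd_le (p - p')
    have h3 := hs.lipschitz ((1 / 2 : ℝ) • (Q + p.1)) ((1 / 2 : ℝ) • (Q' + p'.1))
    have e4 : (1 / 2 : ℝ) • (Q + p.1) - (1 / 2 : ℝ) • (Q' + p'.1) =
        (1 / 2 : ℝ) • ((Q - Q') + (p.1 - p'.1)) := by module
    rw [e4, norm_smul, Real.norm_of_nonneg (by norm_num : (0 : ℝ) ≤ 1 / 2)] at h3
    have h4 : ‖dt • (β • ∇ V ((1 / 2 : ℝ) • (Q + p.1)) - β • ∇ V ((1 / 2 : ℝ) • (Q' + p'.1)))‖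
        ≤ 1 / 2 * (‖Q - Q'‖ + ‖p.1 - p'.1‖) := by
      rw [norm_smul, Real.norm_of_nonneg hs.pos.le]
      calc _ ≤ dt * (L * (1 / 2 * ‖Q - Q' + (p.1 - p'.1)‖)) := by
            have := hs.pos.le
            gcongr
        _ = (dt * L) * (1 / 2 * ‖Q - Q' + (p.1 - p'.1)‖) := by ring
        _ ≤ 1 * (1 / 2 * (‖Q - Q'‖ + ‖p.1 - p'.1‖)) := by
            gcongr
            · exact hs.mul_le
            · exact norm_add_le _ _
        _ = _ := by ring
    have h5 : ‖√(2 * dt) • (p.2 - p'.2)‖ ≤ ‖p - p'‖ := by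
      rw [norm_smul, Real.norm_of_nonneg (Real.sqrt_nonneg _)]
      calc _ ≤ 1 * ‖p - p'‖ := by
            have := hs.sqrt_le_one
            gcongr
        _ = _ := one_mul _
    have h6 : ‖Q - Q'‖ ≤ ‖p.1 - p'.1‖ + ‖√(2 * dt) • (p.2 - p'.2)‖
        + 1 / 2 * (‖Q - Q'‖ + ‖p.1 - p'.1‖) := by
      calc ‖Q - Q'‖ = _ := congrArg norm e3
        _ ≤ _ := (norm_sub_le _ _).trans (add_le_add (norm_add_le _ _) h4)
    have : ((5 : NNReal) : ℝ) = 5 := rfl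
    rw [this]
    linarith

theorem IsSmallStep.continuous_acceptanceRate (hs : IsSmallStep β V dt L) (hV : ContDiff ℝ ∞ V)
    (S : Proposal) (R : AcceptanceRule) :
    Continuous (fun p : Euc d × Euc d => acceptanceRate S R β V dt p.1 p.2) := by
  refine R.continuous_rate.comp ?_
  have e : (fun p : Euc d × Euc d => alphaExponent S β V dt p.1 p.2) = fun p : Euc d × Euc d =>
      dispExponent (scaledPotential β V) p.1
        (S.driftPoint (√(2 * dt)) p.2 (proposalMap S β V dt p.1 p.2 - p.1))
        (proposalMap S β V dt p.1 p.2 - p.1) :=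
    funext fun p => alphaExponent_eq_dispExponent hV hs.pos (hs.existsUnique S p.1 p.2)
  have hΦ := contDiff_scaledPotential (β := β) hV
  have hc := hs.continuous_proposalMap hV S
  have hΦc := hΦ.continuous
  have hFc := (contDiff_gradient hΦ).continuous
  rw [e]
  cases S <;> simp only [dispExponent, Proposal.driftPoint] <;> fun_prop

theorem IsSmallStep.measurable_chainStep (hs : IsSmallStep β V dt L) (hV : ContDiff ℝ ∞ V)
    (S : Proposal) (R : AcceptanceRule) :
    Measurable (fun z : Euc d × (Euc d × ℝ) => chainStep S R β V dt z.1 z.2.1 z.2.2) := by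
  have hp : Measurable (fun z : Euc d × (Euc d × ℝ) => (z.1, z.2.1)) := by fun_prop
  have h1 := (hs.continuous_proposalMap hV S).measurable.comp hp
  have h2 := (hs.continuous_acceptanceRate hV S R).measurable.comp hp
  have h3 : Measurable fun z : Euc d × (Euc d × ℝ) => z.2.2 := by fun_prop
  have h4 : Measurable fun z : Euc d × (Euc d × ℝ) =>
      if z.2.2 ≤ acceptanceRate S R β V dt z.1 z.2.1 then (1 : ℝ) else 0 :=
    Measurable.ite (measurableSet_le h3 h2) measurable_const measurable_const
  have h5 : Measurable fun z : Euc d × (Euc d × ℝ) => proposalMap S β V dt z.1 z.2.1 - z.1 :=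
    h1.sub measurable_fst
  exact measurable_fst.add (h4.smul h5)

instance isProbabilityMeasure_noiseLaw : IsProbabilityMeasure (noiseLaw d) := by
  have : IsProbabilityMeasure (volume.restrict (Set.Icc (0 : ℝ) 1)) := ⟨by simp⟩
  unfold noiseLaw
  infer_instance

theorem IsSmallStep.integrable_chainStep (hs : IsSmallStep β V dt L) (hV : ContDiff ℝ ∞ V)
    (S : Proposal) (R : AcceptanceRule) (hψ : SmoothBdd ψ) (q : Euc d) :
    Integrable (fun z : Euc d × ℝ => ψ (chainStep S R β V dt q z.1 z.2)) (noiseLaw d) := by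
  obtain ⟨C, -, hC⟩ := hψ.exists_norm_le
  refine Integrable.of_bound (C := C) ?_ (Filter.Eventually.of_forall fun z => hC _)
  have h1 : Measurable fun z : Euc d × ℝ => chainStep S R β V dt q z.1 z.2 :=
    (hs.measurable_chainStep hV S R).comp measurable_prodMk_left
  exact (hψ.smooth.continuous.measurable.comp h1).aestronglyMeasurable

theorem IsSmallStep.measurable_evolution (hs : IsSmallStep β V dt L) (hV : ContDiff ℝ ∞ V)
    (S : Proposal) (R : AcceptanceRule) (hψ : SmoothBdd ψ) :
    Measurable (evolution S R β V dt ψ) := by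
  have h1 : Measurable (Function.uncurry fun (q : Euc d) (z : Euc d × ℝ) =>
      ψ (chainStep S R β V dt q z.1 z.2)) :=
    hψ.smooth.continuous.measurable.comp (hs.measurable_chainStep hV S R)
  exact (h1.stronglyMeasurable.integral_prod_right (ν := noiseLaw d)).measurable

theorem apply_chainStep (S : Proposal) (R : AcceptanceRule) (q g : Euc d) (u : ℝ) :
    ψ (chainStep S R β V dt q g u) = ψ q + (Set.Iic (acceptanceRate S R β V dt q g)).indicator
      (fun _ => ψ (proposalMap S β V dt q g) - ψ q) u := by
  unfold chainStep
  by_cases h : u ≤ acceptanceRate S R β V dt q g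
  · rw [if_pos h, Set.indicator_of_mem (by exact h)]
    simp
  · rw [if_neg h, Set.indicator_of_notMem (by exact h)]
    simp

/-- The accepted increment of `ψ`, averaged over the acceptance step. -/
def acceptedIncrement (S : Proposal) (R : AcceptanceRule) (β : ℝ) (V : Euc d → ℝ) (dt : ℝ)
    (ψ : Euc d → ℝ) (q g : Euc d) : ℝ :=
  acceptanceRate S R β V dt q g * (ψ (proposalMap S β V dt q g) - ψ q)

/-- By Fubini, integrating the uniform variable first turns the acceptance indicator into the
acceptance rate, because the latter lies in `[0, 1]`. -/
theorem IsSmallStep.evolution_sub (hs : IsSmallStep β V dt L) (hV : ContDiff ℝ ∞ V)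
    (S : Proposal) (R : AcceptanceRule) (hψ : SmoothBdd ψ) (q : Euc d) :
    Integrable (acceptedIncrement S R β V dt ψ q) (stdGaussian (Euc d)) ∧
    evolution S R β V dt ψ q - ψ q =
      ∫ g, acceptedIncrement S R β V dt ψ q g ∂(stdGaussian (Euc d)) := by
  obtain ⟨C, hC0, hC⟩ := hψ.exists_norm_le
  have hint : Integrable (acceptedIncrement S R β V dt ψ q) (stdGaussian (Euc d)) := by
    have hp : Continuous fun g : Euc d => (q, g) := by fun_prop
    have h1 := (hs.continuous_acceptanceRate hV S R).comp hp
    have h2 := hψ.smooth.continuous.comp ((hs.continuous_proposalMap hV S).comp hp)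
    refine Integrable.of_bound (C := 1 * (C + C))
      ((h1.mul (h2.sub continuous_const)).aestronglyMeasurable)
      (Filter.Eventually.of_forall fun g => ?_)
    rw [acceptedIncrement, norm_mul]
    have h3 := R.rate_mem (alphaExponent S β V dt q g)
    have h4 : ‖acceptanceRate S R β V dt q g‖ ≤ 1 := by
      rw [acceptanceRate, Real.norm_of_nonneg h3.1]
      exact h3.2
    have h5 : ‖ψ (proposalMap S β V dt q g) - ψ q‖ ≤ C + C :=
      (norm_sub_le _ _).trans (add_le_add (hC _) (hC _))
    exact mul_le_mul h4 h5 (norm_nonneg _) zero_le_one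
  refine ⟨hint, ?_⟩
  have hi := hs.integrable_chainStep hV S R hψ q
  have hinner : ∀ g, ∫ u, ψ (chainStep S R β V dt q g u) ∂(volume.restrict (Set.Icc (0 : ℝ) 1)) =
      ψ q + acceptedIncrement S R β V dt ψ q g := by
    intro g
    obtain ⟨r0, r1⟩ := R.rate_mem (alphaExponent S β V dt q g)
    change 0 ≤ acceptanceRate S R β V dt q g at r0
    change acceptanceRate S R β V dt q g ≤ 1 at r1
    simp_rw [apply_chainStep]
    rw [integral_add (integrable_const _) ((integrable_const _).indicator measurableSet_Iic),
      integral_indicator measurableSet_Iic, Measure.restrict_restrict measurableSet_Iic]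
    have e : Set.Iic (acceptanceRate S R β V dt q g) ∩ Set.Icc (0 : ℝ) 1 =
        Set.Icc 0 (acceptanceRate S R β V dt q g) := by
      ext u
      simp only [Set.mem_inter_iff, Set.mem_Iic, Set.mem_Icc]
      constructor
      · rintro ⟨h1, h2, -⟩; exact ⟨h2, h1⟩
      · rintro ⟨h1, h2⟩; exact ⟨h2, h1, h2.trans r1⟩
    rw [e]
    simp [acceptedIncrement, r0]
  rw [evolution]
  unfold noiseLaw at hi ⊢
  rw [integral_prod _ hi]
  simp only [hinner]
  rw [integral_add (integrable_const _) hint]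
  simp

theorem integral_comp_neg_stdGaussian (f : Euc d → ℝ) :
    ∫ g, f (-g) ∂(stdGaussian (Euc d)) = ∫ g, f g ∂(stdGaussian (Euc d)) := by
  have h := stdGaussian_map (LinearIsometryEquiv.neg ℝ (E := Euc d))
  have h2 := (LinearIsometryEquiv.neg ℝ (E := Euc d)).toHomeomorph.toMeasurableEquiv.measurableEmbedding.integral_map
    (μ := stdGaussian (Euc d)) f
  change ∫ y, f y ∂((stdGaussian (Euc d)).map (LinearIsometryEquiv.neg ℝ (E := Euc d))) = _ at h2
  rw [h] at h2
  exact h2.symm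

theorem integrable_comp_neg_stdGaussian {f : Euc d → ℝ} (hf : Integrable f (stdGaussian (Euc d))) :
    Integrable (fun g => f (-g)) (stdGaussian (Euc d)) := by
  have h := stdGaussian_map (LinearIsometryEquiv.neg ℝ (E := Euc d))
  rw [← h] at hf
  exact (LinearIsometryEquiv.neg ℝ (E := Euc d)).toHomeomorph.toMeasurableEquiv.measurableEmbedding.integrable_map_iff.1 hf

theorem exists_evolution_bound (S : Proposal) (R : AcceptanceRule) (hV : ContDiff ℝ ∞ V)
    (hΦ : SmoothBdd (scaledPotential β V)) (hF : SmoothBdd (∇ (scaledPotential β V)))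
    (hψ : SmoothBdd ψ) (L : ℝ) :
    ∃ C : ℝ, 0 ≤ C ∧ ∀ dt, IsSmallStep β V dt L → ∀ q,
      |evolution S R β V dt ψ q - ψ q - R.prefactor * (dt * (langevinGenerator β V ψ q
        + dt / 2 * langevinGenerator β V (langevinGenerator β V ψ) q))|
        ≤ C * √(2 * dt) ^ R.remainderOrder := by
  obtain ⟨C, N, hC, h⟩ := exists_symmetrised_bound R S.implicitness hΦ hF hψ
  have hK := integrable_one_add_norm_pow_stdGaussian (E := Euc d) N
  set K := ∫ g : Euc d, (1 + ‖g‖) ^ N ∂(stdGaussian (Euc d)) with hKdef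
  have hK0 : 0 ≤ K := integral_nonneg fun g => by positivity
  -- The mean over `g` of the accepted increments for `g` and `-g` is twice `P ψ - ψ`; hence the
  -- division by `2`.
  refine ⟨C * K / 2, by positivity, fun dt hs q => ?_⟩
  obtain ⟨hX, hE⟩ := hs.evolution_sub hV S R hψ q
  have hX' := integrable_comp_neg_stdGaussian hX
  have hsq : √(2 * dt) ^ 2 = 2 * dt := Real.sq_sqrt (by linarith [hs.pos])
  set η := √(2 * dt) with hη
  have hT := (((hasGaussianMean_incrCoeff₂ (Φ := scaledPotential β V) hψ.smooth q).const_mul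
    (η ^ 2)).add (((hasGaussianMean_acceptedCoeff S.implicitness hΦ.smooth hψ.smooth q).const_mul
    2).const_mul (η ^ 4))).const_mul (2 * R.prefactor)
  have hbound : ∀ g : Euc d, ‖acceptedIncrement S R β V dt ψ q g
      + acceptedIncrement S R β V dt ψ q (-g) - 2 * R.prefactor *
        (η ^ 2 * incrCoeff₂ (scaledPotential β V) ψ (q, g)
          + η ^ 4 * (2 * acceptedCoeff S.implicitness (scaledPotential β V) ψ (q, g)))‖
      ≤ C * η ^ R.remainderOrder * (1 + ‖g‖) ^ N := by
    intro g
    have h1 := h q g η _ _ _ _ hs.sqrt_pos hs.sqrt_le_one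
      (isDisplacement_of_isProposedMove hV hs.pos (hs.proposalMap_spec S q g))
      (isDisplacement_of_isProposedMove hV hs.pos (hs.proposalMap_spec S q (-g)))
    rw [add_sub_cancel, add_sub_cancel,
      ← alphaExponent_eq_dispExponent hV hs.pos (hs.existsUnique S q g),
      ← alphaExponent_eq_dispExponent hV hs.pos (hs.existsUnique S q (-g))] at h1
    refine h1.trans (le_of_eq ?_)
    ring
  have h2 := norm_integral_le_of_norm_le (hK.const_mul (C * η ^ R.remainderOrder))
    (Filter.Eventually.of_forall hbound)
  have hXX : Integrable (fun g => acceptedIncrement S R β V dt ψ q g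
      + acceptedIncrement S R β V dt ψ q (-g)) (stdGaussian (Euc d)) := hX.add hX'
  rw [integral_const_mul, integral_sub hXX hT.integrable, integral_add hX hX',
    integral_comp_neg_stdGaussian, hT.integral_eq, ← hE, ← hKdef, Real.norm_eq_abs] at h2
  have hgen : langevinGenerator β V ψ = coordGenerator (scaledPotential β V) ψ :=
    langevinGenerator_eq_coordGenerator hV hψ.smooth
  have hgen2 : langevinGenerator β V (langevinGenerator β V ψ) =
      coordGenerator (scaledPotential β V) (coordGenerator (scaledPotential β V) ψ) := by
    rw [hgen]
    exact langevinGenerator_eq_coordGenerator hV (contDiff_coordGenerator hΦ.smooth hψ.smooth)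
  rw [hgen2, hgen]
  have h4 : η ^ 4 = 4 * dt ^ 2 := by
    calc η ^ 4 = (η ^ 2) ^ 2 := by ring
      _ = _ := by rw [hsq]; ring
  rw [hsq, h4] at h2
  rw [abs_le] at h2 ⊢
  constructor <;> linarith [h2.1, h2.2]

end Evolution

/-! ### Invariance under lattice translations -/

section Periodicity

variable {d : ℕ} {β dt L : ℝ} {V ψ : Euc d → ℝ} {u : Euc d}

theorem isProposedMove_add (hV : Function.Periodic V u) {S : Proposal} {q g Q : Euc d}
    (h : IsProposedMove β V dt q g S Q) : IsProposedMove β V dt (q + u) g S (Q + u) := by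
  have hg := periodic_gradient hV
  cases S with
  | midpoint =>
    simp only [IsProposedMove] at h ⊢
    rw [show (1 / 2 : ℝ) • (Q + u + (q + u)) = (1 / 2 : ℝ) • (Q + q) + u by module, hg]
    nth_rw 1 [h]
    abel
  | hmc =>
    simp only [IsProposedMove] at h ⊢
    rw [show q + u + (√(2 * dt) / 2) • g = q + (√(2 * dt) / 2) • g + u by abel, hg, h]
    abel

/-- The proposal is obtained by choice, so equivariance has to come from uniqueness of the solution.
-/
theorem IsSmallStep.proposalMap_add (hs : IsSmallStep β V dt L) (hV : Function.Periodic V u)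
    (S : Proposal) (q g : Euc d) :
    proposalMap S β V dt (q + u) g = proposalMap S β V dt q g + u :=
  (hs.existsUnique S (q + u) g).unique (hs.proposalMap_spec S _ _)
    (isProposedMove_add hV (hs.proposalMap_spec S q g))

theorem IsSmallStep.acceptanceRate_add (hs : IsSmallStep β V dt L) (hVs : ContDiff ℝ ∞ V)
    (hV : Function.Periodic V u) (S : Proposal) (R : AcceptanceRule) (q g : Euc d) :
    acceptanceRate S R β V dt (q + u) g = acceptanceRate S R β V dt q g := by
  have hΦ : Function.Periodic (scaledPotential β V) u := fun x => by
    simp only [scaledPotential, hV x]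
  have hF := periodic_gradient hΦ
  rw [acceptanceRate, acceptanceRate,
    alphaExponent_eq_dispExponent hVs hs.pos (hs.existsUnique S (q + u) g),
    alphaExponent_eq_dispExponent hVs hs.pos (hs.existsUnique S q g), hs.proposalMap_add hV,
    add_sub_add_right_eq_sub]
  simp only [dispExponent, add_right_comm q u, hF _, hΦ _]

theorem IsSmallStep.periodic_evolution (hs : IsSmallStep β V dt L) (hVs : ContDiff ℝ ∞ V)
    (hV : Function.Periodic V u) (hψ : Function.Periodic ψ u) (S : Proposal)
    (R : AcceptanceRule) : Function.Periodic (evolution S R β V dt ψ) u := by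
  intro q
  unfold evolution
  congr 1
  funext z
  rw [apply_chainStep (ψ := ψ), apply_chainStep (ψ := ψ), hs.acceptanceRate_add hVs hV, hs.proposalMap_add hV,
    hψ, hψ]

theorem periodic_coordGenerator {Φ φ : Euc d → ℝ} (hΦ : Function.Periodic Φ u)
    (hφ : Function.Periodic φ u) : Function.Periodic (coordGenerator Φ φ) u := by
  intro x
  simp only [coordGenerator, periodic_dirDeriv hΦ _ x, periodic_dirDeriv hφ _ x,
    periodic_dirDeriv (periodic_dirDeriv hφ _) _ x]

end Periodicity

/-! ### From powers of `√(2Δt)` to powers of `Δt`, and the theorem -/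

theorem AcceptanceRule.sqrt_pow_remainderOrder_le (R : AcceptanceRule) {dt : ℝ} (hdt : 0 < dt) :
    √(2 * dt) ^ R.remainderOrder ≤ 8 * (dt ^ R.order * dt) := by
  have hsq : √(2 * dt) ^ 2 = 2 * dt := Real.sq_sqrt (by linarith)
  cases R with
  | barker =>
    simp only [remainderOrder, order]
    rw [Real.rpow_ofNat]
    have : √(2 * dt) ^ 6 = (√(2 * dt) ^ 2) ^ 3 := by ring
    rw [this, hsq]
    exact le_of_eq (by ring)
  | metropolis =>
    simp only [remainderOrder, order]
    have e1 : dt ^ (3 / 2 : ℝ) = dt * √dt := by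
      rw [show (3 / 2 : ℝ) = 1 + 1 / 2 by norm_num, Real.rpow_add hdt, Real.rpow_one,
        ← Real.sqrt_eq_rpow]
    have e2 : √(2 * dt) ^ 5 = (√(2 * dt) ^ 2) ^ 2 * √(2 * dt) := by ring
    have e3 : √(2 * dt) ≤ 2 * √dt := by
      rw [Real.sqrt_le_left (by positivity), mul_pow, Real.sq_sqrt hdt.le]
      linarith
    rw [e1, e2, hsq]
    calc (2 * dt) ^ 2 * √(2 * dt) ≤ (2 * dt) ^ 2 * (2 * √dt) := by gcongr
      _ = _ := by ring

end

theorem lemma3 {d : ℕ} (b : Module.Basis (Fin d) ℝ (Euc d)) (β : ℝ) (hβ : 0 < β)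
    (V : Euc d → ℝ) (hV : SmoothOnTorus b V) (S : Proposal) (R : AcceptanceRule)
    (ψ : Euc d → ℝ) (hψ : SmoothOnTorus b ψ) :
    ∃ dtStar : ℝ, 0 < dtStar ∧
      -- the proposal and the expectation defining the evolution operator make sense
      (∀ dt ∈ Set.Ioc 0 dtStar,
        (∀ q g, ∃! Q, IsProposedMove β V dt q g S Q) ∧
        ∀ q, Integrable (fun z : Euc d × ℝ => ψ (chainStep S R β V dt q z.1 z.2)) (noiseLaw d)) ∧
      -- the expansion, with a remainder which is uniformly bounded on the torus
      ∃ (r : ℝ → Euc d → ℝ) (C : ℝ), ∀ dt ∈ Set.Ioc 0 dtStar,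
        Measurable (r dt) ∧ LatticePeriodic b (r dt) ∧ (∀ q, |r dt q| ≤ C) ∧
        ∀ q, discreteGenerator S R β V dt ψ q =
          R.prefactor * (langevinGenerator β V ψ q
            + dt / 2 * langevinGenerator β V (langevinGenerator β V ψ) q)
          + dt ^ R.order * r dt q := by
  obtain ⟨hVs, hVp⟩ := hV
  obtain ⟨hψs, hψp⟩ := hψ
  have hΦs : ContDiff ℝ ∞ (scaledPotential β V) := contDiff_scaledPotential hVs
  have hΦp : ∀ i, Function.Periodic (scaledPotential β V) (b i) := fun i x => by
    simp only [scaledPotential, hVp i x]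
  have hΦ : SmoothBdd (scaledPotential β V) := smoothBdd_of_periodic b hΦs hΦp
  have hF : SmoothBdd (∇ (scaledPotential β V)) :=
    smoothBdd_of_periodic b (contDiff_gradient hΦs) fun i => periodic_gradient (hΦp i)
  have hψb : SmoothBdd ψ := smoothBdd_of_periodic b hψs hψp
  obtain ⟨L, hL0, hL⟩ := hF.exists_lipschitz
  -- `dt (2 + L) ≤ 1` yields both `dt ≤ 1 / 2`, so that `h ≤ 1`, and `dt L ≤ 1`, needed for the
  -- contraction.
  have hsmall : ∀ dt ∈ Set.Ioc 0 (1 / (2 + L)), IsSmallStep β V dt L := by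
    rintro dt ⟨h0, h1⟩
    rw [le_div_iff₀ (by linarith)] at h1
    refine ⟨h0, by nlinarith, fun x y => ?_, by nlinarith⟩
    have := hL x y
    rw [gradient_scaledPotential hVs, gradient_scaledPotential hVs, ← neg_sub', norm_neg] at this
    exact this
  obtain ⟨C, hC0, hC⟩ := exists_evolution_bound S R hVs hΦ hF hψb L
  have hgen : langevinGenerator β V ψ = coordGenerator (scaledPotential β V) ψ :=
    langevinGenerator_eq_coordGenerator hVs hψs
  have hgs := contDiff_coordGenerator hΦs hψs
  have hgen2 : langevinGenerator β V (langevinGenerator β V ψ) =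
      coordGenerator (scaledPotential β V) (coordGenerator (scaledPotential β V) ψ) := by
    rw [hgen]
    exact langevinGenerator_eq_coordGenerator hVs hgs
  refine ⟨1 / (2 + L), by positivity, fun dt hdt => ⟨(hsmall dt hdt).existsUnique S,
    (hsmall dt hdt).integrable_chainStep hVs S R hψb⟩,
    -- The remainder is defined by solving the expansion for it; the content lies in its bound,
    -- measurability and periodicity.
    fun dt q => (discreteGenerator S R β V dt ψ q - R.prefactor * (langevinGenerator β V ψ q
      + dt / 2 * langevinGenerator β V (langevinGenerator β V ψ) q)) / dt ^ R.order,
    C * 8, fun dt hdt => ?_⟩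
  have hs := hsmall dt hdt
  have hpow : 0 < dt ^ R.order := Real.rpow_pos_of_pos hs.pos _
  refine ⟨?_, fun i q => ?_, fun q => ?_, fun q => ?_⟩
  · have m1 := hs.measurable_evolution hVs S R hψb
    have m2 : Measurable (langevinGenerator β V ψ) := by
      rw [hgen]; exact hgs.continuous.measurable
    have m3 : Measurable (langevinGenerator β V (langevinGenerator β V ψ)) := by
      rw [hgen2]; exact (contDiff_coordGenerator hΦs hgs).continuous.measurable
    have m4 := hψs.continuous.measurable
    exact ((((m1.sub m4).div_const _).sub ((m2.add (m3.const_mul _)).const_mul _))).div_const _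
  · have p1 := periodic_coordGenerator (hΦp i) (hψp i)
    rw [hgen2, hgen]
    simp only [discreteGenerator]
    rw [hs.periodic_evolution hVs (hVp i) (hψp i) S R q, hψp i q, p1 q,
      periodic_coordGenerator (hΦp i) p1 q]
  · have h1 := hC dt hs q
    have e : (discreteGenerator S R β V dt ψ q - R.prefactor * (langevinGenerator β V ψ q
        + dt / 2 * langevinGenerator β V (langevinGenerator β V ψ) q)) / dt ^ R.order =
        (evolution S R β V dt ψ q - ψ q - R.prefactor * (dt * (langevinGenerator β V ψ q
        + dt / 2 * langevinGenerator β V (langevinGenerator β V ψ) q))) / (dt ^ R.order * dt) := by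
      have := hs.pos.ne'
      rw [discreteGenerator]
      field_simp
    beta_reduce
    rw [e, abs_div, abs_of_pos (mul_pos hpow hs.pos), div_le_iff₀ (mul_pos hpow hs.pos)]
    calc _ ≤ C * √(2 * dt) ^ R.remainderOrder := h1
      _ ≤ C * (8 * (dt ^ R.order * dt)) := by
        gcongr
        exact R.sqrt_pow_remainderOrder_le hs.pos
      _ = _ := by ring
  · beta_reduce
    rw [mul_div_cancel₀ _ hpow.ne']
    ring
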